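/- **Setting.** Let $n\ge 1$, $\lambda_0,\lambda^{[1]}\in\mathbb C$ with $\Im\lambda_0\neq 0$, $\lambda^{[1]}\ne 0$. For $1\le k\le n$ put $a_k=\frac{2\Im\lambda_0}{n+1}\csc\frac{k\pi}{n+1}$, $b_k=\frac{2\Im\lambda_0}{n+1}\cot\frac{k\pi}{n+1}-2\Re\lambda_0$, $\chi_0=2\Re\lambda_0+\mathrm i\frac{2\Im\lambda_0}{n+1}$, and $q^{[0]}_k(x,t)=a_k\exp\bigl(\mathrm i(b_kx+(-\tfrac{b_k^2}{2}+\|\mathbf a\|_2^2)t)\bigr)$. Let $\lambda(\varepsilon)=\lambda_0+\lambda^{[1]}\varepsilon^{n+1}$ and let $\chi(\varepsilon)=\chi_0+\sum_{i\ge1}\chi^{[i]}\varepsilon^i$ be a power series with $$\Bigl(\chi-2\lambda-\sum_{i=1}^n\frac{a_i^2}{\chi+b_i}\Bigr)\prod_{j=1}^n(\chi+b_j)=0 .$$ Define $\alpha_j,\beta_j,h_{1,j},h^{[k]}_{2,j}$ by $\mathrm i(\chi-\lambda)=\sum_{j\ge0}\alpha_j\varepsilon^j$, $\frac{\chi^2}{2}-\lambda^2-\|\mathbf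 a\|_2^2=\sum_{j\ge0}\beta_j\varepsilon^j$, $\ln\Bigl(\frac{\chi_0-\chi_0^*}{\chi^{[1]}\varepsilon}\frac{\chi-\chi_0}{\chi-\chi_0^*}\Bigr)=\sum_{j\ge1}h_{1,j}\varepsilon^j$, $\ln\frac{\chi+b_k}{\chi_0+b_k}=\sum_{j\ge1}h^{[k]}_{2,j}\varepsilon^j$, and let $C_1=|\chi^{[1]}|^2/|\chi_0-\chi_0^*|^2$. The Schur polynomials $S_j$ are given by $\sum_{j\ge0} S_j(\mathbf z)\varepsilon^j=\exp(\sum_{j\ge1}z_j\varepsilon^j)$. **The rogue wave.** Let $\mathcal N=[N_1,\dots,N_n]$ with integers $N_l\ge0$ and $N=\sum_l N_l$. For complex parameters $d_{l,j}$ let $x^{[l,+]}_j=\alpha_jx+\beta_j\mathrm i t+d_{l,j}$ and $\mathbf x^{[l,-]}=(\mathbf x^{[l,+]})^*$, put $\mathbf h_2^{[0]}=0$, and for $0\le s\le n$ let $$\tau^{[s;l_1,l_2]}_{i,j}=\sum_{v=0}^{\min(i,j)}C_1^v\,S_{i-v}\bigl(\mathbf x^{[l_1,-]}+v\mathbf h_1^*+(\mathbf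 h_2^{[s]})^*\bigr)\,S_{j-v}\bigl(\mathbf x^{[l_2,+]}+v\mathbf h_1-\mathbf h_2^{[s]}\bigr).$$ Let $\mathbf M^{[s]}$ be the $N\times N$ matrix of $n\times n$ blocks, whose block $(l_1,l_2)$ is $\bigl(\tau^{[s;l_1,l_2]}_{(n+1)(i-1)+l_1,(n+1)(j-1)+l_2}\bigr)_{1\le i\le N_{l_1},1\le j\le N_{l_2}}$, and $q_k^{\mathcal N}=q_k^{[0]}\det\mathbf M^{[k]}/\det\mathbf M^{[0]}$. The normalized first-order rogue wave is $$\hat q_k^{[1]}(x,t)=1+\frac{2\mathrm i}{|\chi_0+b_k|^2}\,\frac{(\Re\chi_0+b_k)(x+t\,\Re\chi_0)-(\Im\chi_0)^2t+\frac{\mathrm i}{2}}{(x+t\,\Re\chi_0)^2+(\Im\chi_0)^2t^2+\frac1{4(\Im\chi_0)^2}} .$$ **The polynomial.** For complex constants $\kappa_{l,j}$ ($1\le l\le n$, $j\ge1$, $(n+1)\nmid j$) let $\sum_{j\ge0}\varphi_{l,j}(z)\varepsilon^j=\exp\bigl(z\varepsilon+\sum_{(n+1)\nmid i}\kappa_{l,i}\varepsilon^i\bigr)$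 and $\varphi_{l,j}=0$ for $j<0$. List the pairs $(l,p)$, $1\le l\le n$, $0\le p<N_l$, in lexicographic order as $(l_1,p_1),\dots,(l_N,p_N)$. Let $W_{\mathcal N}=c_{\mathcal N}\det\bigl(\varphi^{(i-1)}_{l_j,(n+1)p_j+l_j}\bigr)_{1\le i,j\le N}$, where the constant $c_{\mathcal N}$ makes $W_{\mathcal N}$ monic, and $$W^{[2]}_{\mathcal N}=c_{\mathcal N}\bigl[\det\bigl(\varphi_{l_j,(n+1)p_j+l_j-\bar p_i}\bigr)+\det\bigl(\varphi_{l_j,(n+1)p_j+l_j-\hat p_i}\bigr)\bigr],$$ where $\bar p_{N-1}=N$, $\hat p_N=N+1$, and $\bar p_i=i-1$, $\hat p_i=i-1$ for all other $i$. **Theorem.** Suppose that all roots of $W_{\mathcal N}$ are simple, and let $d_{l,j}=\kappa_{l,j}A^j$ for $(n+1)\nmid j$ and $d_{l,j}=0$ for $(n+1)\mid j$. For a root $\bar z_0$ of $W_{\mathcal N}$ let $(\hat x_0,\hat t_0)\in\mathbb R^2$ and $(\bar x_0,\bar t_0)\in\mathbb R^2$ be given by $\mathrm i\chi^{[1]}(\hat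 x_0+\chi_0\hat t_0)=\bar z_0$ and $$\mathrm i\chi^{[1]}(\bar x_0+\chi_0\bar t_0)=\bar z_0A-\Delta(\bar z_0),\qquad \Delta(\bar z_0)=(\alpha_2\hat x_0+\beta_2\mathrm i\hat t_0)\frac{W_{\mathcal N}^{[2]}(\bar z_0)}{W_{\mathcal N}'(\bar z_0)} .$$ Then the solution splits, as $A\to+\infty$, into $\Gamma$ first-order rogue waves on the plane wave background, in the following sense. 1. $\deg W_{\mathcal N}=\Gamma:=\sum_{l}\frac{N_l}{2}(n(N_l-1)+2l)-\sum_{l<k}N_lN_k$, $W_{\mathcal N}$ has exactly $\Gamma$ distinct roots, and the distance of the positions $(\bar x_0,\bar t_0)$ of any two distinct roots tends to infinity as $A\to+\infty$. The denominator $\det\mathbf M^{[0]}$ vanishes for no real $A,x,t$. 2. For every root $\bar z_0$ and every $R>0$ there are $K$ and $A_0>0$ such that for all $A\ge A_0$, all $(x,t)$ with $\sqrt{(x-\bar x_0)^2+(t-\bar t_0)^2}\le R$ and all $1\le k\le n$, $$\bigl|q_k^{\mathcal N}(x,t)-\hat q_k^{[1]}(x-\bar x_0,t-\bar t_0)\,q_k^{[0]}(x,t)\bigr|\le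 K A^{-1}.$$ 3. For every $\epsilon>0$ there are $R$ and $A_0>0$ such that for all $A\ge A_0$, all $(x,t)$ whose distance from each of the points $(\bar x_0,\bar t_0)$ is at least $R$ and all $1\le k\le n$, $|q_k^{\mathcal N}(x,t)-q_k^{[0]}(x,t)|<\epsilon$. -/

import Mathlib

noncomputable section

namespace RogueWave

/-- The elementary Schur polynomials `S_j`, `j ∈ ℕ`, over a commutative `ℚ`-algebra:
`∑_j S_j(z) ε^j = exp (∑_{j ≥ 1} z_j ε^j)` (the entry `z 0` is not used). -/
def schur {R : Type*} [CommRing R] [Algebra ℚ R] (z : ℕ → R) (j : ℕ) : R :=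
  PowerSeries.coeff j
    ((PowerSeries.exp R).subst (PowerSeries.mk fun i => if i = 0 then 0 else z i))

/-! ### The plane wave background and the spectral data -/

/-- The amplitudes `a_k`; the index `k : Fin n` stands for `k + 1 ∈ {1, …, n}`. -/
def amp (n : ℕ) (lam0 : ℂ) (k : Fin n) : ℝ :=
  2 * lam0.im / (n + 1) * (Real.sin (((k : ℕ) + 1 : ℝ) * Real.pi / (n + 1)))⁻¹

/-- The wave numbers `b_k`. -/
def wav (n : ℕ) (lam0 : ℂ) (k : Fin n) : ℝ :=
  2 * lam0.im / (n + 1) * Real.cot (((k : ℕ) + 1 : ℝ) * Real.pi / (n + 1)) - 2 * lam0.re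

/-- `‖a‖₂²`. -/
def ampSq (n : ℕ) (lam0 : ℂ) : ℝ := ∑ k, amp n lam0 k ^ 2

/-- The plane wave seed solution `q_k^{[0]}(x,t) = a_k exp (i θ_k)`. -/
def planeWave (n : ℕ) (lam0 : ℂ) (k : Fin n) (x t : ℝ) : ℂ :=
  (amp n lam0 k : ℂ) * Complex.exp (Complex.I *
    ((wav n lam0 k * x + (-(wav n lam0 k) ^ 2 / 2 + ampSq n lam0) * t : ℝ) : ℂ))

/-- The multiple characteristic root `χ₀`. -/
def chi0 (n : ℕ) (lam0 : ℂ) : ℂ :=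
  2 * (lam0.re : ℂ) + Complex.I * ((2 * lam0.im / (n + 1) : ℝ) : ℂ)

/-- The perturbed spectral parameter `λ(ε) = λ₀ + λ^{[1]} ε^{n+1}`. -/
def lamSeries (n : ℕ) (lam0 lam1 : ℂ) : PowerSeries ℂ :=
  PowerSeries.C lam0 + PowerSeries.C lam1 * PowerSeries.X ^ (n + 1)

/-- `χ(ε) = χ₀ + ∑_{i ≥ 1} χ^{[i]} ε^i` satisfies the characteristic equation at `λ(ε)`.
All the series `χ(ε) + b_i` have a nonzero constant term, so `⁻¹` is the true inverse. -/
def IsCharBranch (n : ℕ) (lam0 lam1 : ℂ) (chi : PowerSeries ℂ) : Prop :=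
  PowerSeries.constantCoeff chi = chi0 n lam0 ∧
  (chi - 2 * lamSeries n lam0 lam1
      - ∑ i, PowerSeries.C ((amp n lam0 i : ℂ) ^ 2) *
          (chi + PowerSeries.C (wav n lam0 i : ℂ))⁻¹)
    * ∏ j, (chi + PowerSeries.C (wav n lam0 j : ℂ)) = 0

/-- `χ^{[1]}`. -/
def chi1 (chi : PowerSeries ℂ) : ℂ := PowerSeries.coeff 1 chi

/-- `α_j`, the coefficients of `i (χ(ε) - λ(ε))`. -/
def alpha (n : ℕ) (lam0 lam1 : ℂ) (chi : PowerSeries ℂ) (j : ℕ) : ℂ :=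
  PowerSeries.coeff j (PowerSeries.C Complex.I * (chi - lamSeries n lam0 lam1))

/-- `β_j`, the coefficients of `χ(ε)² / 2 - λ(ε)² - ‖a‖₂²`. -/
def beta (n : ℕ) (lam0 lam1 : ℂ) (chi : PowerSeries ℂ) (j : ℕ) : ℂ :=
  PowerSeries.coeff j (PowerSeries.C (1 / 2 : ℂ) * chi ^ 2 - lamSeries n lam0 lam1 ^ 2
    - PowerSeries.C (ampSq n lam0 : ℂ))

/-- `h_{1,j}`, the coefficients of
`ln ((χ₀ - χ₀*) / (χ^{[1]} ε) · (χ(ε) - χ₀) / (χ(ε) - χ₀*))`; the series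
`(χ(ε) - χ₀) / ε` is the shift of the coefficients of `χ(ε)` by one. -/
def h1 (n : ℕ) (lam0 : ℂ) (chi : PowerSeries ℂ) (j : ℕ) : ℂ :=
  PowerSeries.coeff j (PowerSeries.logOf
    (PowerSeries.C ((chi0 n lam0 - star (chi0 n lam0)) / chi1 chi) *
      (PowerSeries.mk fun i => PowerSeries.coeff (i + 1) chi) *
      (chi - PowerSeries.C (star (chi0 n lam0)))⁻¹))

/-- `h_{2,j}^{[k]}`, the coefficients of `ln ((χ(ε) + b_k) / (χ₀ + b_k))`. -/
def h2 (n : ℕ) (lam0 : ℂ) (chi : PowerSeries ℂ) (k : Fin n) (j : ℕ) : ℂ :=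
  PowerSeries.coeff j (PowerSeries.logOf
    (PowerSeries.C (chi0 n lam0 + (wav n lam0 k : ℂ))⁻¹ *
      (chi + PowerSeries.C (wav n lam0 k : ℂ))))

/-- `C₁ = |χ^{[1]}|² / |χ₀ - χ₀*|²`. -/
def C1 (n : ℕ) (lam0 : ℂ) (chi : PowerSeries ℂ) : ℝ :=
  ‖chi1 chi‖ ^ 2 / ‖chi0 n lam0 - star (chi0 n lam0)‖ ^ 2

/-! ### The high-order vector rogue wave `q^𝒩` -/

/-- `x_j^{[l,+]} = α_j x + β_j i t + d_{l,j}`; its conjugate is `x_j^{[l,-]}`. -/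
def xPlus (n : ℕ) (lam0 lam1 : ℂ) (chi : PowerSeries ℂ) (d : Fin n → ℕ → ℂ)
    (l : Fin n) (x t : ℝ) (j : ℕ) : ℂ :=
  alpha n lam0 lam1 chi j * x + beta n lam0 lam1 chi j * Complex.I * t + d l j

/-- The shift which turns `τ^{[0]}` into `τ^{[k]}`: `none` (the case `s = 0`) gives zero and
`some k` gives `h_2^{[k]}`. -/
def shift2 (n : ℕ) (lam0 : ℂ) (chi : PowerSeries ℂ) : Option (Fin n) → ℕ → ℂ
  | none => 0
  | some k => h2 n lam0 chi k

/-- The element `τ_{i,j}^{[s; l₁, l₂]}`. -/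
def tau (n : ℕ) (lam0 lam1 : ℂ) (chi : PowerSeries ℂ) (d : Fin n → ℕ → ℂ) (x t : ℝ)
    (s : Option (Fin n)) (l₁ l₂ : Fin n) (i j : ℕ) : ℂ :=
  ∑ v ∈ Finset.range (min i j + 1), (C1 n lam0 chi : ℂ) ^ v *
    schur (fun m => star (xPlus n lam0 lam1 chi d l₁ x t m) + v * star (h1 n lam0 chi m)
      + star (shift2 n lam0 chi s m)) (i - v) *
    schur (fun m => xPlus n lam0 lam1 chi d l₂ x t m + v * h1 n lam0 chi m
      - shift2 n lam0 chi s m) (j - v)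

/-- The row or column number `(n+1)(p-1) + l` that belongs to place `p` of block `l` (both of
them counted from zero here). -/
def deg {n : ℕ} {N : Fin n → ℕ} (c : (l : Fin n) × Fin (N l)) : ℕ :=
  (n + 1) * (c.2 : ℕ) + ((c.1 : ℕ) + 1)

/-- The block matrix `M^{[s]}`. -/
def Mmat (n : ℕ) (lam0 lam1 : ℂ) (chi : PowerSeries ℂ) (N : Fin n → ℕ) (d : Fin n → ℕ → ℂ)
    (x t : ℝ) (s : Option (Fin n)) :
    Matrix ((l : Fin n) × Fin (N l)) ((l : Fin n) × Fin (N l)) ℂ :=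
  Matrix.of fun r c => tau n lam0 lam1 chi d x t s r.1 c.1 (deg r) (deg c)

/-- The `𝒩`-order vector rogue wave `q_k^𝒩 = q_k^{[0]} det M^{[k]} / det M^{[0]}`. -/
def qRW (n : ℕ) (lam0 lam1 : ℂ) (chi : PowerSeries ℂ) (N : Fin n → ℕ) (d : Fin n → ℕ → ℂ)
    (k : Fin n) (x t : ℝ) : ℂ :=
  planeWave n lam0 k x t * ((Mmat n lam0 lam1 chi N d x t (some k)).det /
    (Mmat n lam0 lam1 chi N d x t none).det)

/-- The normalized first-order rogue wave `q̂_k^{[1]}`. -/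
def qHat (n : ℕ) (lam0 : ℂ) (k : Fin n) (x t : ℝ) : ℂ :=
  1 + 2 * Complex.I / ((‖chi0 n lam0 + (wav n lam0 k : ℂ)‖ ^ 2 : ℝ) : ℂ) *
    (((((chi0 n lam0).re + wav n lam0 k) * (x + (chi0 n lam0).re * t)
        - (chi0 n lam0).im ^ 2 * t : ℝ) : ℂ) + Complex.I / 2) /
    (((x + (chi0 n lam0).re * t) ^ 2 + (chi0 n lam0).im ^ 2 * t ^ 2
        + 1 / (4 * (chi0 n lam0).im ^ 2) : ℝ) : ℂ)

/-- The large internal parameters `d_{l,j} = κ_{l,j} A^j`, with `d_{l,j} = 0` if `(n+1) ∣ j`. -/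
def largeParam (n : ℕ) (kap : Fin n → ℕ → ℂ) (A : ℝ) (l : Fin n) (j : ℕ) : ℂ :=
  if (n + 1) ∣ j then 0 else kap l j * (A : ℂ) ^ j

/-! ### Generalized mixed Adler–Moser polynomials -/

/-- `φ_{l,j}(z)`:
`∑_j φ_{l,j}(z) ε^j = exp (z ε + ∑_{i ≥ 1, (n+1) ∤ i} κ_{l,i} ε^i)`, for `j ∈ ℕ`. -/
def phi (n : ℕ) (kap : Fin n → ℕ → ℂ) (l : Fin n) (j : ℕ) : Polynomial ℂ :=
  schur (fun i => (if i = 1 then Polynomial.X else 0) +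
    (if (n + 1) ∣ i then 0 else Polynomial.C (kap l i))) j

/-- `φ_{l,j}(z)` for `j ∈ ℤ`, with the value `0` for `j < 0`. -/
def phiZ (n : ℕ) (kap : Fin n → ℕ → ℂ) (l : Fin n) (j : ℤ) : Polynomial ℂ :=
  if 0 ≤ j then phi n kap l j.toNat else 0

/-- The block and the place of column `j ∈ {0, …, N - 1}` (blocks in increasing order). -/
def col {n : ℕ} (N : Fin n → ℕ) (j : Fin (∑ l, N l)) : (l : Fin n) × Fin (N l) :=
  finSigmaFinEquiv.symm j

/-- The Wronskian of the polynomials `φ_{l,(n+1)(p-1)+l}`, `1 ≤ l ≤ n`, `1 ≤ p ≤ N_l`. -/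
def gmamWronskian (n : ℕ) (N : Fin n → ℕ) (kap : Fin n → ℕ → ℂ) : Polynomial ℂ :=
  (Matrix.of fun i j : Fin (∑ l, N l) =>
    (Polynomial.derivative^[(i : ℕ)]) (phi n kap (col N j).1 (deg (col N j)))).det

/-- The constant `c_𝒩`, which makes the polynomial monic. -/
def gmamConst (n : ℕ) (N : Fin n → ℕ) (kap : Fin n → ℕ → ℂ) : ℂ :=
  (gmamWronskian n N kap).leadingCoeff⁻¹

/-- The monic GMAM polynomial `W_𝒩`. -/
def gmam (n : ℕ) (N : Fin n → ℕ) (kap : Fin n → ℕ → ℂ) : Polynomial ℂ :=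
  Polynomial.C (gmamConst n N kap) * gmamWronskian n N kap

/-- `det (φ_{l_j, (n+1) p_j + l_j - p_i})` for given row shifts `p_i`. -/
def shiftedDet (n : ℕ) (N : Fin n → ℕ) (kap : Fin n → ℕ → ℂ) (p : Fin (∑ l, N l) → ℕ) :
    Polynomial ℂ :=
  (Matrix.of fun i j : Fin (∑ l, N l) =>
    phiZ n kap (col N j).1 ((deg (col N j) : ℤ) - (p i : ℤ))).det

/-- `W_𝒩^{[2]}`: the sum of the two determinants with row shifts `0, …, N-3, N, N-1` and
`0, …, N-2, N+1`. -/
def gmam2 (n : ℕ) (N : Fin n → ℕ) (kap : Fin n → ℕ → ℂ) : Polynomial ℂ :=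
  Polynomial.C (gmamConst n N kap) *
    (shiftedDet n N kap (fun i => if (i : ℕ) + 2 = ∑ l, N l then ∑ l, N l else (i : ℕ)) +
     shiftedDet n N kap (fun i => if (i : ℕ) + 1 = ∑ l, N l then (∑ l, N l) + 1 else (i : ℕ)))

/-- The degree formula `Γ = ∑_l N_l (n (N_l - 1) + 2 l) / 2 - ∑_{l < k} N_l N_k`. -/
def Gam (n : ℕ) (N : Fin n → ℕ) : ℚ :=
  ∑ l : Fin n, (N l : ℚ) / 2 * (n * ((N l : ℚ) - 1) + 2 * ((l : ℕ) + 1 : ℚ))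
    - ∑ l : Fin n, ∑ k ∈ Finset.univ.filter (fun k => l < k), (N l : ℚ) * (N k : ℚ)

/-! ### Positions of the first-order rogue waves -/

/-- The real point `(x, t)` with `i χ^{[1]} (x + χ₀ t) = w`. -/
def planePoint (n : ℕ) (lam0 : ℂ) (chi : PowerSeries ℂ) (w : ℂ) : ℝ × ℝ :=
  let u := w / (Complex.I * chi1 chi)
  (u.re - (chi0 n lam0).re * (u.im / (chi0 n lam0).im), u.im / (chi0 n lam0).im)

theorem planePoint_iff (n : ℕ) (lam0 : ℂ) (chi : PowerSeries ℂ) (w : ℂ)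
    (h0 : lam0.im ≠ 0) (h1 : chi1 chi ≠ 0) (x t : ℝ) :
    planePoint n lam0 chi w = (x, t) ↔
      Complex.I * chi1 chi * ((x : ℂ) + chi0 n lam0 * t) = w := by
  have him : (chi0 n lam0).im ≠ 0 := by
    have : (chi0 n lam0).im = 2 * lam0.im / (n + 1) := by
      rw [chi0, Complex.add_im, Complex.I_mul_im, Complex.ofReal_re]
      simp
    rw [this]
    exact div_ne_zero (mul_ne_zero two_ne_zero h0) (by positivity)
  have hc : Complex.I * chi1 chi ≠ 0 := mul_ne_zero Complex.I_ne_zero h1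
  have key : Complex.I * chi1 chi * ((x : ℂ) + chi0 n lam0 * t) = w ↔
      w / (Complex.I * chi1 chi) = (x : ℂ) + chi0 n lam0 * t := by
    rw [div_eq_iff hc, mul_comm, eq_comm]
  rw [key]
  simp only [planePoint, Prod.mk.injEq]
  generalize w / (Complex.I * chi1 chi) = u
  rw [Complex.ext_iff]
  simp only [Complex.add_re, Complex.add_im, Complex.mul_re, Complex.mul_im, Complex.ofReal_re,
    Complex.ofReal_im, mul_zero, sub_zero, zero_add]
  constructor
  · rintro ⟨rfl, rfl⟩
    constructor
    · ring
    · field_simp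
  · rintro ⟨hr, hi⟩
    have ht : u.im / (chi0 n lam0).im = t := by
      rw [hi]; field_simp
    exact ⟨by rw [ht, hr]; ring, ht⟩

/-- `Δ(z̄) = (α₂ x̂ + β₂ i t̂) W_𝒩^{[2]}(z̄) / W_𝒩'(z̄)`, where `i χ^{[1]} (x̂ + χ₀ t̂) = z̄`. -/
def Delta (n : ℕ) (lam0 lam1 : ℂ) (chi : PowerSeries ℂ) (N : Fin n → ℕ) (kap : Fin n → ℕ → ℂ)
    (z : ℂ) : ℂ :=
  (alpha n lam0 lam1 chi 2 * (planePoint n lam0 chi z).1 +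
      beta n lam0 lam1 chi 2 * Complex.I * (planePoint n lam0 chi z).2) *
    ((gmam2 n N kap).eval z / (Polynomial.derivative (gmam n N kap)).eval z)

/-- The position `(x̄₀, t̄₀)`, given by `i χ^{[1]} (x̄₀ + χ₀ t̄₀) = z̄ A - Δ(z̄)`. -/
def rwPos (n : ℕ) (lam0 lam1 : ℂ) (chi : PowerSeries ℂ) (N : Fin n → ℕ) (kap : Fin n → ℕ → ℂ)
    (A : ℝ) (z : ℂ) : ℝ × ℝ :=
  planePoint n lam0 chi (z * A - Delta n lam0 lam1 chi N kap z)

/-- The Euclidean distance of two points of the `(x,t)`-plane. -/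
def dist2 (p q : ℝ × ℝ) : ℝ := Real.sqrt ((p.1 - q.1) ^ 2 + (p.2 - q.2) ^ 2)

end RogueWave

end

/-! ### Elementary Schur polynomials: recursion, homogeneity, addition theorem. -/

noncomputable section

namespace RogueWave

open PowerSeries Finset

section Schur

variable {R S : Type*} [CommRing R] [Algebra ℚ R] [CommRing S] [Algebra ℚ S]

/-! The sum that defines `tau` is a matrix product: `M^{[s]} = Φ₊ᴴ diag(C₁^v) Φ₋`, where column `c`
of `Φ±` consists of the values `S_{deg c - v}`, with the shift `± h₂^{[s]}` in the arguments. For `s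
= 0` both factors coincide and have unitriangular shape, so `M^{[0]}` is positive definite and the
denominator never vanishes (`Mmat_none_det_ne_zero`). In general the Cauchy–Binet formula
(`det_mul_eq_sum_orderEmb`) gives a sum over increasing row sets `g` of `C₁^(Σ g)` times two minors.
Schur polynomials are weighted homogeneous, so a rescaling by a large length `B` keeps all minors
bounded and turns the weights into powers of `C₁ / B²`. The rows `0, …, N-1` lead, the rows `0, …,
N-2, N` follow with weight `C₁ / B²`, and all other row sets contribute `O(B⁻⁴)`.

Let `ξ = i χ^{[1]} (x + χ₀ t)` and let `W` be the Wronskian of the `φ`. With scale `B = A` the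
leading minor is `W(ξ / A)` up to `O(1/A)`. Near a point `ξ = z A` with `W(z) = 0` this main term
vanishes, and the expansion has to be carried to order `1/A` (`scaledMinor_second`). Two terms of
that order appear: `(ξ - z A ± h₂) W'(z) / A`, and the second Schur argument `α₂ x + β₂ i t`, itself
of size `A`, times `W^{[2]}(z) / A²` (unnormalized). The displacement `Δ` of the centre is what
absorbs the second one (`lowMinor_near`). The other relevant minor tends to `W'(z)`. Hence `A² det
M^{[s]}`, up to a factor independent of `s`, is `|W'(z)|² ((η + h)* (η - h) + C₁) + O(1/A)`, with
`η` the coordinate relative to the corrected centre and `h = h_{2,1}^{[s]}` (`detSum_near`). The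
quotient of these expressions is the first-order rogue wave (`localTau_div_none`).

The row-dependent arguments `v h₁` do not disturb this order because `h_{1,1} = 0` (`h1_one`). This
rests on the explicit form `(χ - χ₀)^(n+1) = 2 λ^{[1]} ε^(n+1) ∏ (χ + b_j)` of the characteristic
equation (`charPoly_identity`, `wavPoly_identity`).

Away from all positions the scale is `B = max(A, |ξ|)`. The leading minor is then a constant times
`∏ (ξ - A w) / B` over the roots `w`, where at most one factor is small. Its modulus times `B` is
large once `ξ` is far from every `A w`, whereas the dependence on `s` is a relative error of order
`1 / (B |minor|)`; so the quotient is close to one, uniformly in the plane (`far_field`). The degree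
of `W` comes from its top coefficient, which reduces to a Vandermonde determinant
(`det_inv_factorial_ne_zero`). -/

theorem hasSubst_mk {R : Type*} [CommRing R] (z : ℕ → R) :
    HasSubst (PowerSeries.mk fun i => if i = 0 then 0 else z i) :=
  HasSubst.of_constantCoeff_zero' (by simp [← coeff_zero_eq_constantCoeff_apply])

theorem natCast_succ_mul_cancel {a b : R} (j : ℕ) (h : ((j : R) + 1) * a = ((j : R) + 1) * b) :
    a = b := by
  have hu : ((j : R) + 1) = algebraMap ℚ R (j + 1) := by simp
  have h2 : algebraMap ℚ R ((j : ℚ) + 1)⁻¹ * ((j : R) + 1) = 1 := by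
    rw [hu, ← map_mul, inv_mul_cancel₀ (by positivity), map_one]
  calc a = algebraMap ℚ R ((j : ℚ) + 1)⁻¹ * (((j : R) + 1) * a) := by
        rw [← mul_assoc, h2, one_mul]
    _ = b := by rw [h, ← mul_assoc, h2, one_mul]

@[simp]
theorem schur_zero (z : ℕ → R) : schur z 0 = 1 := by
  have h : constantCoeff (PowerSeries.mk fun i => if i = 0 then (0 : R) else z i) = 0 := by
    simp [← coeff_zero_eq_constantCoeff_apply]
  rw [schur, coeff_subst' (hasSubst_mk z), finsum_eq_single _ 0]
  · simp
  · intro d hd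
    rw [coeff_zero_eq_constantCoeff_apply, map_pow, h, zero_pow hd, smul_zero]

/-- Coefficient comparison in `F' = Z' F` for `F = exp Z`. Over a `ℚ`-algebra this recursion and the
initial value determine all `S_j`, so identities and growth bounds can be proved by induction
without returning to the substitution. -/
theorem schur_succ (z : ℕ → R) (j : ℕ) :
    ((j : R) + 1) * schur z (j + 1) =
      ∑ i ∈ range (j + 1), ((i : R) + 1) * z (i + 1) * schur z (j - i) := by
  have h := congrArg (coeff j) (derivative_subst (f := PowerSeries.exp R) (hasSubst_mk z))
  rw [derivative_exp, coeff_derivative, mul_comm, mul_comm (PowerSeries.subst _ _), coeff_mul,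
    Finset.Nat.sum_antidiagonal_eq_sum_range_succ_mk] at h
  rw [schur, h]
  refine sum_congr rfl fun i _ => ?_
  rw [coeff_derivative, coeff_mk, if_neg (Nat.succ_ne_zero i), mul_comm (z (i + 1)), schur]

theorem schur_unique (z : ℕ → R) (a : ℕ → R) (h0 : a 0 = 1)
    (h : ∀ j : ℕ, ((j : R) + 1) * a (j + 1) =
      ∑ i ∈ range (j + 1), ((i : R) + 1) * z (i + 1) * a (j - i)) (j : ℕ) :
    schur z j = a j := by
  induction j using Nat.strong_induction_on with
  | _ j ih =>
    cases j with
    | zero => rw [h0, schur_zero]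
    | succ j =>
      refine natCast_succ_mul_cancel j ?_
      rw [schur_succ, h]
      exact sum_congr rfl fun i _ => by rw [ih _ (by omega)]

theorem map_schur (f : R →+* S) (z : ℕ → R) (j : ℕ) :
    f (schur z j) = schur (fun i => f (z i)) j := by
  refine (schur_unique _ (fun j => f (schur z j)) (by simp) (fun j => ?_) j).symm
  have := congrArg f (schur_succ z j)
  simpa using this

theorem star_schur (z : ℕ → ℂ) (j : ℕ) : star (schur z j) = schur (fun i => star (z i)) j :=
  map_schur (starRingEnd ℂ) z j

/-- The substitution `ε ↦ c ε` in the generating series. It is the reason for the choice of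
parameters proportional to `A^j`. -/
theorem schur_scale (c : R) (z : ℕ → R) (j : ℕ) :
    schur (fun i => c ^ i * z i) j = c ^ j * schur z j := by
  refine schur_unique _ (fun j => c ^ j * schur z j) (by simp) (fun j => ?_) j
  rw [mul_left_comm, schur_succ, mul_sum]
  refine sum_congr rfl fun i hi => ?_
  have : j + 1 = (i + 1) + (j - i) := by have := mem_range.1 hi; omega
  rw [this, pow_add]
  ring

/-- The generating series of the Schur polynomials. -/
def schurSeries (z : ℕ → R) : PowerSeries R := PowerSeries.mk (schur z)

theorem derivative_schurSeries (z : ℕ → R) :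
    d⁄dX R (schurSeries z) = PowerSeries.mk (fun i => ((i : R) + 1) * z (i + 1)) * schurSeries z := by
  ext j
  rw [coeff_derivative, coeff_mul, Finset.Nat.sum_antidiagonal_eq_sum_range_succ_mk, schurSeries,
    coeff_mk, mul_comm, schur_succ]
  simp

/-- The product of the two generating series satisfies the differential equation that belongs to the
sum of the arguments. -/
theorem schur_add (z w : ℕ → R) (j : ℕ) :
    schur (fun i => z i + w i) j = ∑ i ∈ range (j + 1), schur w i * schur z (j - i) := by
  have key : ∀ j, coeff j (schurSeries w * schurSeries z) =
      ∑ i ∈ range (j + 1), schur w i * schur z (j - i) := fun j => by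
    rw [coeff_mul, Finset.Nat.sum_antidiagonal_eq_sum_range_succ_mk]
    simp [schurSeries]
  rw [← key]
  refine schur_unique _ (fun j => coeff j (schurSeries w * schurSeries z)) ?_ (fun j => ?_) j
  · rw [key]; simp
  · have hd : d⁄dX R (schurSeries w * schurSeries z) =
        PowerSeries.mk (fun i => ((i : R) + 1) * (z (i + 1) + w (i + 1))) *
          (schurSeries w * schurSeries z) := by
      have : (PowerSeries.mk (fun i => ((i : R) + 1) * (z (i + 1) + w (i + 1)))) =
        PowerSeries.mk (fun i => ((i : R) + 1) * z (i + 1)) +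
          PowerSeries.mk (fun i => ((i : R) + 1) * w (i + 1)) := by
        ext i; simp [mul_add]
      rw [Derivation.leibniz, derivative_schurSeries, derivative_schurSeries, this, smul_eq_mul,
        smul_eq_mul]
      ring
    have := congrArg (coeff j) hd
    rw [coeff_derivative, coeff_mul j (PowerSeries.mk _),
      Finset.Nat.sum_antidiagonal_eq_sum_range_succ_mk] at this
    rw [mul_comm, this]
    simp

theorem schur_one (z : ℕ → R) : schur z 1 = z 1 := by
  have := schur_succ z 0
  simpa using this

theorem two_mul_schur_two (z : ℕ → R) : 2 * schur z 2 = 2 * z 2 + z 1 ^ 2 := by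
  have := schur_succ z 1
  simp only [sum_range_succ, sum_range_zero, Nat.cast_one, Nat.cast_zero] at this
  simp only [schur_zero, Nat.sub_self, Nat.sub_zero, schur_one] at this
  linear_combination this

theorem factorial_mul_schur_single (z : R) (j : ℕ) :
    (j.factorial : R) * schur (fun i => if i = 1 then z else 0) j = z ^ j := by
  induction j with
  | zero => simp
  | succ j ih =>
    have h := schur_succ (fun i => if i = 1 then z else 0) j
    rw [sum_eq_single 0 (by intro i _ hi; simp [hi]) (by simp)] at h
    simp only [Nat.cast_zero, zero_add, if_true, Nat.sub_zero, one_mul] at h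
    rw [Nat.factorial_succ, Nat.cast_mul, mul_right_comm, Nat.cast_add_one, h, pow_succ, ← ih]
    ring

/-- `S_{j-v}`, read as zero for `v > j`. -/
def schurSub (z : ℕ → R) (j v : ℕ) : R := if v ≤ j then schur z (j - v) else 0

/-- Terms with `v + i > d` are zero by convention, so any `D > d` may bound the sum. A range common
to all columns makes this an expansion of whole rows into multiples of rows further down. -/
theorem schurSub_add (z w : ℕ → R) (d v D : ℕ) (hD : d < D) :
    schurSub (fun i => z i + w i) d v = ∑ i ∈ range D, schur w i * schurSub z d (v + i) := by
  rw [schurSub]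
  split_ifs with h
  · rw [schur_add]
    have hs : range (d - v + 1) ⊆ range D := by
      intro i; simp only [mem_range]; omega
    rw [← sum_subset hs]
    · refine sum_congr rfl fun i hi => ?_
      have := mem_range.1 hi
      rw [schurSub, if_pos (by omega), Nat.sub_sub]
    · intro i _ hi
      have : ¬ (v + i ≤ d) := by simp only [mem_range] at hi; omega
      rw [schurSub, if_neg this, mul_zero]
  · exact (sum_eq_zero fun i _ => by rw [schurSub, if_neg (by omega), mul_zero]).symm

theorem schurSub_self (z : ℕ → R) (j : ℕ) : schurSub z j j = 1 := by simp [schurSub]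

theorem schurSub_of_lt (z : ℕ → R) {j v : ℕ} (h : j < v) : schurSub z j v = 0 := by
  rw [schurSub, if_neg (by omega)]

end Schur

end RogueWave

end

/-! ### The Cauchy–Binet formula and increasing row sets. -/

noncomputable section

namespace RogueWave

open Finset Matrix

section CauchyBinet

/-- The Cauchy–Binet formula. -/
theorem det_mul_eq_sum_orderEmb {R : Type*} [CommRing R] {N m : ℕ}
    (A : Matrix (Fin N) (Fin m) R) (B : Matrix (Fin m) (Fin N) R) :
    (A * B).det = ∑ g : Fin N ↪o Fin m, (A.submatrix id g).det * (B.submatrix g id).det := by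
  have h1 : (A * B).det = ∑ f : Fin N → Fin m, (∏ i, A i (f i)) * (B.submatrix f id).det := by
    have hr : A * B = fun i => ∑ k, A i k • B k := by
      ext i j; simp [Matrix.mul_apply, Finset.sum_apply]
    have := (detRowAlternating (n := Fin N) (R := R)).toMultilinearMap.map_sum
      (fun i (k : Fin m) => A i k • B k)
    rw [hr]
    refine Eq.trans this (sum_congr rfl fun f _ => ?_)
    exact (detRowAlternating (n := Fin N) (R := R)).toMultilinearMap.map_smul_univ
      (fun i => A i (f i)) (fun i => B (f i))
  -- An injective `f` is `g ∘ σ` for a unique increasing `g` and a unique permutation `σ`; for any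
  -- other `f` the minor has two equal rows.
  have h2 : ∑ p : (Fin N ↪o Fin m) × Equiv.Perm (Fin N),
      (∏ i, A i (p.1 (p.2 i))) * (B.submatrix (p.1 ∘ p.2) id).det =
      ∑ f : Fin N → Fin m, (∏ i, A i (f i)) * (B.submatrix f id).det := by
    refine sum_of_injOn (fun p => p.1 ∘ p.2) ?_ (fun _ _ => mem_coe.2 (mem_univ _)) ?_
      (fun _ _ => rfl)
    · rintro ⟨g, σ⟩ - ⟨g', σ'⟩ - h
      have h : (g : Fin N → Fin m) ∘ σ = g' ∘ σ' := h
      have hg : g = g' := by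
        rw [← OrderEmbedding.range_inj, ← σ.surjective.range_comp g, h, σ'.surjective.range_comp]
      subst hg
      have : σ = σ' := Equiv.ext fun i => g.injective (congrFun h i)
      rw [this]
    · intro f _ hf
      have hni : ¬ Function.Injective f := by
        intro hinj
        refine hf ⟨(OrderEmbedding.ofStrictMono (f ∘ Tuple.sort f)
          ((Tuple.monotone_sort f).strictMono_of_injective
            (hinj.comp (Tuple.sort f).injective)), (Tuple.sort f)⁻¹), mem_coe.2 (mem_univ _), ?_⟩
        ext i
        simp
      obtain ⟨i, j, hij, hne⟩ : ∃ i j, f i = f j ∧ i ≠ j := by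
        simpa [Function.Injective] using hni
      rw [det_zero_of_row_eq hne (by ext k; simp [hij]), mul_zero]
  rw [h1, ← h2, Fintype.sum_prod_type]
  refine sum_congr rfl fun g _ => ?_
  rw [← det_transpose (A.submatrix id g), det_apply', sum_mul]
  refine sum_congr rfl fun σ _ => ?_
  have : B.submatrix (g ∘ σ) id = (B.submatrix g id).submatrix σ id := rfl
  rw [this, det_permute]
  simp only [transpose_apply, submatrix_apply, id_eq]
  ring

end CauchyBinet

section OrderEmb

variable {N m : ℕ}

theorem orderEmb_add_le (g : Fin N ↪o Fin m) {i j : Fin N} (h : i ≤ j) :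
    (g i : ℕ) + j ≤ g j + i := by
  obtain ⟨i, hi⟩ := i
  obtain ⟨j, hj⟩ := j
  have h : i ≤ j := h
  obtain ⟨k, rfl⟩ := Nat.exists_eq_add_of_le h
  clear h
  induction k with
  | zero => simp
  | succ k ih =>
    have h1 : (g ⟨i, hi⟩ : ℕ) + (i + k) ≤ g ⟨i + k, by omega⟩ + i :=
      ih (by omega) (by show i ≤ i + k; omega)
    have h2 : g ⟨i + k, by omega⟩ < g ⟨i + (k + 1), hj⟩ := g.strictMono (by simp)
    have h2 : (g ⟨i + k, by omega⟩ : ℕ) < g ⟨i + (k + 1), hj⟩ := h2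
    show (g ⟨i, hi⟩ : ℕ) + (i + (k + 1)) ≤ g ⟨i + (k + 1), hj⟩ + i
    omega

theorem le_orderEmb (g : Fin N ↪o Fin m) (i : Fin N) : (i : ℕ) ≤ g i := by
  have h := orderEmb_add_le g (i := ⟨0, by have := i.2; omega⟩) (j := i) (by
    show 0 ≤ (i : ℕ); omega)
  simp only at h
  omega

/-- The rows `0, …, N - 1`. -/
def lowRows (h : N ≤ m) : Fin N ↪o Fin m := Fin.castLEOrderEmb h

@[simp] theorem lowRows_val (h : N ≤ m) (i : Fin N) : (lowRows h i : ℕ) = i := rfl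

/-- The rows `0, …, N - 2, N`. -/
def nextRows (h : N < m) : Fin N ↪o Fin m :=
  OrderEmbedding.ofStrictMono
    (fun i => ⟨if (i : ℕ) + 1 = N then N else i, by have := i.2; split_ifs <;> omega⟩) (by
      intro i j hij
      have hij : (i : ℕ) < j := hij
      have := j.2
      show (if (i : ℕ) + 1 = N then N else (i : ℕ)) < if (j : ℕ) + 1 = N then N else (j : ℕ)
      split_ifs <;> omega)

@[simp] theorem nextRows_val (h : N < m) (i : Fin N) :
    (nextRows h i : ℕ) = if (i : ℕ) + 1 = N then N else i := rfl

/-- The excess `∑ g i - ∑ i` is the exponent of `C₁ / B²` in the rescaled Cauchy–Binet sum; it is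
zero only for the lowest rows. -/
theorem sum_lt_sum_orderEmb (h : N ≤ m) (g : Fin N ↪o Fin m) (hg : g ≠ lowRows h) :
    ∑ i : Fin N, (i : ℕ) + 1 ≤ ∑ i, (g i : ℕ) := by
  obtain ⟨i, hi⟩ : ∃ i, g i ≠ lowRows h i := by
    by_contra! hc
    exact hg (by ext i; rw [hc i])
  refine sum_lt_sum (fun i _ => le_orderEmb g i) ⟨i, mem_univ _, ?_⟩
  refine lt_of_le_of_ne (le_orderEmb g i) fun he => hi (Fin.ext ?_)
  rw [lowRows_val, ← he]

/-- If some row of `g` is raised, the last one is raised at least as much. Excess one therefore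
forces that only the last row moves, by a single place, which is `nextRows`. -/
theorem sum_add_two_le_sum_orderEmb (h : N < m) (g : Fin N ↪o Fin m) (hg : g ≠ lowRows h.le)
    (hg' : g ≠ nextRows h) : ∑ i : Fin N, (i : ℕ) + 2 ≤ ∑ i, (g i : ℕ) := by
  obtain ⟨i, hi⟩ : ∃ i, g i ≠ lowRows h.le i := by
    by_contra! hc
    exact hg (by ext i; rw [hc i])
  have hi' : (i : ℕ) < g i := by
    refine lt_of_le_of_ne (le_orderEmb g i) fun he => hi (Fin.ext ?_)
    rw [lowRows_val, ← he]
  have hN : 0 < N := by have := i.2; omega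
  set L : Fin N := ⟨N - 1, by omega⟩ with hL
  have hLval : (L : ℕ) = N - 1 := rfl
  have hiL : i ≤ L := by show (i : ℕ) ≤ N - 1; have := i.2; omega
  have hgL : (L : ℕ) + 1 ≤ g L := by
    have h1 := orderEmb_add_le g hiL
    have h2 : (i : ℕ) ≤ L := hiL
    omega
  rw [← add_sum_erase _ (fun i : Fin N => (i : ℕ)) (mem_univ L),
    ← add_sum_erase _ (fun i : Fin N => (g i : ℕ)) (mem_univ L)]
  have hle : ∑ i ∈ univ.erase L, (i : ℕ) ≤ ∑ i ∈ univ.erase L, (g i : ℕ) :=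
    sum_le_sum fun i _ => le_orderEmb g i
  by_cases h2 : (L : ℕ) + 2 ≤ g L
  · omega
  · have hgL' : (g L : ℕ) = N := by omega
    obtain ⟨j, hj⟩ : ∃ j, g j ≠ nextRows h j := by
      by_contra! hc
      exact hg' (by ext i; rw [hc i])
    have hjL : j ≠ L := by
      rintro rfl
      refine hj (Fin.ext ?_)
      rw [nextRows_val, hgL', if_pos (by omega)]
    have hjv : (j : ℕ) + 1 ≠ N := fun hc => hjL (Fin.ext (by omega))
    have hj' : (j : ℕ) < g j := by
      refine lt_of_le_of_ne (le_orderEmb g j) fun he => hj (Fin.ext ?_)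
      rw [nextRows_val, if_neg hjv, ← he]
    have : ∑ i ∈ univ.erase L, (i : ℕ) < ∑ i ∈ univ.erase L, (g i : ℕ) :=
      sum_lt_sum (fun i _ => le_orderEmb g i) ⟨j, by simp [hjL], hj'⟩
    omega

end OrderEmb

/-! ### Nonvanishing of weighted Gram determinants. -/

section Gram

open scoped ComplexOrder in
theorem det_gram_ne_zero {ι κ : Type*} [Fintype ι] [DecidableEq ι] [Fintype κ] [DecidableEq κ]
    (Φ : Matrix κ ι ℂ) (hΦ : Function.Injective Φ.mulVec) (w : κ → ℝ) (hw : ∀ v, 0 < w v) :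
    (Φᴴ * Matrix.diagonal (fun v => (w v : ℂ)) * Φ).det ≠ 0 := by
  have h : (Matrix.diagonal (fun v => (w v : ℂ))).PosDef :=
    Matrix.PosDef.diagonal fun v => by exact_mod_cast hw v
  have := (h.conjTranspose_mul_mul_same hΦ).isUnit
  exact ((Matrix.isUnit_iff_isUnit_det _).1 this).ne_zero

/-- For a nonzero kernel vector `u`, take the column of largest `d c` with `u c ≠ 0`. In row `d c`
every other term vanishes, which forces `u c = 0`. -/
theorem mulVec_injective_of_unitriangular {ι : Type*} [Fintype ι] {D : ℕ}
    (Φ : Matrix (Fin D) ι ℂ) (d : ι → Fin D) (hd : Function.Injective d)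
    (h1 : ∀ c, Φ (d c) c = 1) (h0 : ∀ v c, d c < v → Φ v c = 0) :
    Function.Injective Φ.mulVec := by
  classical
  have key : ∀ u, Φ.mulVec u = 0 → u = 0 := by
    intro u hu
    by_contra hne
    obtain ⟨c₀, hc₀⟩ : ∃ c, u c ≠ 0 := by
      by_contra! hc
      exact hne (funext hc)
    obtain ⟨c, hc, hmax⟩ := (univ.filter fun c => u c ≠ 0).exists_max_image d ⟨c₀, by simp [hc₀]⟩
    have hc : u c ≠ 0 := by simpa using hc
    have h := congrFun hu (d c)
    rw [Matrix.mulVec, dotProduct, sum_eq_single c, h1, one_mul] at h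
    · exact hc h
    · intro b _ hb
      by_cases hub : u b = 0
      · rw [hub, mul_zero]
      · have hle := hmax b (by simp [hub])
        rw [h0 _ _ (lt_of_le_of_ne hle fun he => hb (hd he)), zero_mul]
    · simp
  intro u v huv
  have := key (u - v) (by rw [Matrix.mulVec_sub]; exact sub_eq_zero.2 huv)
  exact sub_eq_zero.1 this

end Gram

/-! ### Asymptotic expansion of perturbed determinants. -/

section Perturbation

open Asymptotics Filter

variable {Ω : Type*} {l : Filter Ω}

theorem isBigO_prod {ι : Type*} (s : Finset ι) {f : ι → Ω → ℂ} {g : ι → Ω → ℝ}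
    (h : ∀ i ∈ s, f i =O[l] g i) :
    (fun ω => ∏ i ∈ s, f i ω) =O[l] fun ω => ∏ i ∈ s, g i ω := by
  classical
  induction s using Finset.induction_on with
  | empty => simpa using isBigO_refl (fun _ : Ω => (1 : ℝ)) l
  | insert a s ha ih =>
    simp only [prod_insert ha]
    exact (h a (mem_insert_self _ _)).mul (ih fun i hi => h i (mem_insert_of_mem hi))

variable {ι : Type*} [Fintype ι] [DecidableEq ι]

theorem isBigO_det {X : Ω → Matrix ι ι ℂ} {g : ι → Ω → ℝ}
    (h : ∀ i j, (fun ω => X ω i j) =O[l] g i) :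
    (fun ω => (X ω).det) =O[l] fun ω => ∏ i, g i ω := by
  simp only [← det_transpose (X _), det_apply']
  refine IsBigO.fun_sum fun σ _ => ?_
  refine IsBigO.const_mul_left ?_ _
  exact isBigO_prod _ fun i _ => h i (σ i)

theorem isBigO_det_one {X : Ω → Matrix ι ι ℂ}
    (h : ∀ i j, (fun ω => X ω i j) =O[l] fun _ => (1 : ℝ)) :
    (fun ω => (X ω).det) =O[l] fun _ => (1 : ℝ) := by
  simpa using isBigO_det (g := fun _ _ => 1) h

/-- By multilinearity in the rows, every term with two or more rows from `E` is `O(ε²)`. The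
first-order terms are kept as determinants with one replaced row, the shape in which the derivative
of a Wronskian appears. -/
theorem isBigO_det_add {X E : Ω → Matrix ι ι ℂ} {ε : Ω → ℝ}
    (hε : ε =O[l] fun _ => (1 : ℝ))
    (hX : ∀ i j, (fun ω => X ω i j) =O[l] fun _ => (1 : ℝ))
    (hE : ∀ i j, (fun ω => E ω i j) =O[l] ε) :
    (fun ω => (X ω + E ω).det - (X ω).det - ∑ i, ((X ω).updateRow i (E ω i)).det) =O[l]
      fun ω => ε ω ^ 2 := by
  have h : ∀ ω, (X ω + E ω).det - (X ω).det - ∑ i, ((X ω).updateRow i (E ω i)).det =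
      ∑ s : Finset ι with 2 ≤ #s, Matrix.det (Matrix.of (s.piecewise (E ω) (X ω))) := by
    intro ω
    have := (detRowAlternating (n := ι) (R := ℂ)).toMultilinearMap.map_add_eq_map_add_linearDeriv_add
      (X ω) (E ω)
    have hd := MultilinearMap.linearDeriv_apply
      (detRowAlternating (n := ι) (R := ℂ)).toMultilinearMap (X ω) (E ω)
    rw [sub_sub, sub_eq_iff_eq_add']
    exact this.trans (congrArg₂ _ (congrArg₂ _ rfl hd) rfl)
  simp only [h]
  refine IsBigO.fun_sum fun s hs => ?_
  have h2 : 2 ≤ #s := (mem_filter.1 hs).2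
  refine (isBigO_det (g := fun i ω => if i ∈ s then ε ω else 1) ?_).trans ?_
  · intro i j
    by_cases hi : i ∈ s
    · simpa [Finset.piecewise, hi] using hE i j
    · simpa [Finset.piecewise, hi] using hX i j
  · simp only [prod_ite, prod_const_one, mul_one, prod_const, filter_univ_mem]
    obtain ⟨k, hk⟩ := Nat.exists_eq_add_of_le h2
    rw [hk]
    simp only [pow_add]
    simpa using (isBigO_refl (fun ω => ε ω ^ 2) l).mul (hε.pow k)

theorem isBigO_det_updateRow {X : Ω → Matrix ι ι ℂ} {e : Ω → ι → ℂ} {ε : Ω → ℝ}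
    (hX : ∀ i j, (fun ω => X ω i j) =O[l] fun _ => (1 : ℝ))
    (i : ι) (he : ∀ j, (fun ω => e ω j) =O[l] ε) :
    (fun ω => ((X ω).updateRow i (e ω)).det) =O[l] ε := by
  refine (isBigO_det (g := fun i' ω => if i' = i then ε ω else 1) ?_).trans ?_
  · intro i' j
    by_cases hi : i' = i
    · subst hi; simpa using he j
    · simpa [hi] using hX i' j
  · simpa using isBigO_refl _ _

theorem isBigO_det_add_first {X E : Ω → Matrix ι ι ℂ} {ε : Ω → ℝ}
    (hε : ε =O[l] fun _ => (1 : ℝ))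
    (hX : ∀ i j, (fun ω => X ω i j) =O[l] fun _ => (1 : ℝ))
    (hE : ∀ i j, (fun ω => E ω i j) =O[l] ε) :
    (fun ω => (X ω + E ω).det - (X ω).det) =O[l] ε := by
  have h1 := isBigO_det_add hε hX hE
  have h2 : (fun ω => ε ω ^ 2) =O[l] ε := by
    simpa [pow_two] using (isBigO_refl ε l).mul hε
  have h3 : (fun ω => ∑ i, ((X ω).updateRow i (E ω i)).det) =O[l] ε :=
    IsBigO.fun_sum fun i _ => isBigO_det_updateRow hX i (hE i)
  simpa using (h1.trans h2).add h3

end Perturbation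

end RogueWave

end

/-! ### Trigonometry of the background amplitudes and wave numbers. -/

noncomputable section

namespace RogueWave

open Finset

/-- The common scale `2 Im λ₀ / (n + 1)` of the spectral data. -/
def specScale (n : ℕ) (lam0 : ℂ) : ℝ := 2 * lam0.im / (n + 1)

/-- The angles `k π / (n + 1)`. -/
def specAngle (n : ℕ) (k : Fin n) : ℝ := ((k : ℕ) + 1 : ℝ) * Real.pi / (n + 1)

section SpectralData

variable {n : ℕ} {lam0 : ℂ}

theorem specScale_ne_zero (h : lam0.im ≠ 0) : specScale n lam0 ≠ 0 :=
  div_ne_zero (mul_ne_zero two_ne_zero h) (by positivity)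

theorem specAngle_pos (k : Fin n) : 0 < specAngle n k := by
  have := Real.pi_pos
  unfold specAngle
  positivity

theorem specAngle_lt_pi (k : Fin n) : specAngle n k < Real.pi := by
  unfold specAngle
  rw [div_lt_iff₀ (by positivity), mul_comm]
  have : ((k : ℕ) : ℝ) + 1 < n + 1 := by exact_mod_cast Nat.succ_lt_succ k.2
  exact mul_lt_mul_of_pos_left this Real.pi_pos

theorem sin_specAngle_pos (k : Fin n) : 0 < Real.sin (specAngle n k) :=
  Real.sin_pos_of_pos_of_lt_pi (specAngle_pos k) (specAngle_lt_pi k)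

theorem wav_eq (k : Fin n) :
    wav n lam0 k = specScale n lam0 * Real.cot (specAngle n k) - 2 * lam0.re := rfl

theorem amp_eq (k : Fin n) :
    amp n lam0 k = specScale n lam0 * (Real.sin (specAngle n k))⁻¹ := rfl

theorem chi0_eq : chi0 n lam0 = 2 * (lam0.re : ℂ) + Complex.I * (specScale n lam0 : ℂ) := rfl

theorem chi0_re : (chi0 n lam0).re = 2 * lam0.re := by
  rw [chi0_eq]; simp

theorem chi0_im : (chi0 n lam0).im = specScale n lam0 := by
  rw [chi0_eq]; simp

theorem chi0_add_wav (k : Fin n) : chi0 n lam0 + (wav n lam0 k : ℂ) =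
    (specScale n lam0 : ℂ) / (Real.sin (specAngle n k) : ℂ) *
      Complex.exp (Complex.I * (specAngle n k : ℂ)) := by
  have hs : (Complex.sin (specAngle n k : ℂ)) ≠ 0 := by
    rw [← Complex.ofReal_sin]; exact_mod_cast (sin_specAngle_pos k).ne'
  rw [chi0_eq, wav_eq, mul_comm Complex.I (specAngle n k : ℂ), Complex.exp_mul_I,
    Real.cot_eq_cos_div_sin]
  push_cast
  field_simp
  ring

theorem star_chi0_add_wav (k : Fin n) : star (chi0 n lam0) + (wav n lam0 k : ℂ) =
    (specScale n lam0 : ℂ) / (Real.sin (specAngle n k) : ℂ) *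
      Complex.exp (-(Complex.I * (specAngle n k : ℂ))) := by
  have := congrArg (starRingEnd ℂ) (chi0_add_wav (lam0 := lam0) k)
  simp only [map_add, map_mul, map_div₀, ← Complex.exp_conj, Complex.conj_ofReal,
    Complex.conj_I, neg_mul] at this
  exact this

theorem chi0_add_wav_ne_zero (h : lam0.im ≠ 0) (k : Fin n) :
    chi0 n lam0 + (wav n lam0 k : ℂ) ≠ 0 := by
  rw [chi0_add_wav]
  refine mul_ne_zero (div_ne_zero ?_ ?_) (Complex.exp_ne_zero _)
  · exact_mod_cast specScale_ne_zero h
  · exact_mod_cast (sin_specAngle_pos k).ne'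

/-- The two bases have opposite arguments `∓ k π / (n+1)` (with `k` counted from one) and the same
real prefactor, so their quotient is an `(n+1)`-st root of unity. -/
theorem star_chi0_add_wav_pow (k : Fin n) :
    (star (chi0 n lam0) + (wav n lam0 k : ℂ)) ^ (n + 1) =
      (chi0 n lam0 + (wav n lam0 k : ℂ)) ^ (n + 1) := by
  rw [chi0_add_wav, star_chi0_add_wav, mul_pow, mul_pow, ← Complex.exp_nat_mul,
    ← Complex.exp_nat_mul]
  congr 1
  rw [Complex.exp_eq_exp_iff_exists_int]
  refine ⟨-((k : ℕ) + 1), ?_⟩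
  have : ((n : ℂ) + 1) ≠ 0 := by exact_mod_cast Nat.succ_ne_zero n
  unfold specAngle
  push_cast
  field_simp
  ring

theorem chi0_mul_star_eq_amp_sq (k : Fin n) :
    (chi0 n lam0 + (wav n lam0 k : ℂ)) * (star (chi0 n lam0) + (wav n lam0 k : ℂ)) =
      (amp n lam0 k : ℂ) ^ 2 := by
  have hs : ((Real.sin (specAngle n k) : ℝ) : ℂ) ≠ 0 := by
    exact_mod_cast (sin_specAngle_pos k).ne'
  rw [chi0_add_wav, star_chi0_add_wav, mul_mul_mul_comm, ← Complex.exp_add, add_neg_cancel,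
    Complex.exp_zero, mul_one, amp_eq]
  push_cast
  push_cast at hs
  field_simp

theorem wav_injective (h : lam0.im ≠ 0) : Function.Injective (wav n lam0) := by
  intro i j hij
  rw [wav_eq, wav_eq, sub_left_inj] at hij
  have hc : Real.cot (specAngle n i) = Real.cot (specAngle n j) :=
    mul_left_cancel₀ (specScale_ne_zero h) hij
  have hi := (sin_specAngle_pos i).ne'
  have hj := (sin_specAngle_pos j).ne'
  rw [Real.cot_eq_cos_div_sin, Real.cot_eq_cos_div_sin, div_eq_div_iff hi hj] at hc
  have hsin : Real.sin (specAngle n i - specAngle n j) = 0 := by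
    rw [Real.sin_sub]; linarith
  have h0 : specAngle n i - specAngle n j = 0 := by
    refine (Real.sin_eq_zero_iff_of_lt_of_lt ?_ ?_).1 hsin
    · linarith [specAngle_pos i, specAngle_lt_pi j]
    · linarith [specAngle_pos j, specAngle_lt_pi i]
  have hn : ((n : ℝ) + 1) ≠ 0 := by positivity
  have : ((i : ℕ) : ℝ) = ((j : ℕ) : ℝ) := by
    unfold specAngle at h0
    field_simp at h0
    simp only [mul_zero] at h0
    have := (mul_eq_zero.1 h0).resolve_left Real.pi_ne_zero
    linarith
  exact Fin.ext (by exact_mod_cast this)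

/-- The cotangents cancel in pairs under the reflection `k ↦ n + 1 - k` of the angles. -/
theorem sum_wav : ∑ k, (wav n lam0 k : ℂ) = -(n * (2 * lam0.re)) := by
  have hrev : ∀ k : Fin n, specAngle n (Fin.rev k) = Real.pi - specAngle n k := by
    intro k
    have hn : ((n : ℝ) + 1) ≠ 0 := by positivity
    have : ((Fin.rev k : Fin n) : ℕ) + (k + 1) = n := by rw [Fin.val_rev]; have := k.2; omega
    have : (((Fin.rev k : Fin n) : ℕ) : ℝ) = n - (k + 1) := by
      rw [eq_sub_iff_add_eq]; exact_mod_cast this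
    unfold specAngle
    rw [this]
    field_simp
    ring
  have hcot : ∑ k : Fin n, Real.cot (specAngle n k) = 0 := by
    have h1 : ∑ k : Fin n, Real.cot (specAngle n k) =
        ∑ k : Fin n, Real.cot (specAngle n (Fin.rev k)) :=
      (Equiv.sum_comp Fin.revPerm fun k => Real.cot (specAngle n k)).symm
    have h2 : ∀ k : Fin n, Real.cot (specAngle n (Fin.rev k)) = - Real.cot (specAngle n k) := by
      intro k
      rw [hrev, Real.cot_eq_cos_div_sin, Real.cot_eq_cos_div_sin, Real.cos_pi_sub,
        Real.sin_pi_sub, neg_div]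
    simp only [h2, sum_neg_distrib] at h1
    linarith
  have : ∑ k, wav n lam0 k = -(n * (2 * lam0.re)) := by
    simp only [wav_eq, sum_sub_distrib, ← mul_sum, hcot]
    simp
    ring
  exact_mod_cast this

theorem chi0_sub_star : chi0 n lam0 - star (chi0 n lam0) = 2 * Complex.I * specScale n lam0 := by
  have := Complex.sub_conj (chi0 n lam0)
  rw [chi0_im] at this
  rw [Complex.star_def, this]
  push_cast; ring

theorem chi0_sub_star_ne_zero (h : lam0.im ≠ 0) : chi0 n lam0 - star (chi0 n lam0) ≠ 0 := by
  rw [chi0_sub_star]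
  have : (specScale n lam0 : ℂ) ≠ 0 := by exact_mod_cast specScale_ne_zero h
  simp [this]

end SpectralData

/-! ### The characteristic polynomial is a pure power at `λ₀`. -/

section CharPoly

open Polynomial

variable (n : ℕ) (lam0 : ℂ)

/-- `∏_j (T + b_j)`. -/
def wavPoly : ℂ[X] := ∏ j, (X + C (wav n lam0 j : ℂ))

variable {n lam0}

/-- Both sides have degree at most `n` and the same coefficient at `n`. They vanish at the `n`
distinct points `-b_k`, the right side by `star_chi0_add_wav_pow`; a difference of degree below `n`
with `n` zeros is zero. -/
theorem wavPoly_identity (h : lam0.im ≠ 0) :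
    C ((n + 1) * (chi0 n lam0 - star (chi0 n lam0))) * wavPoly n lam0 =
      (X - C (star (chi0 n lam0))) ^ (n + 1) - (X - C (chi0 n lam0)) ^ (n + 1) := by
  have hcoef : ∀ z : ℂ, ((X - C z) ^ (n + 1)).coeff n = (n + 1) * -z := by
    intro z
    have := Polynomial.coeff_X_add_C_pow (-z) (n + 1) n
    rw [map_neg, ← sub_eq_add_neg] at this
    rw [this]
    simp [mul_comm]
  have hmon : ∀ z : ℂ, ((X - C z) ^ (n + 1)).Monic := fun z => (monic_X_sub_C z).pow _
  have hdeg : ∀ z : ℂ, ((X - C z) ^ (n + 1)).natDegree = n + 1 := fun z => by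
    rw [(monic_X_sub_C z).natDegree_pow]; simp
  have hwmon : (wavPoly n lam0).Monic := monic_prod_of_monic _ _ fun j _ => monic_X_add_C _
  have hwdeg : (wavPoly n lam0).natDegree = n := by
    rw [wavPoly, natDegree_prod_of_monic _ _ fun j _ => monic_X_add_C _]; simp
  set δ := chi0 n lam0 - star (chi0 n lam0) with hδ
  refine Polynomial.eq_of_degree_sub_lt_of_eval_finset_eq
    (univ.image fun k => -(wav n lam0 k : ℂ)) ?_ ?_
  · rw [card_image_of_injective _ fun i j hij => wav_injective h (by simpa using hij), card_univ,
      Fintype.card_fin, Polynomial.degree_lt_iff_coeff_zero]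
    intro m hm
    rw [coeff_sub, coeff_C_mul, coeff_sub]
    rcases eq_or_lt_of_le hm with rfl | hm
    · rw [hcoef, hcoef]
      have : (wavPoly n lam0).coeff n = 1 := by
        rw [Monic, leadingCoeff, hwdeg] at hwmon
        exact hwmon
      rw [this, hδ]; ring
    · rw [coeff_eq_zero_of_natDegree_lt (by omega : (wavPoly n lam0).natDegree < m)]
      rcases eq_or_lt_of_le (Nat.succ_le_of_lt hm) with rfl | hm
      · have : ∀ z : ℂ, ((X - C z) ^ (n + 1)).coeff (n + 1) = 1 := fun z => by
          have := hmon z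
          rw [Monic, leadingCoeff, hdeg] at this
          exact this
        rw [Nat.succ_eq_add_one, this, this]; simp
      · have : ∀ z : ℂ, ((X - C z) ^ (n + 1)).coeff m = 0 := fun z =>
          coeff_eq_zero_of_natDegree_lt (by rw [hdeg]; omega)
        rw [this, this]; simp
  · intro x hx
    obtain ⟨k, -, rfl⟩ := mem_image.1 hx
    have h0 : eval (-(wav n lam0 k : ℂ)) (wavPoly n lam0) = 0 := by
      rw [wavPoly, eval_prod]
      exact prod_eq_zero (mem_univ k) (by simp)
    have h1 := star_chi0_add_wav_pow (lam0 := lam0) k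
    have h2 : ∀ z : ℂ, (-(wav n lam0 k : ℂ) - z) ^ (n + 1) =
        (-1) ^ (n + 1) * (z + wav n lam0 k) ^ (n + 1) := fun z => by
      rw [← mul_pow]; congr 1; ring
    simp only [eval_mul, h0, mul_zero, eval_sub, eval_pow, eval_X, eval_C]
    rw [h2, h2, h1, sub_self]

theorem derivative_wavPoly :
    derivative (wavPoly n lam0) = ∑ i, ∏ j ∈ univ.erase i, (X + C (wav n lam0 j : ℂ)) := by
  rw [wavPoly, derivative_prod_finset]
  simp

theorem derivative_wavPoly_identity (h : lam0.im ≠ 0) :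
    C (chi0 n lam0 - star (chi0 n lam0)) * derivative (wavPoly n lam0) =
      (X - C (star (chi0 n lam0))) ^ n - (X - C (chi0 n lam0)) ^ n := by
  have := congrArg derivative (wavPoly_identity (n := n) h)
  simp only [derivative_mul, derivative_C, mul_zero, zero_mul, zero_add, derivative_sub,
    derivative_pow, derivative_X, sub_zero, mul_one, Nat.add_sub_cancel, C_mul] at this
  have hn' : (C ((n : ℂ) + 1)) ≠ 0 := by
    rw [Ne, C_eq_zero]; exact_mod_cast Nat.succ_ne_zero n
  refine mul_left_cancel₀ hn' ?_
  rw [← mul_assoc, this]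
  push_cast
  simp only [map_natCast, map_add, map_one]
  ring

/-- The amplitudes satisfy `a_k² = (χ₀ + b_k)(χ₀* + b_k)`, so the sum over `i` can be expressed by
`∏ (T + b_j)` and its derivative. Both are differences of powers of `T - χ₀*` and `T - χ₀`, and the
powers of `T - χ₀*` cancel for the given `λ₀`. -/
theorem charPoly_identity (h : lam0.im ≠ 0) :
    (X - C (2 * lam0)) * wavPoly n lam0 -
      ∑ i, C ((amp n lam0 i : ℂ) ^ 2) * ∏ j ∈ univ.erase i, (X + C (wav n lam0 j : ℂ)) =
    (X - C (chi0 n lam0)) ^ (n + 1) := by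
  set χ := chi0 n lam0 with hχ
  set δ := χ - star χ with hδ
  have hδ0 : C δ ≠ 0 := by
    rw [Ne, C_eq_zero]; exact chi0_sub_star_ne_zero h
  have hn' : (C ((n : ℂ) + 1)) ≠ 0 := by
    rw [Ne, C_eq_zero]; exact_mod_cast Nat.succ_ne_zero n
  have h2 : star χ = χ - δ := by rw [hδ]; ring
  have hre : (4 * lam0.re : ℂ) = χ + star χ := by
    have := Complex.add_conj χ
    rw [hχ, chi0_re, ← Complex.star_def] at this
    rw [hχ, this]; push_cast; ring
  have hlam : 4 * lam0 = χ + star χ + (n + 1) * δ := by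
    rw [← hre, hδ, hχ, chi0_sub_star, specScale]
    have : ((n : ℂ) + 1) ≠ 0 := by exact_mod_cast Nat.succ_ne_zero n
    push_cast
    field_simp
    linear_combination (-4 : ℂ) * (Complex.re_add_im lam0)
  -- With `a_i² = (χ + b_i)(χ* + b_i)` this is `a_i² = (T - χ)(T - χ*) - (T + b_i)(T - b_i - χ -
  -- χ*)`, multiplied by the other factors.
  have hterm : ∀ i, C ((amp n lam0 i : ℂ) ^ 2) * ∏ j ∈ univ.erase i, (X + C (wav n lam0 j : ℂ)) =
      (X - C χ) * (X - C (star χ)) * (∏ j ∈ univ.erase i, (X + C (wav n lam0 j : ℂ))) -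
        wavPoly n lam0 * (X - C (wav n lam0 i : ℂ) - C (χ + star χ)) := by
    intro i
    rw [wavPoly, ← mul_prod_erase univ _ (mem_univ i), ← chi0_mul_star_eq_amp_sq]
    simp only [C_mul, C_add, ← hχ]
    ring
  have hsum : ∑ i, C ((amp n lam0 i : ℂ) ^ 2) * ∏ j ∈ univ.erase i, (X + C (wav n lam0 j : ℂ)) =
      (X - C χ) * (X - C (star χ)) * derivative (wavPoly n lam0) -
        wavPoly n lam0 * (C (n : ℂ) * X - C (n : ℂ) * C (2 * (lam0.re : ℂ))) := by
    rw [sum_congr rfl fun i _ => hterm i, sum_sub_distrib, ← mul_sum, ← mul_sum,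
      ← derivative_wavPoly, sum_sub_distrib, sum_sub_distrib, ← map_sum, sum_wav, ← hre]
    simp only [sum_const, card_univ, Fintype.card_fin, nsmul_eq_mul, C_mul, C_neg, map_natCast]
    have : (C (4 : ℂ)) = C 2 * 2 := by rw [← C_ofNat, ← C_mul]; norm_num
    rw [this]
    ring
  have hQ := wavPoly_identity (n := n) h
  have hQ' := derivative_wavPoly_identity (n := n) h
  rw [← hχ, ← hδ] at hQ hQ'
  rw [hsum]
  have hl : C (2 * lam0) * 2 = C χ + C (star χ) + C ((n : ℂ) + 1) * C δ := by
    rw [← C_mul, ← C_add, ← C_add, ← hlam, ← C_ofNat, ← C_mul]; congr 1; ring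
  have hr : C (2 * (lam0.re : ℂ)) * 2 = C χ + C (star χ) := by
    rw [← C_add, ← hre, ← C_ofNat, ← C_mul]; congr 1; ring
  have hd : C δ = C χ - C (star χ) := by rw [hδ, C_sub]
  refine mul_left_cancel₀ hδ0 (mul_left_cancel₀ (two_ne_zero (α := ℂ[X])) ?_)
  rw [C_mul] at hQ
  have hn1 : C ((n : ℂ) + 1) = C (n : ℂ) + 1 := by rw [C_add, C_1]
  rw [hn1] at hl hQ
  generalize C (2 * lam0) = L at *
  generalize C (2 * (lam0.re : ℂ)) = Rr at *
  generalize C χ = c at *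
  generalize C (star χ) = c' at *
  generalize C δ = D at *
  generalize C (n : ℂ) = m at *
  generalize wavPoly n lam0 = Q at *
  generalize derivative Q = Q' at *
  rw [pow_succ] at hQ ⊢
  rw [pow_succ] at hQ
  subst hd
  linear_combination (-(c - c') * Q) * hl - (c - c') * m * Q * hr + 2 * (X - c) * hQ
    - 2 * (X - c) * (X - c') * hQ'

end CharPoly

end RogueWave

end

/-! ### Low-order coefficients of the branch `χ(ε)`. -/

noncomputable section

namespace RogueWave

open Finset PowerSeries

theorem coeff_one_pow_of_constantCoeff_zero {g : PowerSeries ℂ} (hg : constantCoeff g = 0)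
    {d : ℕ} (hd : 2 ≤ d) : coeff 1 (g ^ d) = 0 :=
  X_pow_dvd_iff.1 (pow_dvd_pow_of_dvd (X_dvd_iff.2 hg) d) 1 (by omega)

theorem coeff_one_logOf {f : PowerSeries ℂ} (hf : constantCoeff f = 1) :
    coeff 1 (logOf f) = coeff 1 f := by
  have h0 : constantCoeff (f - 1) = 0 := by rw [map_sub, hf, map_one, sub_self]
  rw [logOf_eq, coeff_subst' (HasSubst.of_constantCoeff_zero' h0), finsum_eq_single _ 1]
  · simp
  · intro d hd
    rcases Nat.lt_or_ge d 1 with h | h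
    · have : d = 0 := by omega
      subst this; simp
    · rw [coeff_one_pow_of_constantCoeff_zero h0 (by omega), smul_zero]

theorem coeff_one_mul' (f g : PowerSeries ℂ) :
    coeff 1 (f * g) = coeff 1 f * constantCoeff g + constantCoeff f * coeff 1 g := by
  rw [coeff_mul, Finset.Nat.sum_antidiagonal_eq_sum_range_succ_mk]
  simp [sum_range_succ, add_comm]

theorem coeff_one_pow' (f : PowerSeries ℂ) (n : ℕ) :
    coeff 1 (f ^ (n + 1)) = (n + 1) * constantCoeff f ^ n * coeff 1 f := by
  induction n with
  | zero => simp
  | succ n ih =>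
    rw [pow_succ, coeff_one_mul', ih, map_pow]
    push_cast
    ring

theorem constantCoeff_aeval (p : Polynomial ℂ) (f : PowerSeries ℂ) :
    constantCoeff (Polynomial.aeval f p) = p.eval (constantCoeff f) := by
  induction p using Polynomial.induction_on' with
  | add p q hp hq => simp [hp, hq]
  | monomial n a => simp [Polynomial.aeval_monomial]

theorem coeff_one_aeval (p : Polynomial ℂ) (f : PowerSeries ℂ) :
    coeff 1 (Polynomial.aeval f p) =
      (Polynomial.derivative p).eval (constantCoeff f) * coeff 1 f := by
  induction p using Polynomial.induction_on' with
  | add p q hp hq => simp [hp, hq, add_mul]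
  | monomial n a =>
    cases n with
    | zero => simp
    | succ n =>
      simp only [Polynomial.aeval_monomial, PowerSeries.algebraMap_apply, Algebra.algebraMap_self,
        RingHom.id_apply, coeff_C_mul, coeff_one_pow', Polynomial.derivative_monomial,
        Polynomial.eval_monomial, Nat.add_sub_cancel, Nat.cast_add, Nat.cast_one]
      ring

section Branch

variable {n : ℕ} {lam0 lam1 : ℂ} {chi : PowerSeries ℂ}

/-- `(χ(ε) - χ₀) / ε`. -/
def chiShift (chi : PowerSeries ℂ) : PowerSeries ℂ :=
  PowerSeries.mk fun i => PowerSeries.coeff (i + 1) chi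

theorem chi_eq (hchi : IsCharBranch n lam0 lam1 chi) :
    chi = C (chi0 n lam0) + X * chiShift chi := by
  ext j
  cases j with
  | zero => simp [hchi.1]
  | succ j => simp [chiShift, coeff_succ_X_mul]

/-- At `λ(ε)` the characteristic equation differs from the one at `λ₀` only by `2 λ^{[1]} ε^(n+1) ∏
(χ + b_j)`. By `charPoly_identity` it reads `(χ - χ₀)^(n+1)` = that term, and `ε^(n+1)` cancels. -/
theorem chiShift_pow (hchi : IsCharBranch n lam0 lam1 chi) (h : lam0.im ≠ 0) :
    chiShift chi ^ (n + 1) = C (2 * lam1) * Polynomial.aeval chi (wavPoly n lam0) := by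
  have hunit : ∀ i : Fin n, (chi + C (wav n lam0 i : ℂ)) *
      (chi + C (wav n lam0 i : ℂ))⁻¹ = 1 := fun i => by
    refine PowerSeries.mul_inv_cancel _ ?_
    rw [map_add, hchi.1, constantCoeff_C]
    exact chi0_add_wav_ne_zero h i
  have hW : Polynomial.aeval chi (wavPoly n lam0) = ∏ j, (chi + C (wav n lam0 j : ℂ)) := by
    rw [wavPoly, map_prod]
    simp
  have h1 := hchi.2
  rw [sub_mul, sum_mul] at h1
  have h2 : ∀ i : Fin n, C ((amp n lam0 i : ℂ) ^ 2) * (chi + C (wav n lam0 i : ℂ))⁻¹ *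
      ∏ j, (chi + C (wav n lam0 j : ℂ)) =
      C ((amp n lam0 i : ℂ) ^ 2) * ∏ j ∈ univ.erase i, (chi + C (wav n lam0 j : ℂ)) := fun i => by
    rw [← mul_prod_erase univ _ (mem_univ i)]
    linear_combination (C ((amp n lam0 i : ℂ) ^ 2) *
      ∏ j ∈ univ.erase i, (chi + C (wav n lam0 j : ℂ))) * hunit i
  rw [sum_congr rfl fun i _ => h2 i] at h1
  have h3 := congrArg (Polynomial.aeval chi) (charPoly_identity (n := n) h)
  simp only [map_sub, map_mul, map_sum, map_prod, map_pow, map_add, Polynomial.aeval_X,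
    Polynomial.aeval_C, PowerSeries.algebraMap_apply, Algebra.algebraMap_self, RingHom.id_apply] at h3
  simp only [map_pow] at h1
  have h4 : X ^ (n + 1) * chiShift chi ^ (n + 1) =
      X ^ (n + 1) * (C (2 * lam1) * Polynomial.aeval chi (wavPoly n lam0)) := by
    have h5 : chi - C (chi0 n lam0) = X * chiShift chi := by
      conv_lhs => rw [chi_eq hchi]
      ring
    rw [← mul_pow, ← h5, ← h3, hW]
    simp only [lamSeries, map_mul] at h1 ⊢
    have hC2 : (C (2 : ℂ) : PowerSeries ℂ) = 2 := map_ofNat _ 2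
    rw [hC2]
    linear_combination h1
  exact mul_left_cancel₀ (pow_ne_zero _ X_ne_zero) h4

theorem constantCoeff_chiShift : constantCoeff (chiShift chi) = chi1 chi := by
  rw [← coeff_zero_eq_constantCoeff_apply, chiShift, coeff_mk, chi1]

theorem chi1_pow (hchi : IsCharBranch n lam0 lam1 chi) (h : lam0.im ≠ 0) :
    chi1 chi ^ (n + 1) = 2 * lam1 * (wavPoly n lam0).eval (chi0 n lam0) := by
  have := congrArg constantCoeff (chiShift_pow hchi h)
  rw [map_pow, constantCoeff_chiShift, map_mul, constantCoeff_C, constantCoeff_aeval,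
    hchi.1] at this
  exact this

theorem chi1_ne_zero (hchi : IsCharBranch n lam0 lam1 chi) (h : lam0.im ≠ 0)
    (hlam1 : lam1 ≠ 0) : chi1 chi ≠ 0 := by
  intro h0
  have := chi1_pow hchi h
  rw [h0, zero_pow (Nat.succ_ne_zero n), wavPoly, Polynomial.eval_prod] at this
  refine (mul_ne_zero (mul_ne_zero two_ne_zero hlam1) (prod_ne_zero_iff.2 fun i _ => ?_)) this.symm
  simpa using chi0_add_wav_ne_zero h i

/-- The coefficients of orders zero and one in `chiShift_pow`. With `Q = ∏ (T + b_j)` and `δ = χ₀ -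
χ₀*`, the explicit form of `Q` gives `(n+1) δ Q(χ₀) = δ^(n+1)` and `δ Q'(χ₀) = δ^n`; here `n ≥ 1` is
needed for the second value. -/
theorem coeff_two_chi (hn : 1 ≤ n) (hchi : IsCharBranch n lam0 lam1 chi) (h : lam0.im ≠ 0)
    (hlam1 : lam1 ≠ 0) :
    coeff 2 chi * (chi0 n lam0 - star (chi0 n lam0)) = chi1 chi ^ 2 := by
  have hc1 := chi1_ne_zero hchi h hlam1
  have h1 := congrArg (coeff 1) (chiShift_pow hchi h)
  rw [coeff_one_pow', coeff_C_mul, coeff_one_aeval, constantCoeff_chiShift, hchi.1] at h1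
  have h2 : coeff 1 (chiShift chi) = coeff 2 chi := by rw [chiShift, coeff_mk]
  have h3 : coeff 1 chi = chi1 chi := rfl
  rw [h2, h3] at h1
  have h4 := chi1_pow hchi h
  have h5 := congrArg (Polynomial.eval (chi0 n lam0)) (wavPoly_identity (n := n) h)
  have h6 := congrArg (Polynomial.eval (chi0 n lam0)) (derivative_wavPoly_identity (n := n) h)
  simp only [Polynomial.eval_mul, Polynomial.eval_C, Polynomial.eval_sub, Polynomial.eval_pow,
    Polynomial.eval_X, sub_self, zero_pow (Nat.succ_ne_zero n),
    zero_pow (show n ≠ 0 by omega), sub_zero] at h5 h6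
  have hδ := chi0_sub_star_ne_zero (n := n) h
  generalize chi0 n lam0 - star (chi0 n lam0) = δ at *
  have hn' : ((n : ℂ) + 1) ≠ 0 := by exact_mod_cast Nat.succ_ne_zero n
  have hcn : chi1 chi ^ n ≠ 0 := pow_ne_zero _ hc1
  rw [pow_succ] at h4
  refine mul_left_cancel₀ hδ (mul_left_cancel₀ hcn (mul_left_cancel₀ hn' ?_))
  rw [pow_succ] at h5
  linear_combination δ ^ 2 * h1 + 2 * lam1 * δ * chi1 chi * h6 - (n + 1) * δ * chi1 chi * h4
    - 2 * lam1 * chi1 chi * h5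

/-- The logarithmic derivative at `ε = 0` is `χ^{[2]} / χ^{[1]} - χ^{[1]} / (χ₀ - χ₀*)`, which
vanishes by `coeff_two_chi`. Consequently the first Schur argument is the same in every row `v`, and
the first-order corrections of a determinant add up to a derivative of the Wronskian. -/
theorem h1_one (hn : 1 ≤ n) (hchi : IsCharBranch n lam0 lam1 chi) (h : lam0.im ≠ 0)
    (hlam1 : lam1 ≠ 0) : h1 n lam0 chi 1 = 0 := by
  have hc1 := chi1_ne_zero hchi h hlam1
  have hδ := chi0_sub_star_ne_zero (n := n) h
  set f := chi - C (star (chi0 n lam0)) with hf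
  have hf0 : constantCoeff f = chi0 n lam0 - star (chi0 n lam0) := by
    rw [hf, map_sub, hchi.1, constantCoeff_C]
  have hf1 : coeff 1 f = chi1 chi := by
    rw [hf, map_sub, coeff_C, if_neg one_ne_zero, sub_zero]; rfl
  have hinv0 : constantCoeff f⁻¹ = (chi0 n lam0 - star (chi0 n lam0))⁻¹ := by
    rw [constantCoeff_inv, hf0]
  have hinv1 : coeff 1 f⁻¹ * (chi0 n lam0 - star (chi0 n lam0)) ^ 2 = - chi1 chi := by
    have := congrArg (coeff 1) (PowerSeries.mul_inv_cancel f (by rw [hf0]; exact hδ))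
    rw [coeff_one_mul', hf0, hf1, hinv0, coeff_one, if_neg one_ne_zero] at this
    field_simp at this
    linear_combination this
  change coeff 1 (logOf (C ((chi0 n lam0 - star (chi0 n lam0)) / chi1 chi) * chiShift chi * f⁻¹)) = 0
  rw [coeff_one_logOf]
  · rw [coeff_one_mul', coeff_C_mul, map_mul, constantCoeff_C, constantCoeff_chiShift, hinv0]
    have h2 : coeff 1 (chiShift chi) = coeff 2 chi := by rw [chiShift, coeff_mk]
    have h3 := coeff_two_chi hn hchi h hlam1
    rw [h2]
    generalize chi0 n lam0 - star (chi0 n lam0) = δ at *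
    field_simp
    refine mul_left_cancel₀ hδ ?_
    linear_combination h3 + chi1 chi * hinv1
  · rw [map_mul, map_mul, constantCoeff_C, constantCoeff_chiShift, hinv0]
    field_simp

theorem h2_one (hchi : IsCharBranch n lam0 lam1 chi) (h : lam0.im ≠ 0) (k : Fin n) :
    h2 n lam0 chi k 1 = chi1 chi / (chi0 n lam0 + (wav n lam0 k : ℂ)) := by
  have h0 := chi0_add_wav_ne_zero h k
  rw [h2, coeff_one_logOf]
  · rw [coeff_C_mul, map_add, coeff_C, if_neg one_ne_zero, add_zero, chi1]
    field_simp
  · rw [map_mul, constantCoeff_C, map_add, constantCoeff_C, hchi.1, inv_mul_cancel₀ h0]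

theorem coeff_one_lamSeries (hn : 1 ≤ n) : coeff 1 (lamSeries n lam0 lam1) = 0 := by
  rw [lamSeries, map_add, coeff_C_mul, coeff_X_pow, if_neg (by omega), coeff_C,
    if_neg one_ne_zero, mul_zero, add_zero]

theorem alpha_one (hn : 1 ≤ n) : alpha n lam0 lam1 chi 1 = Complex.I * chi1 chi := by
  rw [alpha, coeff_C_mul, map_sub, coeff_one_lamSeries hn, sub_zero, chi1]

/-- Together with `alpha_one` it makes `α₁ x + β₁ i t` equal to `i χ^{[1]} (x + χ₀ t)`, the natural
complex coordinate of the plane. -/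
theorem beta_one (hn : 1 ≤ n) (hchi : IsCharBranch n lam0 lam1 chi) :
    beta n lam0 lam1 chi 1 = chi0 n lam0 * chi1 chi := by
  rw [beta, map_sub, map_sub, coeff_C_mul, pow_two, pow_two, coeff_one_mul', coeff_one_mul',
    coeff_one_lamSeries hn, hchi.1, coeff_C, if_neg one_ne_zero, chi1]
  ring

end Branch

end RogueWave

end

/-! ### The polynomials `φ` and determinants of their derivatives. -/

noncomputable section

namespace RogueWave

open Finset Polynomial

section Phi

variable (n : ℕ) (kap : Fin n → ℕ → ℂ) (l : Fin n)

theorem schur_X_single (m : ℕ) :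
    schur (fun i => if i = 1 then (X : ℂ[X]) else 0) m = C ((m.factorial : ℂ))⁻¹ * X ^ m := by
  have h2 := factorial_mul_schur_single (X : ℂ[X]) m
  have h3 : C ((m.factorial : ℂ))⁻¹ * (m.factorial : ℂ[X]) = 1 := by
    rw [← C_eq_natCast, ← C_mul, inv_mul_cancel₀ (by exact_mod_cast Nat.factorial_ne_zero _), C_1]
  rw [← h2, ← mul_assoc, h3, one_mul]

/-- The coefficients of `exp (∑_{(n+1) ∤ i} κ_{l,i} ε^i)`. -/
def kapSchur (j : ℕ) : ℂ := schur (fun i => if (n + 1) ∣ i then 0 else kap l i) j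

theorem phi_eq_sum (j : ℕ) : phi n kap l j =
    ∑ i ∈ range (j + 1), C (kapSchur n kap l i * (((j - i).factorial : ℂ))⁻¹) * X ^ (j - i) := by
  have h0 : (fun i => if (n + 1) ∣ i then (0 : ℂ[X]) else C (kap l i)) =
      fun i => C (if (n + 1) ∣ i then 0 else kap l i) := by
    funext i
    rw [apply_ite C, C_0]
  rw [phi, schur_add, h0]
  refine sum_congr rfl fun i _ => ?_
  have h1 := map_schur (C : ℂ →+* ℂ[X]) (fun i => if (n + 1) ∣ i then 0 else kap l i) i
  rw [← h1, schur_X_single, C_mul, mul_assoc, kapSchur]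

/-- Differentiation in `z` multiplies the generating series by `ε`. Hence lowering an index, going
down one row and differentiating are the same operation. -/
theorem derivative_phi_succ (j : ℕ) : derivative (phi n kap l (j + 1)) = phi n kap l j := by
  rw [phi_eq_sum, phi_eq_sum, derivative_sum, sum_range_succ]
  simp only [Nat.sub_self, pow_zero, mul_one, derivative_C, add_zero]
  refine sum_congr rfl fun i hi => ?_
  have hi' : j + 1 - i = (j - i) + 1 := by have := mem_range.1 hi; omega
  rw [hi', derivative_C_mul, derivative_X_pow, Nat.add_sub_cancel, ← mul_assoc,
    ← C_mul, Nat.factorial_succ]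
  congr 2
  have : (((j - i : ℕ) : ℂ) + 1) ≠ 0 := by exact_mod_cast Nat.succ_ne_zero (j - i)
  have h2 : ((j - i).factorial : ℂ) ≠ 0 := by exact_mod_cast Nat.factorial_ne_zero _
  push_cast
  field_simp

theorem phi_zero : phi n kap l 0 = 1 := schur_zero _

theorem iterate_derivative_phi (i j : ℕ) :
    derivative^[i] (phi n kap l j) = if i ≤ j then phi n kap l (j - i) else 0 := by
  induction i with
  | zero => simp
  | succ i ih =>
    rw [Function.iterate_succ_apply', ih]
    split_ifs with h1 h2 h2
    · rw [show j - i = (j - (i + 1)) + 1 by omega, derivative_phi_succ]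
    · rw [show j - i = 0 by omega, phi_zero, derivative_one]
    · omega
    · rw [derivative_zero]

theorem natDegree_phi_le (j : ℕ) : (phi n kap l j).natDegree ≤ j := by
  rw [phi_eq_sum]
  refine natDegree_sum_le_of_forall_le _ _ fun i _ => ?_
  exact (natDegree_C_mul_X_pow_le _ _).trans (Nat.sub_le _ _)

theorem coeff_phi_self (j : ℕ) : (phi n kap l j).coeff j = ((j.factorial : ℂ))⁻¹ := by
  rw [phi_eq_sum, finsetSum_coeff, sum_eq_single 0]
  · rw [coeff_C_mul_X_pow, if_pos (by omega), kapSchur, schur_zero, one_mul, Nat.sub_zero]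
  · intro i hi hi0
    rw [coeff_C_mul_X_pow, if_neg]
    have := mem_range.1 hi
    omega
  · simp

/-- The exponents `z δ_{i,1} + κ_{l,i} A^i`, `(n+1) ∤ i`. -/
def baseSeq (A z : ℂ) (i : ℕ) : ℂ := (if i = 1 then z else 0) + if (n + 1) ∣ i then 0 else kap l i * A ^ i

theorem eval_phi (z : ℂ) (j : ℕ) : (phi n kap l j).eval z = schur (baseSeq n kap l 1 z) j := by
  rw [phi, ← coe_evalRingHom, map_schur]
  congr 1
  funext i
  simp only [coe_evalRingHom, baseSeq, one_pow, mul_one, eval_add]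
  congr 1 <;> split_ifs <;> simp

theorem schur_baseSeq_scale (c A z : ℂ) (j : ℕ) :
    schur (baseSeq n kap l (c * A) (c * z)) j = c ^ j * schur (baseSeq n kap l A z) j := by
  rw [← schur_scale]
  congr 1
  funext i
  simp only [baseSeq, mul_add]
  congr 1
  · split_ifs with h
    · rw [h, pow_one]
    · rw [mul_zero]
  · split_ifs
    · rw [mul_zero]
    · rw [mul_pow]; ring

end Phi

section Det

variable {R : Type*} [CommRing R]

theorem derivative_det {ι : Type*} [Fintype ι] [DecidableEq ι] (F : Matrix ι ι R[X]) :
    derivative F.det = ∑ i, (F.updateRow i fun j => derivative (F i j)).det := by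
  have h : ∀ i, (F.updateRow i fun j => derivative (F i j)).det =
      ∑ σ : Equiv.Perm ι, ((Equiv.Perm.sign σ : ℤ) : R[X]) *
        ((∏ k ∈ univ.erase i, F k (σ k)) * derivative (F i (σ i))) := by
    intro i
    rw [← Matrix.det_transpose, Matrix.det_apply']
    refine sum_congr rfl fun σ _ => ?_
    rw [← mul_prod_erase univ _ (mem_univ i), mul_comm (∏ k ∈ univ.erase i, F k (σ k))]
    simp only [Matrix.transpose_apply, Matrix.updateRow_self]
    congr 2
    refine prod_congr rfl fun k hk => ?_
    rw [Matrix.updateRow_ne (ne_of_mem_erase hk)]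
  rw [sum_congr rfl fun i _ => h i, sum_comm, ← Matrix.det_transpose, Matrix.det_apply',
    derivative_sum]
  refine sum_congr rfl fun σ _ => ?_
  rw [derivative_intCast_mul, derivative_prod_finset, mul_sum]
  rfl

variable {N : ℕ}

/-- The square matrix with the rows `r (p 0), …, r (p (N - 1))`. -/
def rowMatrix {R : Type*} {N : ℕ} (r : ℕ → Fin N → R) (p : Fin N → ℕ) : Matrix (Fin N) (Fin N) R :=
  Matrix.of fun i => r (p i)

theorem rowMatrix_updateRow {R : Type*} {N : ℕ} (r : ℕ → Fin N → R) (p : Fin N → ℕ) (i : Fin N) (q : ℕ) :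
    (rowMatrix r p).updateRow i (r q) = rowMatrix r (Function.update p i q) := by
  ext k j
  by_cases h : k = i
  · subst h; simp [rowMatrix]
  · simp [rowMatrix, h]

theorem det_rowMatrix_eq_zero (r : ℕ → Fin N → R) (p : Fin N → ℕ) {i j : Fin N} (hij : i ≠ j)
    (h : p i = p j) : (rowMatrix r p).det = 0 :=
  Matrix.det_zero_of_row_eq hij (by show r (p i) = r (p j); rw [h])

/-- Raising row `i` by one duplicates row `i + 1`, except for the last row. -/
theorem sum_det_updateRow_succ (r : ℕ → Fin N → R) (hN : 0 < N) :
    ∑ i : Fin N, ((rowMatrix r fun i => i).updateRow i (r (i + 1))).det =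
      (rowMatrix r fun i => if (i : ℕ) + 1 = N then N else i).det := by
  rw [sum_eq_single ⟨N - 1, by omega⟩]
  · rw [rowMatrix_updateRow]
    congr 2
    funext i
    by_cases h : i = ⟨N - 1, by omega⟩
    · subst h
      simp only [Function.update_self]
      split_ifs <;> omega
    · have : (i : ℕ) ≠ N - 1 := fun hc => h (Fin.ext hc)
      rw [Function.update_of_ne h, if_neg (by omega)]
  · intro i _ hi
    have h1 : (i : ℕ) ≠ N - 1 := fun hc => hi (Fin.ext hc)
    have h2 := i.2
    rw [rowMatrix_updateRow]
    have hne : i ≠ ⟨i + 1, by omega⟩ := fun hc => by have := congrArg Fin.val hc; simp at this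
    refine det_rowMatrix_eq_zero r _ hne ?_
    rw [Function.update_self, Function.update_of_ne hne.symm]
  · simp

/-- Raising row `i` by two duplicates row `i + 2`, so only the last two rows contribute; these are
the two determinants of `W^{[2]}`. -/
theorem sum_det_updateRow_succ_succ (r : ℕ → Fin N → R) (hN : 0 < N)
    (h0 : (rowMatrix r fun i => i).det = 0) :
    ∑ i : Fin N, ((rowMatrix r fun i => i).updateRow i (r (i + 2))).det =
      (rowMatrix r fun i => if (i : ℕ) + 2 = N then N else i).det +
      (rowMatrix r fun i => if (i : ℕ) + 1 = N then N + 1 else i).det := by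
  have hz : ∀ i : Fin N, (i : ℕ) + 2 < N →
      ((rowMatrix r fun i => i).updateRow i (r (i + 2))).det = 0 := by
    intro i hi
    rw [rowMatrix_updateRow]
    have hne : i ≠ ⟨i + 2, by omega⟩ := fun hc => by have := congrArg Fin.val hc; simp at this
    refine det_rowMatrix_eq_zero r _ hne ?_
    rw [Function.update_self, Function.update_of_ne hne.symm]
  have hlast : ((rowMatrix r fun i => i).updateRow ⟨N - 1, by omega⟩ (r (N - 1 + 2))).det =
      (rowMatrix r fun i => if (i : ℕ) + 1 = N then N + 1 else i).det := by
    rw [rowMatrix_updateRow]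
    congr 2
    funext i
    by_cases h : i = ⟨N - 1, by omega⟩
    · subst h
      simp only [Function.update_self]
      split_ifs <;> omega
    · have : (i : ℕ) ≠ N - 1 := fun hc => h (Fin.ext hc)
      rw [Function.update_of_ne h, if_neg (by omega)]
  -- For `N = 1` there is no last but one row, and the first determinant on the right is the
  -- unshifted one; this is the only use of `h0`.
  by_cases hN1 : N = 1
  · have : (rowMatrix r fun i => if (i : ℕ) + 2 = N then N else i).det = 0 := by
      rw [← h0]
      congr 2
      funext i
      rw [if_neg (by omega)]
    rw [this, zero_add, ← hlast, sum_eq_single ⟨N - 1, by omega⟩]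
    · intro i _ hi
      exact absurd (Fin.ext (by have := i.2; show (i : ℕ) = N - 1; omega)) hi
    · simp
  · have hprev : ((rowMatrix r fun i => i).updateRow ⟨N - 2, by omega⟩ (r (N - 2 + 2))).det =
        (rowMatrix r fun i => if (i : ℕ) + 2 = N then N else i).det := by
      rw [rowMatrix_updateRow]
      congr 2
      funext i
      by_cases h : i = ⟨N - 2, by omega⟩
      · subst h
        simp only [Function.update_self]
        split_ifs <;> omega
      · have : (i : ℕ) ≠ N - 2 := fun hc => h (Fin.ext hc)
        rw [Function.update_of_ne h, if_neg (by omega)]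
    rw [← hlast, ← hprev]
    have hne : (⟨N - 2, by omega⟩ : Fin N) ≠ ⟨N - 1, by omega⟩ := fun hc => by
      have := congrArg Fin.val hc; simp only at this; omega
    rw [← sum_subset (subset_univ {(⟨N - 2, by omega⟩ : Fin N), ⟨N - 1, by omega⟩}),
      sum_pair hne]
    intro i _ hi
    simp only [mem_insert, mem_singleton, Fin.ext_iff, not_or] at hi
    exact hz i (by have := i.2; omega)

theorem coeff_prod_sum_of_natDegree_le {ι : Type*} (s : Finset ι) (f : ι → R[X]) (m : ι → ℕ)
    (h : ∀ i ∈ s, (f i).natDegree ≤ m i) :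
    (∏ i ∈ s, f i).coeff (∑ i ∈ s, m i) = ∏ i ∈ s, (f i).coeff (m i) := by
  classical
  induction s using Finset.induction_on with
  | empty => simp
  | insert a s ha ih =>
    rw [prod_insert ha, sum_insert ha, prod_insert ha, coeff_mul_add_eq_of_natDegree_le,
      ih fun i hi => h i (mem_insert_of_mem hi)]
    · exact h a (mem_insert_self _ _)
    · exact (natDegree_prod_le _ _).trans (sum_le_sum fun i hi => h i (mem_insert_of_mem hi))

/-- A Leibniz term without zero factors has degree at most `∑ d j - ∑ σ j = m`, whatever the
permutation, so the coefficient at `m` can be taken entrywise. `hzero` covers the entries where `d j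
- i` is truncated. -/
theorem natDegree_det_le_and_coeff (F : Matrix (Fin N) (Fin N) R[X]) (d : Fin N → ℕ) (m : ℕ)
    (hm : m + ∑ i : Fin N, (i : ℕ) = ∑ j, d j)
    (hdeg : ∀ i j, (F i j).natDegree ≤ d j - i) (hzero : ∀ (i j : Fin N), d j < (i : ℕ) → F i j = 0) :
    F.det.natDegree ≤ m ∧
      F.det.coeff m = (Matrix.of fun i j : Fin N => (F i j).coeff (d j - i)).det := by
  have key : ∀ σ : Equiv.Perm (Fin N), (∀ j, (σ j : ℕ) ≤ d j) → ∑ j, (d j - σ j) = m := by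
    intro σ hσ
    have h1 : ∑ j, (d j - σ j) + ∑ j, (σ j : ℕ) = ∑ j, d j := by
      rw [← sum_add_distrib]
      exact sum_congr rfl fun j _ => Nat.sub_add_cancel (hσ j)
    have h2 : ∑ j, (σ j : ℕ) = ∑ j : Fin N, (j : ℕ) := Equiv.sum_comp σ fun j => (j : ℕ)
    omega
  constructor
  · rw [Matrix.det_apply']
    refine natDegree_sum_le_of_forall_le _ _ fun σ _ => ?_
    by_cases hσ : ∀ j, (σ j : ℕ) ≤ d j
    · rw [← key σ hσ]
      refine (natDegree_mul_le).trans ?_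
      rw [natDegree_intCast, zero_add]
      exact (natDegree_prod_le _ _).trans (sum_le_sum fun j _ => hdeg _ _)
    · push Not at hσ
      obtain ⟨j, hj⟩ := hσ
      have hp : ∏ i, F (σ i) i = 0 := prod_eq_zero (mem_univ j) (hzero _ _ hj)
      rw [hp, mul_zero, natDegree_zero]
      exact Nat.zero_le _
  · rw [Matrix.det_apply', Matrix.det_apply', finsetSum_coeff]
    refine sum_congr rfl fun σ _ => ?_
    rw [← C_eq_intCast, coeff_C_mul]
    by_cases hσ : ∀ j, (σ j : ℕ) ≤ d j
    · conv_lhs => rw [← key σ hσ]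
      rw [coeff_prod_sum_of_natDegree_le _ _ _ fun j _ => hdeg _ _]
      simp
    · push Not at hσ
      obtain ⟨j, hj⟩ := hσ
      have hp : ∏ i, F (σ i) i = 0 := prod_eq_zero (mem_univ j) (hzero _ _ hj)
      rw [hp]
      have hp' : ∏ k, (Matrix.of fun i j : Fin N => (F i j).coeff (d j - i)) (σ k) k = 0 :=
        prod_eq_zero (mem_univ j) (by simp [hzero _ _ hj])
      rw [hp']
      simp

/-- `1 / (d - i)!` is the falling factorial of `d` of length `i`, divided by `d!`. Falling
factorials are monic polynomials of degree `i` in `d`, so a Vandermonde determinant in the distinct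
`d j` remains. -/
theorem det_inv_factorial_ne_zero (d : Fin N → ℕ) (hd : Function.Injective d) :
    (Matrix.of fun i j : Fin N =>
      if (i : ℕ) ≤ d j then (((d j - i).factorial : ℂ))⁻¹ else 0).det ≠ 0 := by
  have h1 : (Matrix.of fun i j : Fin N =>
      if (i : ℕ) ≤ d j then (((d j - i).factorial : ℂ))⁻¹ else 0).det =
      (∏ j, ((d j).factorial : ℂ)⁻¹) *
        (Matrix.of fun i j : Fin N => ((descPochhammer ℂ i).eval (d j : ℂ))).det := by
    rw [← Matrix.det_mul_row]
    congr 1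
    ext i j
    simp only [Matrix.of_apply]
    rw [descPochhammer_eval_eq_descFactorial]
    have hf : ((d j).factorial : ℂ) ≠ 0 := by exact_mod_cast Nat.factorial_ne_zero _
    split_ifs with h
    · have hf' : ((d j - i).factorial : ℂ) ≠ 0 := by exact_mod_cast Nat.factorial_ne_zero _
      have : ((d j - i).factorial : ℂ) * ((d j).descFactorial i : ℂ) = ((d j).factorial : ℂ) := by
        exact_mod_cast Nat.factorial_mul_descFactorial h
      field_simp
      rw [← this]
    · rw [Nat.descFactorial_eq_zero_iff_lt.2 (by omega)]; simp
  have h2 := Matrix.det_eval_matrixOfPolynomials_eq_det_vandermonde (fun j => (d j : ℂ))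
    (fun i : Fin N => descPochhammer ℂ i) (fun i => descPochhammer_natDegree ℂ i)
    (fun i => monic_descPochhammer ℂ i)
  rw [h1]
  refine mul_ne_zero (prod_ne_zero_iff.2 fun j _ => inv_ne_zero ?_) ?_
  · exact_mod_cast Nat.factorial_ne_zero _
  · rw [← Matrix.det_transpose]
    have h3 : (Matrix.of fun i j : Fin N => ((descPochhammer ℂ i).eval (d j : ℂ))).transpose =
        Matrix.of fun i j : Fin N => ((descPochhammer ℂ j).eval (d i : ℂ)) := rfl
    rw [h3, ← h2, Matrix.det_vandermonde_ne_zero_iff]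
    exact fun i j hij => hd (Nat.cast_injective (R := ℂ) hij)

end Det

end RogueWave

end

/-! ### Degree and roots of the Wronskian. -/

noncomputable section

namespace RogueWave

open Finset Polynomial

/-- Sorted distinct naturals dominate `0, 1, 2, …` termwise. It makes the truncated subtraction in
`wronskianDegree` exact. -/
theorem sum_val_le_sum_of_injective {N : ℕ} (d : Fin N → ℕ) (hd : Function.Injective d) :
    ∑ i : Fin N, (i : ℕ) ≤ ∑ i, d i := by
  have hlt : ∀ i, d i < ∑ i, d i + 1 := fun i =>
    Nat.lt_succ_of_le (single_le_sum (f := d) (fun _ _ => Nat.zero_le _) (mem_univ i))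
  let g : Fin N ↪o Fin (∑ i, d i + 1) := OrderEmbedding.ofStrictMono
    (fun i => ⟨d (Tuple.sort d i), hlt _⟩) (fun i j hij =>
      (Tuple.monotone_sort d).strictMono_of_injective (hd.comp (Tuple.sort d).injective) hij)
  have h1 : ∑ i, (g i : ℕ) = ∑ i, d i := Equiv.sum_comp (Tuple.sort d) d
  rw [← h1]
  exact sum_le_sum fun i _ => le_orderEmb g i

section Gmam

variable {n : ℕ} (N : Fin n → ℕ) (kap : Fin n → ℕ → ℂ)

/-- The block is recovered as the nonzero residue modulo `n + 1`, the place as the quotient. -/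
theorem deg_injective {N : Fin n → ℕ} :
    Function.Injective (deg : ((l : Fin n) × Fin (N l)) → ℕ) := by
  rintro ⟨l, p⟩ ⟨l', p'⟩ h
  have h : (n + 1) * (p : ℕ) + ((l : ℕ) + 1) = (n + 1) * (p' : ℕ) + ((l' : ℕ) + 1) := h
  have hl := l.2
  have hl' := l'.2
  have h1 := congrArg (· % (n + 1)) h
  simp only [Nat.mul_add_mod, Nat.mod_eq_of_lt (show (l : ℕ) + 1 < n + 1 by omega),
    Nat.mod_eq_of_lt (show (l' : ℕ) + 1 < n + 1 by omega)] at h1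
  have h2 : l = l' := Fin.ext (by omega)
  subst h2
  have h3 : (n + 1) * (p : ℕ) = (n + 1) * (p' : ℕ) := by omega
  have h4 : p = p' := Fin.ext (Nat.eq_of_mul_eq_mul_left (Nat.succ_pos n) h3)
  rw [h4]

/-- The number `(n+1) p_j + l_j` that belongs to column `j`. -/
def colDeg (j : Fin (∑ l, N l)) : ℕ := deg (col N j)

theorem colDeg_injective : Function.Injective (colDeg N) :=
  deg_injective.comp (Equiv.injective _)

/-- The `i`-th derivatives of the polynomials `φ_{l_j, (n+1) p_j + l_j}`. -/
def phiRow (i : ℕ) (j : Fin (∑ l, N l)) : ℂ[X] :=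
  if i ≤ colDeg N j then phi n kap (col N j).1 (colDeg N j - i) else 0

theorem derivative_phiRow (i : ℕ) (j : Fin (∑ l, N l)) :
    derivative (phiRow N kap i j) = phiRow N kap (i + 1) j := by
  have h := iterate_derivative_phi n kap (col N j).1 (i + 1) (colDeg N j)
  rw [Function.iterate_succ_apply', iterate_derivative_phi] at h
  exact h

theorem gmamWronskian_eq :
    gmamWronskian n N kap = (rowMatrix (phiRow N kap) fun i => i).det := by
  rw [gmamWronskian]
  congr 1
  ext1 i j
  exact iterate_derivative_phi n kap _ _ _

theorem shiftedDet_eq (p : Fin (∑ l, N l) → ℕ) :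
    shiftedDet n N kap p = (rowMatrix (phiRow N kap) p).det := by
  rw [shiftedDet]
  congr 1
  ext1 i j
  show phiZ _ _ _ _ = phiRow _ _ _ _
  rw [phiZ, phiRow, colDeg]
  by_cases h : p i ≤ deg (col N j)
  · rw [if_pos (by omega), if_pos h]
    congr 1
    omega
  · rw [if_neg (by omega), if_neg h]

theorem derivative_gmamWronskian :
    derivative (gmamWronskian n N kap) = ∑ i : Fin (∑ l, N l),
      ((rowMatrix (phiRow N kap) fun i => i).updateRow i (phiRow N kap (i + 1))).det := by
  rw [gmamWronskian_eq, derivative_det]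
  refine sum_congr rfl fun i _ => ?_
  congr 2
  funext j
  exact derivative_phiRow N kap i j

/-- The degree of the Wronskian. -/
def wronskianDegree : ℕ := ∑ j, colDeg N j - ∑ i : Fin (∑ l, N l), (i : ℕ)

theorem wronskianDegree_add :
    wronskianDegree N + ∑ i : Fin (∑ l, N l), (i : ℕ) = ∑ j, colDeg N j :=
  Nat.sub_add_cancel (sum_val_le_sum_of_injective _ (colDeg_injective N))

theorem natDegree_gmamWronskian_le_and_coeff :
    (gmamWronskian n N kap).natDegree ≤ wronskianDegree N ∧
      (gmamWronskian n N kap).coeff (wronskianDegree N) ≠ 0 := by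
  rw [gmamWronskian_eq]
  have h := natDegree_det_le_and_coeff (rowMatrix (phiRow N kap) fun i => i) (colDeg N)
    (wronskianDegree N) (wronskianDegree_add N) ?_ ?_
  · refine ⟨h.1, ?_⟩
    rw [h.2]
    convert det_inv_factorial_ne_zero (colDeg N) (colDeg_injective N) using 5 with i j
    show (phiRow N kap i j).coeff _ = _
    rw [phiRow]
    split_ifs
    · exact coeff_phi_self _ _ _ _
    · exact coeff_zero _
  · intro i j
    show (phiRow N kap i j).natDegree ≤ _
    rw [phiRow]
    split_ifs
    · exact natDegree_phi_le _ _ _ _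
    · simp
  · intro i j hij
    exact if_neg (show ¬ (i : ℕ) ≤ colDeg N j by omega)

theorem gmamWronskian_ne_zero : gmamWronskian n N kap ≠ 0 := by
  intro h
  have := (natDegree_gmamWronskian_le_and_coeff N kap).2
  rw [h] at this
  simp at this

theorem natDegree_gmamWronskian : (gmamWronskian n N kap).natDegree = wronskianDegree N :=
  le_antisymm (natDegree_gmamWronskian_le_and_coeff N kap).1
    (le_natDegree_of_ne_zero (natDegree_gmamWronskian_le_and_coeff N kap).2)

theorem gmamConst_ne_zero : gmamConst n N kap ≠ 0 :=
  inv_ne_zero (leadingCoeff_ne_zero.2 (gmamWronskian_ne_zero N kap))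

theorem natDegree_gmam : (gmam n N kap).natDegree = wronskianDegree N := by
  rw [gmam, natDegree_C_mul (gmamConst_ne_zero N kap), natDegree_gmamWronskian]

theorem gmam_ne_zero : gmam n N kap ≠ 0 :=
  mul_ne_zero (C_ne_zero.2 (gmamConst_ne_zero N kap)) (gmamWronskian_ne_zero N kap)

theorem sum_fin_val (m : ℕ) : ∑ i : Fin m, ((i : ℕ) : ℚ) = m * (m - 1) / 2 := by
  induction m with
  | zero => simp
  | succ m ih =>
    rw [Fin.sum_univ_castSucc]
    simp only [Fin.val_castSucc, Fin.val_last, ih]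
    push_cast
    ring

theorem sum_sq_eq (a : Fin n → ℚ) : (∑ l, a l) ^ 2 =
    ∑ l, a l ^ 2 + 2 * ∑ l : Fin n, ∑ k ∈ univ.filter (fun k => l < k), a l * a k := by
  have h1 : ∀ l, ∑ k, a l * a k = ∑ k ∈ univ.filter (fun k => l < k), a l * a k +
      (a l ^ 2 + ∑ k ∈ univ.filter (fun k => k < l), a l * a k) := by
    intro l
    rw [← sum_filter_add_sum_filter_not univ (fun k => l < k)]
    congr 1
    have : univ.filter (fun k => ¬ l < k) = insert l (univ.filter (fun k => k < l)) := by
      ext k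
      simp only [mem_filter, mem_univ, true_and, mem_insert, not_lt]
      exact le_iff_eq_or_lt
    rw [this, sum_insert (by simp), pow_two]
  have h2 : ∑ l, ∑ k ∈ univ.filter (fun k => k < l), a l * a k =
      ∑ l : Fin n, ∑ k ∈ univ.filter (fun k => l < k), a l * a k := by
    simp only [sum_filter]
    rw [sum_comm]
    refine sum_congr rfl fun l _ => sum_congr rfl fun k _ => ?_
    rw [mul_comm]
  rw [pow_two, sum_mul_sum, sum_congr rfl fun l _ => h1 l, sum_add_distrib, sum_add_distrib, h2]
  ring

/-- The column degrees are summed block by block. The subtracted `N (N - 1) / 2` contains `(∑ N_l)²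
/ 2`, whose mixed products form the double sum in `Gam`. -/
theorem wronskianDegree_eq_Gam : (wronskianDegree N : ℚ) = Gam n N := by
  have h1 : ((∑ j, colDeg N j : ℕ) : ℚ) =
      ∑ l : Fin n, ((n + 1) * ((N l : ℚ) * (N l - 1) / 2) + N l * ((l : ℕ) + 1)) := by
    have : ∑ j, colDeg N j = ∑ c : (l : Fin n) × Fin (N l), deg c :=
      Equiv.sum_comp finSigmaFinEquiv.symm deg
    rw [this, Fintype.sum_sigma]
    push_cast
    refine sum_congr rfl fun l _ => ?_
    simp only [deg]
    push_cast
    rw [sum_add_distrib, ← mul_sum, sum_fin_val]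
    simp
    ring
  have h2 : ((∑ i : Fin (∑ l, N l), (i : ℕ) : ℕ) : ℚ) =
      (∑ l, (N l : ℚ)) * ((∑ l, (N l : ℚ)) - 1) / 2 := by
    push_cast
    rw [sum_fin_val]
    push_cast
    rfl
  have h3 := congrArg (Nat.cast : ℕ → ℚ) (wronskianDegree_add N)
  rw [Nat.cast_add, h1, h2] at h3
  have h4 := sum_sq_eq (fun l => (N l : ℚ))
  have h5 : ∑ l : Fin n, ((n + 1) * ((N l : ℚ) * (N l - 1) / 2) + N l * ((l : ℕ) + 1)) =
      ∑ l : Fin n, (N l : ℚ) / 2 * (n * ((N l : ℚ) - 1) + 2 * ((l : ℕ) + 1 : ℚ)) +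
        (∑ l, (N l : ℚ) ^ 2 - ∑ l, (N l : ℚ)) / 2 := by
    rw [← sum_sub_distrib, sum_div, ← sum_add_distrib]
    refine sum_congr rfl fun l _ => ?_
    ring
  rw [Gam]
  rw [h5] at h3
  linear_combination h3 - h4 / 2

theorem eval_gmamWronskian (z : ℂ) : (gmamWronskian n N kap).eval z =
    (gmamWronskian n N kap).leadingCoeff *
      ((gmam n N kap).roots.map fun w => z - w).prod := by
  rw [gmam, roots_C_mul _ (gmamConst_ne_zero N kap)]
  exact (IsAlgClosed.splits (gmamWronskian n N kap)).eval_eq_prod_roots z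

theorem nodup_roots_gmam (hsimple : ∀ z : ℂ, (gmam n N kap).IsRoot z →
      (gmam n N kap).rootMultiplicity z = 1) : (gmam n N kap).roots.Nodup := by
  rw [Multiset.nodup_iff_count_le_one]
  intro z
  rw [count_roots]
  by_cases h : (gmam n N kap).IsRoot z
  · exact (hsimple z h).le
  · rw [rootMultiplicity_eq_zero h]; exact Nat.zero_le _

theorem card_roots_gmam : Multiset.card (gmam n N kap).roots = wronskianDegree N := by
  rw [← natDegree_gmam N kap]
  exact (splits_iff_card_roots.1 (IsAlgClosed.splits _))

theorem isRoot_gmam_iff {z : ℂ} :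
    (gmam n N kap).IsRoot z ↔ (gmamWronskian n N kap).eval z = 0 := by
  rw [gmam, IsRoot.def, eval_mul, eval_C, mul_eq_zero, or_iff_right (gmamConst_ne_zero N kap)]

theorem eval_derivative_gmamWronskian_ne_zero {z : ℂ} (hz : (gmam n N kap).IsRoot z)
    (h : (gmam n N kap).rootMultiplicity z = 1) :
    (derivative (gmamWronskian n N kap)).eval z ≠ 0 := by
  intro h0
  have h1 : (derivative (gmam n N kap)).IsRoot z := by
    rw [gmam, derivative_C_mul, IsRoot.def, eval_mul, h0, mul_zero]
  have := (one_lt_rootMultiplicity_iff_isRoot (gmam_ne_zero N kap)).2 ⟨hz, h1⟩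
  omega

end Gmam

end RogueWave

end

/-! ### Factorization of `M^{[s]}` and its expansion in scaled minors. -/

noncomputable section

namespace RogueWave

open Finset Matrix

section Gram

variable (n : ℕ) (lam0 lam1 : ℂ) (chi : PowerSeries ℂ) (N : Fin n → ℕ) (d : Fin n → ℕ → ℂ)

/-- The arguments `x^{[l,+]} + v h₁ + σ h₂^{[s]}` of the Schur polynomials. -/
def uSeq (x t : ℝ) (s : Option (Fin n)) (σ : ℂ) (l : Fin n) (v m : ℕ) : ℂ :=
  xPlus n lam0 lam1 chi d l x t m + v * h1 n lam0 chi m + σ * shift2 n lam0 chi s m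

/-- The number of rows of the factors of `M^{[s]}`. -/
def rowBound {n : ℕ} (N : Fin n → ℕ) : ℕ := ∑ j, colDeg N j + ∑ l, N l + 1

/-- The factors of `M^{[s]}`. -/
def gramFactor (x t : ℝ) (s : Option (Fin n)) (σ : ℂ) :
    Matrix (Fin (rowBound N)) (Fin (∑ l, N l)) ℂ :=
  Matrix.of fun v c => schurSub (uSeq n lam0 lam1 chi d x t s σ (col N c).1 v) (colDeg N c) v

variable {n lam0 lam1 chi N d}

theorem colDeg_lt_rowBound (c : Fin (∑ l, N l)) : colDeg N c < rowBound N := by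
  have := single_le_sum (f := colDeg N) (fun _ _ => Nat.zero_le _) (mem_univ c)
  unfold rowBound
  omega

theorem lt_rowBound : ∑ l, N l < rowBound N := by
  unfold rowBound; omega

/-- With the convention of `schurSub` the upper limit `min i j` can be replaced by a common bound
`D`; the entry is then one of a product of three matrices. -/
theorem tau_eq_sum (x t : ℝ) (s : Option (Fin n)) (l₁ l₂ : Fin n) (i j D : ℕ) (hi : i < D) :
    tau n lam0 lam1 chi d x t s l₁ l₂ i j = ∑ v : Fin D, (C1 n lam0 chi : ℂ) ^ (v : ℕ) *
      star (schurSub (uSeq n lam0 lam1 chi d x t s 1 l₁ v) i v) *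
      schurSub (uSeq n lam0 lam1 chi d x t s (-1) l₂ v) j v := by
  rw [tau, Fin.sum_univ_eq_sum_range (fun v => (C1 n lam0 chi : ℂ) ^ v *
      star (schurSub (uSeq n lam0 lam1 chi d x t s 1 l₁ v) i v) *
      schurSub (uSeq n lam0 lam1 chi d x t s (-1) l₂ v) j v) D]
  have hsub : range (min i j + 1) ⊆ range D := by
    intro v; simp only [mem_range]; omega
  rw [← sum_subset hsub]
  · refine sum_congr rfl fun v hv => ?_
    have hv' := mem_range.1 hv
    rw [schurSub, if_pos (by omega), schurSub, if_pos (by omega), star_schur]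
    congr 2
    · congr 1
      funext m
      simp [uSeq]
    · funext m
      simp [uSeq, sub_eq_add_neg]
  · intro v _ hv
    rw [mem_range] at hv
    by_cases h : v ≤ i
    · rw [schurSub_of_lt _ (show j < v by omega), mul_zero]
    · rw [schurSub_of_lt _ (show i < v by omega), star_zero, mul_zero, zero_mul]

theorem Mmat_det_eq (x t : ℝ) (s : Option (Fin n)) :
    (Mmat n lam0 lam1 chi N d x t s).det =
      ((gramFactor n lam0 lam1 chi N d x t s 1)ᴴ *
        Matrix.diagonal (fun v : Fin (rowBound N) => ((C1 n lam0 chi ^ (v : ℕ) : ℝ) : ℂ)) *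
        gramFactor n lam0 lam1 chi N d x t s (-1)).det := by
  rw [← det_submatrix_equiv_self finSigmaFinEquiv.symm]
  congr 1
  ext1 r c
  rw [mul_apply]
  simp only [mul_diagonal]
  refine (tau_eq_sum x t s _ _ _ _ (rowBound N) (colDeg_lt_rowBound r)).trans ?_
  refine sum_congr rfl fun v _ => ?_
  simp only [conjTranspose_apply, gramFactor, of_apply, Complex.ofReal_pow]
  rw [mul_comm ((C1 n lam0 chi : ℂ) ^ (v : ℕ))]
  rfl

theorem gramFactor_injective (x t : ℝ) (s : Option (Fin n)) (σ : ℂ) :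
    Function.Injective (gramFactor n lam0 lam1 chi N d x t s σ).mulVec := by
  refine mulVec_injective_of_unitriangular _ (fun c => ⟨colDeg N c, colDeg_lt_rowBound c⟩) ?_ ?_ ?_
  · intro c c' h
    exact colDeg_injective N (congrArg Fin.val h)
  · intro c
    exact schurSub_self _ _
  · intro v c h
    exact schurSub_of_lt _ h

theorem C1_pos (hlam0 : lam0.im ≠ 0) (h1 : chi1 chi ≠ 0) : 0 < C1 n lam0 chi := by
  have := chi0_sub_star_ne_zero (n := n) hlam0
  unfold C1
  positivity

theorem gramFactor_none (x t : ℝ) (σ σ' : ℂ) :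
    gramFactor n lam0 lam1 chi N d x t none σ = gramFactor n lam0 lam1 chi N d x t none σ' := by
  have : ∀ σ l v, uSeq n lam0 lam1 chi d x t none σ l v =
      fun m => xPlus n lam0 lam1 chi d l x t m + v * h1 n lam0 chi m := fun σ l v => by
    funext m
    simp [uSeq, shift2]
  unfold gramFactor
  simp only [this]

/-- Without the shift by `h₂` the left and right factors agree, so the matrix is a Gram matrix with
positive weights `C₁^v`. -/
theorem Mmat_none_det_ne_zero (hlam0 : lam0.im ≠ 0) (h1 : chi1 chi ≠ 0) (x t : ℝ) :
    (Mmat n lam0 lam1 chi N d x t none).det ≠ 0 := by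
  rw [Mmat_det_eq, gramFactor_none x t (-1) 1]
  exact det_gram_ne_zero _ (gramFactor_injective x t none 1) _
    fun v => pow_pos (C1_pos hlam0 h1) _

end Gram

section Minors

/-- The `g`-minor of the matrix with the entries `f v c`, scaled by `B^(v - e_c)`. -/
def scaledMinor {N D : ℕ} (Φ : Matrix (Fin D) (Fin N) ℂ) (e : Fin N → ℕ) (B : ℝ)
    (g : Fin N ↪o Fin D) : ℂ :=
  (Matrix.of fun i c : Fin N => Φ (g i) c * (B : ℂ) ^ (g i : ℕ) / (B : ℂ) ^ e c).det

/-- The expansion of a weighted Gram determinant by scaled minors, up to a common factor. -/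
def minorSum {N D : ℕ} (Φ Ψ : Matrix (Fin D) (Fin N) ℂ) (e : Fin N → ℕ) (C B : ℝ) : ℂ :=
  ∑ g : Fin N ↪o Fin D, ((C / B ^ 2 : ℝ) : ℂ) ^ (∑ i, (g i : ℕ) - ∑ i : Fin N, (i : ℕ)) *
    (star (scaledMinor Φ e B g) * scaledMinor Ψ e B g)

theorem det_submatrix_eq_scaledMinor {N D : ℕ} (Φ : Matrix (Fin D) (Fin N) ℂ) (e : Fin N → ℕ)
    {B : ℝ} (hB : B ≠ 0) (g : Fin N ↪o Fin D) :
    (Φ.submatrix g id).det * (B : ℂ) ^ (∑ i, (g i : ℕ)) =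
      (B : ℂ) ^ (∑ c, e c) * scaledMinor Φ e B g := by
  have hB' : (B : ℂ) ≠ 0 := by exact_mod_cast hB
  have h : Matrix.of (fun i c : Fin N => (B : ℂ) ^ e c *
      (Φ (g i) c * (B : ℂ) ^ (g i : ℕ) / (B : ℂ) ^ e c)) =
      Matrix.of (fun i c : Fin N => (B : ℂ) ^ (g i : ℕ) * (Φ.submatrix g id) i c) := by
    ext i c
    simp only [of_apply, submatrix_apply, id_eq]
    field_simp
  have h1 := det_mul_row (fun c => (B : ℂ) ^ e c)
    (Matrix.of fun i c : Fin N => Φ (g i) c * (B : ℂ) ^ (g i : ℕ) / (B : ℂ) ^ e c)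
  have h2 := det_mul_column (fun i => (B : ℂ) ^ (g i : ℕ)) (Φ.submatrix g id)
  simp only [prod_pow_eq_pow_sum] at h1 h2
  rw [mul_comm, ← h2, ← h]
  exact h1

/-- Scaling row `v` by `B^v` and column `c` by `B^(-e c)` only costs prefactors independent of `Φ`
and `Ψ`. They cancel in the quotients that define `q_k`. -/
theorem det_weighted_gram {N D : ℕ} (Φ Ψ : Matrix (Fin D) (Fin N) ℂ) (e : Fin N → ℕ) (C : ℝ)
    {B : ℝ} (hB : B ≠ 0) :
    (Φᴴ * Matrix.diagonal (fun v : Fin D => ((C ^ (v : ℕ) : ℝ) : ℂ)) * Ψ).det *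
      (B : ℂ) ^ (2 * ∑ i : Fin N, (i : ℕ)) =
      (C : ℂ) ^ (∑ i : Fin N, (i : ℕ)) * (B : ℂ) ^ (2 * ∑ c, e c) * minorSum Φ Ψ e C B := by
  have hB' : (B : ℂ) ≠ 0 := by exact_mod_cast hB
  rw [det_mul_eq_sum_orderEmb, minorSum]
  generalize hE : ∑ i : Fin N, (i : ℕ) = E
  generalize hS : ∑ c, e c = S
  rw [sum_mul, mul_sum]
  refine sum_congr rfl fun g _ => ?_
  have h1 : ((Φᴴ * Matrix.diagonal (fun v : Fin D => ((C ^ (v : ℕ) : ℝ) : ℂ))).submatrix id g).det =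
      (C : ℂ) ^ (∑ i, (g i : ℕ)) * star (Φ.submatrix g id).det := by
    have : (Φᴴ * Matrix.diagonal (fun v : Fin D => ((C ^ (v : ℕ) : ℝ) : ℂ))).submatrix id g =
        Matrix.of fun i j => (C : ℂ) ^ (g j : ℕ) * ((Φ.submatrix g id)ᴴ) i j := by
      ext i j
      simp [mul_diagonal, mul_comm]
    rw [this, det_mul_row, prod_pow_eq_pow_sum, det_conjTranspose]
  have hle : E ≤ ∑ i, (g i : ℕ) := hE ▸ sum_le_sum fun i _ => le_orderEmb g i
  obtain ⟨r, hr⟩ := Nat.exists_eq_add_of_le hle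
  have h2 := det_submatrix_eq_scaledMinor Φ e hB g
  have h3 := det_submatrix_eq_scaledMinor Ψ e hB g
  rw [hS] at h2 h3
  have h2' := congrArg (starRingEnd ℂ) h2
  rw [map_mul, map_mul, map_pow, map_pow, Complex.conj_ofReal] at h2'
  rw [h1]
  simp only [Complex.star_def]
  rw [hr] at h2' h3 ⊢
  rw [Nat.add_sub_cancel_left]
  -- The factor `B^(2(E + r))` supplies one power `B^(∑ g)` to each of the two minors, as
  -- `det_submatrix_eq_scaledMinor` requires; it avoids negative exponents.
  have hp : ((B : ℂ) ^ (E + r) * (B : ℂ) ^ (E + r)) ≠ 0 :=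
    mul_ne_zero (pow_ne_zero _ hB') (pow_ne_zero _ hB')
  refine mul_right_cancel₀ hp ?_
  have h4 : (((C / B ^ 2 : ℝ) : ℂ)) ^ r * ((B : ℂ) ^ r * (B : ℂ) ^ r) = (C : ℂ) ^ r := by
    rw [← mul_pow, ← mul_pow]
    congr 1
    push_cast
    field_simp
  set a := (starRingEnd ℂ) (Φ.submatrix g id).det
  set b := (Ψ.submatrix g id).det
  set a' := (starRingEnd ℂ) (scaledMinor Φ e B g)
  set b' := scaledMinor Ψ e B g
  calc (C : ℂ) ^ (E + r) * a * b * (B : ℂ) ^ (2 * E) * ((B : ℂ) ^ (E + r) * (B : ℂ) ^ (E + r))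
      = (C : ℂ) ^ (E + r) * (a * (B : ℂ) ^ (E + r)) * (b * (B : ℂ) ^ (E + r)) *
        (B : ℂ) ^ (2 * E) := by ring
    _ = (C : ℂ) ^ E * (B : ℂ) ^ (2 * S) * (B : ℂ) ^ (2 * E) * (C : ℂ) ^ r * (a' * b') := by
        rw [h2', h3]; ring
    _ = _ := by rw [← h4]; ring

end Minors

section Ratio

variable {n : ℕ} {lam0 lam1 : ℂ} {chi : PowerSeries ℂ} {N : Fin n → ℕ} {d : Fin n → ℕ → ℂ}

/-- `det M^{[s]}` up to a factor that does not depend on `s`. -/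
def detSum (n : ℕ) (lam0 lam1 : ℂ) (chi : PowerSeries ℂ) (N : Fin n → ℕ) (d : Fin n → ℕ → ℂ)
    (x t : ℝ) (s : Option (Fin n)) (B : ℝ) : ℂ :=
  minorSum (gramFactor n lam0 lam1 chi N d x t s 1) (gramFactor n lam0 lam1 chi N d x t s (-1))
    (colDeg N) (C1 n lam0 chi) B

theorem Mmat_det_eq_detSum (x t : ℝ) (s : Option (Fin n)) {B : ℝ} (hB : B ≠ 0) :
    (Mmat n lam0 lam1 chi N d x t s).det * (B : ℂ) ^ (2 * ∑ i : Fin (∑ l, N l), (i : ℕ)) =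
      (C1 n lam0 chi : ℂ) ^ (∑ i : Fin (∑ l, N l), (i : ℕ)) * (B : ℂ) ^ (2 * ∑ c, colDeg N c) *
        detSum n lam0 lam1 chi N d x t s B := by
  rw [Mmat_det_eq, det_weighted_gram _ _ (colDeg N) _ hB, detSum]

theorem detSum_none_ne_zero (hlam0 : lam0.im ≠ 0) (h1 : chi1 chi ≠ 0) (x t : ℝ) {B : ℝ}
    (hB : B ≠ 0) : detSum n lam0 lam1 chi N d x t none B ≠ 0 := by
  intro h
  have h2 := Mmat_det_eq_detSum (lam0 := lam0) (lam1 := lam1) (chi := chi) (N := N) (d := d)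
    x t none hB
  have hB' : (B : ℂ) ≠ 0 := by exact_mod_cast hB
  rw [h, mul_zero] at h2
  exact mul_ne_zero (Mmat_none_det_ne_zero hlam0 h1 x t) (pow_ne_zero _ hB') h2

theorem div_eq_div_of_mul_eq {a b x y p r : ℂ} (hp : p ≠ 0) (hb : b ≠ 0) (hy : y ≠ 0)
    (ha : a * p = r * x) (hb' : b * p = r * y) : a / b = x / y := by
  rw [div_eq_div_iff hb hy]
  refine mul_right_cancel₀ hp ?_
  linear_combination y * ha - x * hb'

/-- Any nonzero `B` is admissible, so the scale may be adapted to `A` and to the point `(x, t)`. -/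
theorem qRW_eq (hlam0 : lam0.im ≠ 0) (h1 : chi1 chi ≠ 0) (k : Fin n) (x t : ℝ) {B : ℝ}
    (hB : B ≠ 0) : qRW n lam0 lam1 chi N d k x t = planeWave n lam0 k x t *
      (detSum n lam0 lam1 chi N d x t (some k) B / detSum n lam0 lam1 chi N d x t none B) := by
  have hB' : (B : ℂ) ≠ 0 := by exact_mod_cast hB
  rw [qRW]
  congr 1
  exact div_eq_div_of_mul_eq (pow_ne_zero _ hB') (Mmat_none_det_ne_zero hlam0 h1 x t)
    (detSum_none_ne_zero hlam0 h1 x t hB) (Mmat_det_eq_detSum x t (some k) hB)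
    (Mmat_det_eq_detSum x t none hB)

end Ratio

end RogueWave

end

/-! ### Rescaling by a large length and asymptotics of the scaled minors. -/

noncomputable section

namespace RogueWave

open Finset Asymptotics Filter

section Sequences

variable {n : ℕ} {lam0 lam1 : ℂ} {chi : PowerSeries ℂ} {kap : Fin n → ℕ → ℂ}

/-- The complex coordinate `i χ^{[1]} (x + χ₀ t)` of the `(x,t)`-plane. -/
def waveCoord (n : ℕ) (lam0 : ℂ) (chi : PowerSeries ℂ) (x t : ℝ) : ℂ :=
  Complex.I * chi1 chi * ((x : ℂ) + chi0 n lam0 * t)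

/-- The part of `x^{[l,+]} + v h₁ + σ h₂^{[s]}` that is small for large parameters, relative to
the base point `ζ`. -/
def wSeq (n : ℕ) (lam0 lam1 : ℂ) (chi : PowerSeries ℂ) (x t : ℝ) (ζ : ℂ) (s : Option (Fin n))
    (σ : ℂ) (v m : ℕ) : ℂ :=
  (if m = 1 then waveCoord n lam0 chi x t - ζ
    else alpha n lam0 lam1 chi m * x + beta n lam0 lam1 chi m * Complex.I * t) +
    v * h1 n lam0 chi m + σ * shift2 n lam0 chi s m

theorem uSeq_largeParam (hn : 1 ≤ n) (hchi : IsCharBranch n lam0 lam1 chi) (A x t : ℝ) (ζ : ℂ)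
    (s : Option (Fin n)) (σ : ℂ) (l : Fin n) (v m : ℕ) :
    uSeq n lam0 lam1 chi (largeParam n kap A) x t s σ l v m =
      baseSeq n kap l A ζ m + wSeq n lam0 lam1 chi x t ζ s σ v m := by
  rw [uSeq, xPlus, baseSeq, wSeq, largeParam]
  by_cases hm : m = 1
  · subst hm
    rw [alpha_one hn, beta_one hn hchi, if_pos rfl, if_pos rfl, waveCoord]
    ring
  · rw [if_neg hm, if_neg hm]
    ring

theorem schurSub_congr {z w : ℕ → ℂ} (h : ∀ i, z i = w i) (j v : ℕ) :
    schurSub z j v = schurSub w j v := by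
  rw [funext h]

theorem schurSub_baseSeq_scale (l : Fin n) (A : ℝ) (ζ : ℂ) {B : ℝ} (hB : B ≠ 0) (d v : ℕ) :
    schurSub (baseSeq n kap l A ζ) d v * (B : ℂ) ^ v =
      (B : ℂ) ^ d * schurSub (baseSeq n kap l (A / B) (ζ / B)) d v := by
  have hB' : (B : ℂ) ≠ 0 := by exact_mod_cast hB
  rw [schurSub, schurSub]
  split_ifs with h
  · have := schur_baseSeq_scale n kap l (B : ℂ) (A / B) (ζ / B) (d - v)
    rw [mul_div_cancel₀ _ hB', mul_div_cancel₀ _ hB'] at this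
    rw [this]
    obtain ⟨r, rfl⟩ := Nat.exists_eq_add_of_le h
    rw [Nat.add_sub_cancel_left, pow_add]
    ring
  · simp

/-- The scaled Schur polynomials at the base point. -/
def baseRow (n : ℕ) (kap : Fin n → ℕ → ℂ) (N : Fin n → ℕ) (a z : ℂ) (v : ℕ)
    (c : Fin (∑ l, N l)) : ℂ :=
  schurSub (baseSeq n kap (col N c).1 a z) (colDeg N c) v

/-- The addition theorem separates the large arguments from the remaining ones, and homogeneity
normalizes the large part. Row `v` becomes base row `v` plus small multiples of the base rows `v +
i`, that is, of derivatives. -/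
theorem gramFactor_scaled (hn : 1 ≤ n) (hchi : IsCharBranch n lam0 lam1 chi) (N : Fin n → ℕ)
    (A x t : ℝ) (ζ : ℂ) (s : Option (Fin n)) (σ : ℂ) {B : ℝ} (hB : B ≠ 0)
    (v : Fin (rowBound N)) (c : Fin (∑ l, N l)) :
    gramFactor n lam0 lam1 chi N (largeParam n kap A) x t s σ v c * (B : ℂ) ^ (v : ℕ) /
      (B : ℂ) ^ colDeg N c =
    ∑ i ∈ range (rowBound N + 3), schur (wSeq n lam0 lam1 chi x t ζ s σ v) i / (B : ℂ) ^ i *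
      baseRow n kap N (A / B) (ζ / B) (v + i) c := by
  have hB' : (B : ℂ) ≠ 0 := by exact_mod_cast hB
  have h1 : gramFactor n lam0 lam1 chi N (largeParam n kap A) x t s σ v c =
      schurSub (fun m => baseSeq n kap (col N c).1 A ζ m + wSeq n lam0 lam1 chi x t ζ s σ v m)
        (colDeg N c) v :=
    schurSub_congr (fun m => uSeq_largeParam hn hchi A x t ζ s σ _ _ m) _ _
  -- The extra `3` leaves room to split off the terms `i = 0, 1, 2` later.
  rw [h1, schurSub_add _ _ _ _ (rowBound N + 3) (by have := colDeg_lt_rowBound c; omega),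
    sum_mul, sum_div]
  refine sum_congr rfl fun i _ => ?_
  have h2 := schurSub_baseSeq_scale (kap := kap) (col N c).1 A ζ hB (colDeg N c) (v + i)
  rw [baseRow, div_mul_eq_mul_div, div_eq_div_iff (pow_ne_zero _ hB') (pow_ne_zero _ hB')]
  rw [pow_add] at h2
  linear_combination schur (wSeq n lam0 lam1 chi x t ζ s σ v) i * h2

end Sequences

section Asymptotics

variable {Ω : Type*} {l : Filter Ω}

/-- Induction along the recursion `schur_succ`; `hg` says that the bounds `g` are compatible with
it. -/
theorem isBigO_schur {u : Ω → ℕ → ℂ} {b g : ℕ → Ω → ℝ} (h0 : (fun _ => (1 : ℝ)) =O[l] g 0)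
    (hu : ∀ i, (fun ω => u ω (i + 1)) =O[l] b (i + 1))
    (hg : ∀ i j, i ≤ j → (fun ω => b (i + 1) ω * g (j - i) ω) =O[l] g (j + 1)) (j : ℕ) :
    (fun ω => schur (u ω) j) =O[l] g j := by
  induction j using Nat.strong_induction_on with
  | _ j ih =>
    cases j with
    | zero =>
      refine IsBigO.trans ?_ h0
      simp only [schur_zero]
      exact isBigO_of_le _ fun _ => by simp
    | succ j =>
      have h1 : (fun ω => schur (u ω) (j + 1)) = fun ω => ((j : ℂ) + 1)⁻¹ *
          ∑ i ∈ range (j + 1), ((i : ℂ) + 1) * u ω (i + 1) * schur (u ω) (j - i) := by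
        funext ω
        rw [← schur_succ, inv_mul_cancel_left₀]
        exact_mod_cast Nat.succ_ne_zero j
      rw [h1]
      refine IsBigO.const_mul_left (IsBigO.fun_sum fun i hi => ?_) _
      have hi' := mem_range.1 hi
      refine IsBigO.trans ?_ (hg i j (by omega))
      exact ((hu i).const_mul_left _).mul (ih (j - i) (by omega))

theorem isBigO_pow_pow {B : Ω → ℝ} (hB : Tendsto B l atTop) {a b : ℕ} (h : a ≤ b) :
    (fun ω => B ω ^ a) =O[l] fun ω => B ω ^ b := by
  refine IsBigO.of_bound 1 ?_
  filter_upwards [hB.eventually_ge_atTop 1] with ω hω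
  rw [norm_pow, norm_pow, one_mul]
  exact pow_le_pow_right₀ (by rw [Real.norm_eq_abs]; exact hω.trans (le_abs_self _)) h

theorem isBigO_one_of_tendsto_atTop {B : Ω → ℝ} (hB : Tendsto B l atTop) :
    (fun _ => (1 : ℝ)) =O[l] B := by
  simpa using isBigO_pow_pow hB (Nat.zero_le 1)

theorem isBigO_inv_one {B : Ω → ℝ} (hB : Tendsto B l atTop) :
    (fun ω => (B ω)⁻¹) =O[l] fun _ => (1 : ℝ) :=
  (tendsto_inv_atTop_zero.comp hB).isBigO_one ℝ

theorem isBigO_div_pow {B : Ω → ℝ} (hB : Tendsto B l atTop) {f : Ω → ℂ} {a r k : ℕ}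
    (hf : f =O[l] fun ω => B ω ^ a) (h : a + r ≤ k) :
    (fun ω => f ω / (B ω : ℂ) ^ k) =O[l] fun ω => (B ω)⁻¹ ^ r := by
  have h1 : (fun ω => ((B ω : ℂ) ^ k)⁻¹) =O[l] fun ω => ((B ω) ^ k)⁻¹ :=
    isBigO_of_le _ fun ω => by simp
  have h2 : (fun ω => f ω / (B ω : ℂ) ^ k) =O[l] fun ω => B ω ^ a * ((B ω) ^ k)⁻¹ := by
    simp only [div_eq_mul_inv]
    exact hf.mul h1
  refine h2.trans (IsBigO.of_bound 1 ?_)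
  filter_upwards [hB.eventually_ge_atTop 1] with ω hω
  have hpos : 0 < B ω := by linarith
  rw [one_mul, Real.norm_of_nonneg (by positivity), Real.norm_of_nonneg (by positivity),
    inv_pow, ← div_eq_mul_inv, div_le_iff₀ (by positivity), ← div_eq_inv_mul,
    le_div_iff₀ (by positivity), ← pow_add]
  exact pow_le_pow_right₀ hω h

/-- The position, the size parameter, the scale and the base point are compatible: the scale
tends to infinity and dominates all the others, and the base point stays at bounded distance. -/
structure ScaleBounds (n : ℕ) (lam0 : ℂ) (chi : PowerSeries ℂ) (l : Filter Ω)
    (A x t B : Ω → ℝ) (ζ : Ω → ℂ) : Prop where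
  scale : Tendsto B l atTop
  param : A =O[l] B
  space : x =O[l] B
  time : t =O[l] B
  base : ζ =O[l] B
  near : (fun ω => waveCoord n lam0 chi (x ω) (t ω) - ζ ω) =O[l] fun _ => (1 : ℝ)

variable {n : ℕ} {lam0 lam1 : ℂ} {chi : PowerSeries ℂ} {kap : Fin n → ℕ → ℂ} {N : Fin n → ℕ}
  {A x t B : Ω → ℝ} {ζ : Ω → ℂ}

namespace ScaleBounds

variable (H : ScaleBounds n lam0 chi l A x t B ζ)

include H

theorem eventually_ne_zero : ∀ᶠ ω in l, B ω ≠ 0 := by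
  filter_upwards [H.scale.eventually_ge_atTop 1] with ω hω
  linarith

theorem const_isBigO (c : ℂ) : (fun _ : Ω => c) =O[l] B :=
  (isBigO_const_const c one_ne_zero l).trans (isBigO_one_of_tendsto_atTop H.scale)

theorem wSeq_one (s : Option (Fin n)) (σ : ℂ) (v : ℕ) :
    (fun ω => wSeq n lam0 lam1 chi (x ω) (t ω) (ζ ω) s σ v 1) =O[l] fun _ => (1 : ℝ) := by
  simp only [wSeq, if_true]
  exact (H.near.add (isBigO_const_const _ one_ne_zero l)).add (isBigO_const_const _ one_ne_zero l)

theorem linear_isBigO (a b : ℂ) :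
    (fun ω => a * (x ω : ℂ) + b * Complex.I * (t ω : ℂ)) =O[l] B := by
  have hx : (fun ω => (x ω : ℂ)) =O[l] B :=
    (isBigO_of_le l fun ω => by simp).trans H.space
  have ht : (fun ω => (t ω : ℂ)) =O[l] B :=
    (isBigO_of_le l fun ω => by simp).trans H.time
  exact (hx.const_mul_left a).add (ht.const_mul_left (b * Complex.I))

theorem wSeq_isBigO (s : Option (Fin n)) (σ : ℂ) (v m : ℕ) :
    (fun ω => wSeq n lam0 lam1 chi (x ω) (t ω) (ζ ω) s σ v m) =O[l] B := by
  by_cases hm : m = 1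
  · subst hm
    exact (H.wSeq_one s σ v).trans (isBigO_one_of_tendsto_atTop H.scale)
  · simp only [wSeq, if_neg hm]
    exact ((H.linear_isBigO _ _).add (H.const_isBigO _)).add (H.const_isBigO _)

/-- The first argument is bounded and only arguments of weight at least two grow like `B`, so a
monomial of weight `j` contains at most `j / 2` large factors. After division by `B^k`, orders one
and two are `O(1/B)` and all higher ones are `O(1/B²)`. -/
theorem schur_wSeq (s : Option (Fin n)) (σ : ℂ) (v j : ℕ) :
    (fun ω => schur (wSeq n lam0 lam1 chi (x ω) (t ω) (ζ ω) s σ v) j) =O[l]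
      fun ω => B ω ^ (j / 2) := by
  refine isBigO_schur (b := fun i ω => B ω ^ (if i = 1 then 0 else 1))
    (g := fun j ω => B ω ^ (j / 2)) ?_ (fun i => ?_) (fun i j hij => ?_) j
  · simpa using isBigO_refl (fun _ : Ω => (1 : ℝ)) l
  · by_cases hi : i = 0
    · subst hi
      simpa using H.wSeq_one s σ v
    · simpa [hi] using H.wSeq_isBigO s σ v (i + 1)
  · simp only [← pow_add]
    refine isBigO_pow_pow H.scale ?_
    split_ifs <;> omega

theorem schur_wSeq_div (s : Option (Fin n)) (σ : ℂ) (v : ℕ) {k r : ℕ} (h : k / 2 + r ≤ k) :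
    (fun ω => schur (wSeq n lam0 lam1 chi (x ω) (t ω) (ζ ω) s σ v) k / (B ω : ℂ) ^ k) =O[l]
      fun ω => (B ω)⁻¹ ^ r :=
  isBigO_div_pow H.scale (H.schur_wSeq s σ v k) h

theorem baseRow_isBigO (v : ℕ) (c : Fin (∑ l, N l)) :
    (fun ω => baseRow n kap N (A ω / B ω) (ζ ω / B ω) v c) =O[l] fun _ => (1 : ℝ) := by
  have hA : (fun ω => (A ω : ℂ)) =O[l] B := (isBigO_of_le l fun ω => by simp).trans H.param
  have h1 : (fun ω => (A ω : ℂ) / (B ω : ℂ)) =O[l] fun _ => (1 : ℝ) := by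
    simpa using isBigO_div_pow (f := fun ω => (A ω : ℂ)) (a := 1) (r := 0) (k := 1) H.scale
      (by simpa only [pow_one] using hA) (by omega)
  have h2 : (fun ω => ζ ω / (B ω : ℂ)) =O[l] fun _ => (1 : ℝ) := by
    simpa using isBigO_div_pow (a := 1) (r := 0) (k := 1) H.scale
      (by simpa only [pow_one] using H.base)
      (by omega)
  by_cases h : v ≤ colDeg N c
  · simp only [baseRow, schurSub, if_pos h]
    refine isBigO_schur (b := fun _ _ => 1) (g := fun _ _ => 1) (isBigO_refl _ _) (fun i => ?_)
      (fun i j _ => by simpa using isBigO_refl (fun _ : Ω => (1 : ℝ)) l) _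
    simp only [baseSeq]
    refine IsBigO.add ?_ ?_
    · split_ifs
      · exact h2
      · exact isBigO_zero _ _
    · split_ifs
      · exact isBigO_zero _ _
      · simpa using ((h1.pow (i + 1)).const_mul_left (kap (col N c).1 (i + 1)))
  · simp only [baseRow, schurSub, if_neg h]
    exact isBigO_zero _ _

end ScaleBounds

/-- The deviation of the rows of the scaled factor of `M^{[s]}` from the base rows. -/
def rowError (n : ℕ) (lam0 lam1 : ℂ) (chi : PowerSeries ℂ) (kap : Fin n → ℕ → ℂ) (N : Fin n → ℕ)
    (A x t : ℝ) (ζ : ℂ) (B : ℝ) (s : Option (Fin n)) (σ : ℂ) (v : ℕ) (c : Fin (∑ l, N l)) : ℂ :=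
  ∑ k ∈ range (rowBound N + 2), schur (wSeq n lam0 lam1 chi x t ζ s σ v) (k + 1) /
    (B : ℂ) ^ (k + 1) * baseRow n kap N (A / B) (ζ / B) (v + (k + 1)) c

theorem scaledMinor_eq (hn : 1 ≤ n) (hchi : IsCharBranch n lam0 lam1 chi) (A x t : ℝ) (ζ : ℂ)
    (s : Option (Fin n)) (σ : ℂ) {B : ℝ} (hB : B ≠ 0)
    (g : Fin (∑ l, N l) ↪o Fin (rowBound N)) :
    scaledMinor (gramFactor n lam0 lam1 chi N (largeParam n kap A) x t s σ) (colDeg N) B g =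
      (rowMatrix (baseRow n kap N (A / B) (ζ / B)) (fun i => (g i : ℕ)) +
        rowMatrix (rowError n lam0 lam1 chi kap N A x t ζ B s σ) (fun i => (g i : ℕ))).det := by
  rw [scaledMinor]
  congr 1
  ext1 i c
  rw [Matrix.of_apply, gramFactor_scaled hn hchi N A x t ζ s σ hB, sum_range_succ']
  rw [schur_zero, pow_zero, div_one, one_mul, add_zero, add_comm]
  rfl

namespace ScaleBounds

variable (H : ScaleBounds n lam0 chi l A x t B ζ)

include H

theorem rowError_isBigO (s : Option (Fin n)) (σ : ℂ) (v : ℕ) (c : Fin (∑ l, N l)) :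
    (fun ω => rowError n lam0 lam1 chi kap N (A ω) (x ω) (t ω) (ζ ω) (B ω) s σ v c) =O[l]
      fun ω => (B ω)⁻¹ := by
  refine IsBigO.fun_sum fun k _ => ?_
  have h1 := H.schur_wSeq_div (lam1 := lam1) s σ v (k := k + 1) (r := 1) (by omega)
  simpa using h1.mul (H.baseRow_isBigO (kap := kap) (N := N) (v + (k + 1)) c)

theorem scaledMinor_first (hn : 1 ≤ n) (hchi : IsCharBranch n lam0 lam1 chi)
    (s : Option (Fin n)) (σ : ℂ) (g : Fin (∑ l, N l) ↪o Fin (rowBound N)) :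
    (fun ω => scaledMinor (gramFactor n lam0 lam1 chi N (largeParam n kap (A ω)) (x ω) (t ω) s σ)
        (colDeg N) (B ω) g -
      (rowMatrix (baseRow n kap N (A ω / B ω) (ζ ω / B ω)) (fun i => (g i : ℕ))).det) =O[l]
      fun ω => (B ω)⁻¹ := by
  have h := isBigO_det_add_first
    (X := fun ω => rowMatrix (baseRow n kap N (A ω / B ω) (ζ ω / B ω)) (fun i => (g i : ℕ)))
    (E := fun ω => rowMatrix (rowError n lam0 lam1 chi kap N (A ω) (x ω) (t ω) (ζ ω) (B ω) s σ)
      (fun i => (g i : ℕ)))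
    (isBigO_inv_one H.scale) (fun i c => H.baseRow_isBigO _ _)
    (fun i c => H.rowError_isBigO s σ _ _)
  refine h.congr' ?_ EventuallyEq.rfl
  filter_upwards [H.eventually_ne_zero] with ω hω
  rw [scaledMinor_eq hn hchi _ _ _ (ζ ω) s σ hω]

theorem scaledMinor_isBigO (hn : 1 ≤ n) (hchi : IsCharBranch n lam0 lam1 chi)
    (s : Option (Fin n)) (σ : ℂ) (g : Fin (∑ l, N l) ↪o Fin (rowBound N)) :
    (fun ω => scaledMinor (gramFactor n lam0 lam1 chi N (largeParam n kap (A ω)) (x ω) (t ω) s σ)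
        (colDeg N) (B ω) g) =O[l] fun _ => (1 : ℝ) := by
  have h1 := (H.scaledMinor_first (kap := kap) hn hchi s σ g).trans (isBigO_inv_one H.scale)
  have h2 : (fun ω => (rowMatrix (baseRow n kap N (A ω / B ω) (ζ ω / B ω))
      (fun i => (g i : ℕ))).det) =O[l] fun _ => (1 : ℝ) :=
    isBigO_det_one fun i c => H.baseRow_isBigO _ _
  simpa using h1.add h2

/-- Up to `O(1/B²)` a row is perturbed only by multiples of the next two base rows. At this accuracy
the two coefficients do not depend on the row, hence can be taken out of the sums over rows, which
are then the derivative of the Wronskian and its second-order analogue. -/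
theorem scaledMinor_second (hn : 1 ≤ n) (hchi : IsCharBranch n lam0 lam1 chi)
    (hlam0 : lam0.im ≠ 0) (hlam1 : lam1 ≠ 0) (s : Option (Fin n)) (σ : ℂ) :
    (fun ω => scaledMinor (gramFactor n lam0 lam1 chi N (largeParam n kap (A ω)) (x ω) (t ω) s σ)
        (colDeg N) (B ω) (lowRows lt_rowBound.le) -
      (rowMatrix (baseRow n kap N (A ω / B ω) (ζ ω / B ω)) (fun i => i)).det -
      (waveCoord n lam0 chi (x ω) (t ω) - ζ ω + σ * shift2 n lam0 chi s 1) / B ω *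
        ∑ i : Fin (∑ l, N l), ((rowMatrix (baseRow n kap N (A ω / B ω) (ζ ω / B ω))
          (fun i => i)).updateRow i (baseRow n kap N (A ω / B ω) (ζ ω / B ω) (i + 1))).det -
      (alpha n lam0 lam1 chi 2 * x ω + beta n lam0 lam1 chi 2 * Complex.I * t ω) / (B ω : ℂ) ^ 2 *
        ∑ i : Fin (∑ l, N l), ((rowMatrix (baseRow n kap N (A ω / B ω) (ζ ω / B ω))
          (fun i => i)).updateRow i (baseRow n kap N (A ω / B ω) (ζ ω / B ω) (i + 2))).det) =O[l]
      fun ω => (B ω)⁻¹ ^ 2 := by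
  set r : Ω → ℕ → Fin (∑ l, N l) → ℂ := fun ω => baseRow n kap N (A ω / B ω) (ζ ω / B ω) with hr
  set X : Ω → Matrix (Fin (∑ l, N l)) (Fin (∑ l, N l)) ℂ :=
    fun ω => rowMatrix (r ω) (fun i => i) with hX
  set e : Ω → ℕ → Fin (∑ l, N l) → ℂ :=
    fun ω => rowError n lam0 lam1 chi kap N (A ω) (x ω) (t ω) (ζ ω) (B ω) s σ with he
  set a : Ω → ℕ → ℕ → ℂ :=
    fun ω v k => schur (wSeq n lam0 lam1 chi (x ω) (t ω) (ζ ω) s σ v) k / (B ω : ℂ) ^ k with ha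
  set rem : Ω → ℕ → Fin (∑ l, N l) → ℂ := fun ω v => ∑ k ∈ range (rowBound N),
    a ω v (k + 3) • r ω (v + (k + 3)) with hrem
  have hXO : ∀ i c, (fun ω => X ω i c) =O[l] fun _ => (1 : ℝ) := fun i c => H.baseRow_isBigO _ _
  have h0 := isBigO_det_add (X := X) (E := fun ω => rowMatrix (e ω) (fun i => i))
    (isBigO_inv_one H.scale) hXO (fun i c => H.rowError_isBigO s σ _ _)
  have hsplit : ∀ ω (i : Fin (∑ l, N l)), ((X ω).updateRow i (e ω i)).det =
      a ω i 1 * ((X ω).updateRow i (r ω (i + 1))).det +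
      a ω i 2 * ((X ω).updateRow i (r ω (i + 2))).det + ((X ω).updateRow i (rem ω i)).det := by
    intro ω i
    have : e ω i = a ω i 1 • r ω (i + 1) + a ω i 2 • r ω (i + 2) + rem ω i := by
      funext c
      simp only [he, rowError, Pi.add_apply, Pi.smul_apply, smul_eq_mul, hrem, Finset.sum_apply]
      rw [sum_range_succ', sum_range_succ']
      ring
    rw [this, Matrix.det_updateRow_add, Matrix.det_updateRow_add, Matrix.det_updateRow_smul,
      Matrix.det_updateRow_smul]
  have hremO : ∀ v c, (fun ω => rem ω v c) =O[l] fun ω => (B ω)⁻¹ ^ 2 := by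
    intro v c
    simp only [hrem, Finset.sum_apply, Pi.smul_apply, smul_eq_mul]
    refine IsBigO.fun_sum fun k _ => ?_
    have h1 := H.schur_wSeq_div (lam1 := lam1) s σ v (k := k + 3) (r := 2) (by omega)
    simpa using h1.mul (H.baseRow_isBigO (kap := kap) (N := N) (v + (k + 3)) c)
  have hDO : ∀ (i : Fin (∑ l, N l)) (q : ℕ),
      (fun ω => ((X ω).updateRow i (r ω q)).det) =O[l] fun _ => (1 : ℝ) := fun i q =>
    isBigO_det_updateRow hXO i fun j => H.baseRow_isBigO _ _
  -- The term `v h_{1,1}` drops out by `h1_one`.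
  have ha1 : ∀ ω (v : ℕ), a ω v 1 =
      (waveCoord n lam0 chi (x ω) (t ω) - ζ ω + σ * shift2 n lam0 chi s 1) / B ω := by
    intro ω v
    simp only [ha, schur_one, pow_one, wSeq, if_true, h1_one hn hchi hlam0 hlam1]
    ring
  -- `S₂ = w₂ + w₁² / 2`, where `w₁` and the `h`-parts of `w₂` are bounded; only the part linear in
  -- `x, t` can be of size `B`.
  have ha2 : ∀ v : ℕ, (fun ω => a ω v 2 - (alpha n lam0 lam1 chi 2 * x ω +
      beta n lam0 lam1 chi 2 * Complex.I * t ω) / (B ω : ℂ) ^ 2) =O[l]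
      fun ω => (B ω)⁻¹ ^ 2 := by
    intro v
    have h1 : (fun ω => v * h1 n lam0 chi 2 + σ * shift2 n lam0 chi s 2 +
        (1 / 2 : ℂ) * wSeq n lam0 lam1 chi (x ω) (t ω) (ζ ω) s σ v 1 ^ 2) =O[l]
        fun ω => B ω ^ 0 := by
      have h2 := ((H.wSeq_one (lam1 := lam1) s σ v).pow 2).const_mul_left (1 / 2 : ℂ)
      simp only [one_pow] at h2
      simp only [pow_zero]
      exact (isBigO_const_const _ one_ne_zero l).add h2
    refine (isBigO_div_pow (r := 2) (k := 2) H.scale h1 (by omega)).congr_left fun ω => ?_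
    have h2 := two_mul_schur_two (wSeq n lam0 lam1 chi (x ω) (t ω) (ζ ω) s σ v)
    have h3 : wSeq n lam0 lam1 chi (x ω) (t ω) (ζ ω) s σ v 2 = alpha n lam0 lam1 chi 2 * x ω +
        beta n lam0 lam1 chi 2 * Complex.I * t ω + v * RogueWave.h1 n lam0 chi 2 +
        σ * shift2 n lam0 chi s 2 := by
      rw [wSeq, if_neg (by norm_num)]
    simp only [ha]
    rw [← sub_div]
    congr 1
    linear_combination (-1 / 2 : ℂ) * h2 - h3
  have hE : (fun ω => ∑ i : Fin (∑ l, N l), ((a ω i 2 - (alpha n lam0 lam1 chi 2 * x ω +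
      beta n lam0 lam1 chi 2 * Complex.I * t ω) / (B ω : ℂ) ^ 2) *
        ((X ω).updateRow i (r ω (i + 2))).det + ((X ω).updateRow i (rem ω i)).det)) =O[l]
      fun ω => (B ω)⁻¹ ^ 2 := by
    refine IsBigO.fun_sum fun i _ => IsBigO.add ?_ ?_
    · simpa using (ha2 i).mul (hDO i (i + 2))
    · exact isBigO_det_updateRow hXO i fun j => hremO _ _
  refine (h0.add hE).congr' ?_ EventuallyEq.rfl
  filter_upwards [H.eventually_ne_zero] with ω hω
  rw [scaledMinor_eq hn hchi _ _ _ (ζ ω) s σ hω]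
  have h4 : ∀ i, rowMatrix (e ω) (fun i => (i : ℕ)) i = e ω i := fun i => rfl
  simp only [h4, hsplit, ha1, sum_add_distrib, ← mul_sum, sub_mul, sum_sub_distrib]
  simp only [hX, he, hr, lowRows_val]
  ring

end ScaleBounds

end Asymptotics

end RogueWave

end

/-! ### Leading row sets in the Cauchy–Binet sum. -/

noncomputable section

namespace RogueWave

open Finset Asymptotics Filter

section MinorSum

variable {Ω : Type*} {l : Filter Ω} {N D : ℕ}

theorem isBigO_weight {B : Ω → ℝ} (hB : Tendsto B l atTop) (C : ℝ) {e r : ℕ} (h : r ≤ e) :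
    (fun ω => ((C / B ω ^ 2 : ℝ) : ℂ) ^ e) =O[l] fun ω => (B ω)⁻¹ ^ (2 * r) := by
  have h1 : (fun _ : Ω => (C : ℂ) ^ e) =O[l] fun ω => B ω ^ 0 := by
    simpa only [pow_zero] using isBigO_const_const ((C : ℂ) ^ e) one_ne_zero l
  refine (isBigO_div_pow (k := 2 * e) hB h1 (by omega)).congr_left fun ω => ?_
  push_cast
  rw [div_pow, pow_mul]

theorem isBigO_star_mul {f g : Ω → ℂ} {a b : Ω → ℝ} (hf : f =O[l] a) (hg : g =O[l] b) :
    (fun ω => star (f ω) * g ω) =O[l] fun ω => a ω * b ω := by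
  refine IsBigO.mul ?_ hg
  exact (isBigO_of_le l fun ω => by simp).trans hf

variable {Φ Ψ : Ω → Matrix (Fin D) (Fin N) ℂ} {e : Fin N → ℕ} {B : Ω → ℝ}

theorem minorSum_first (hB : Tendsto B l atTop) (C : ℝ) (hND : N ≤ D)
    (hΦ : ∀ g, (fun ω => scaledMinor (Φ ω) e (B ω) g) =O[l] fun _ => (1 : ℝ))
    (hΨ : ∀ g, (fun ω => scaledMinor (Ψ ω) e (B ω) g) =O[l] fun _ => (1 : ℝ)) :
    (fun ω => minorSum (Φ ω) (Ψ ω) e C (B ω) -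
      star (scaledMinor (Φ ω) e (B ω) (lowRows hND)) * scaledMinor (Ψ ω) e (B ω) (lowRows hND))
      =O[l] fun ω => (B ω)⁻¹ ^ 2 := by
  have h : ∀ ω, minorSum (Φ ω) (Ψ ω) e C (B ω) -
      star (scaledMinor (Φ ω) e (B ω) (lowRows hND)) * scaledMinor (Ψ ω) e (B ω) (lowRows hND) =
      ∑ g ∈ univ.erase (lowRows hND),
        ((C / B ω ^ 2 : ℝ) : ℂ) ^ (∑ i, (g i : ℕ) - ∑ i : Fin N, (i : ℕ)) *
        (star (scaledMinor (Φ ω) e (B ω) g) * scaledMinor (Ψ ω) e (B ω) g) := by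
    intro ω
    rw [minorSum, ← add_sum_erase _ _ (mem_univ (lowRows hND))]
    simp
  simp only [h]
  refine IsBigO.fun_sum fun g hg => ?_
  have h1 := sum_lt_sum_orderEmb hND g (ne_of_mem_erase hg)
  have h2 := isBigO_weight hB C (e := ∑ i, (g i : ℕ) - ∑ i : Fin N, (i : ℕ)) (r := 1) (by omega)
  simpa using h2.mul (isBigO_star_mul (hΦ g) (hΨ g))

theorem minorSum_second (hB : Tendsto B l atTop) (C : ℝ) (hND : N < D) (hN : 0 < N)
    (hΦ : ∀ g, (fun ω => scaledMinor (Φ ω) e (B ω) g) =O[l] fun _ => (1 : ℝ))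
    (hΨ : ∀ g, (fun ω => scaledMinor (Ψ ω) e (B ω) g) =O[l] fun _ => (1 : ℝ)) :
    (fun ω => minorSum (Φ ω) (Ψ ω) e C (B ω) -
      star (scaledMinor (Φ ω) e (B ω) (lowRows hND.le)) *
        scaledMinor (Ψ ω) e (B ω) (lowRows hND.le) -
      ((C / B ω ^ 2 : ℝ) : ℂ) * (star (scaledMinor (Φ ω) e (B ω) (nextRows hND)) *
        scaledMinor (Ψ ω) e (B ω) (nextRows hND)))
      =O[l] fun ω => (B ω)⁻¹ ^ 4 := by
  have hlast : (lowRows hND.le) ⟨N - 1, by omega⟩ ≠ (nextRows hND) ⟨N - 1, by omega⟩ := by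
    intro hc
    have := congrArg Fin.val hc
    rw [lowRows_val, nextRows_val, if_pos (by simp only; omega)] at this
    simp only at this
    omega
  have hne : nextRows hND ≠ lowRows hND.le := fun hc => hlast (by rw [hc])
  have hsum : ∑ i, (nextRows hND i : ℕ) - ∑ i : Fin N, (i : ℕ) = 1 := by
    rw [← add_sum_erase univ (fun i => (nextRows hND i : ℕ)) (mem_univ ⟨N - 1, by omega⟩),
      ← add_sum_erase univ (fun i : Fin N => (i : ℕ)) (mem_univ ⟨N - 1, by omega⟩)]
    have h1 : ∑ i ∈ univ.erase (⟨N - 1, by omega⟩ : Fin N), (nextRows hND i : ℕ) =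
        ∑ i ∈ univ.erase (⟨N - 1, by omega⟩ : Fin N), (i : ℕ) := by
      refine sum_congr rfl fun i hi => ?_
      have : (i : ℕ) ≠ N - 1 := fun hc => ne_of_mem_erase hi (Fin.ext hc)
      rw [nextRows_val, if_neg (by omega)]
    rw [h1, nextRows_val, if_pos (by simp only; omega)]
    simp only
    omega
  have h : ∀ ω, minorSum (Φ ω) (Ψ ω) e C (B ω) -
      star (scaledMinor (Φ ω) e (B ω) (lowRows hND.le)) *
        scaledMinor (Ψ ω) e (B ω) (lowRows hND.le) -
      ((C / B ω ^ 2 : ℝ) : ℂ) * (star (scaledMinor (Φ ω) e (B ω) (nextRows hND)) *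
        scaledMinor (Ψ ω) e (B ω) (nextRows hND)) =
      ∑ g ∈ (univ.erase (lowRows hND.le)).erase (nextRows hND),
        ((C / B ω ^ 2 : ℝ) : ℂ) ^ (∑ i, (g i : ℕ) - ∑ i : Fin N, (i : ℕ)) *
        (star (scaledMinor (Φ ω) e (B ω) g) * scaledMinor (Ψ ω) e (B ω) g) := by
    intro ω
    rw [minorSum, ← add_sum_erase _ _ (mem_univ (lowRows hND.le)),
      ← add_sum_erase _ _ (mem_erase.2 ⟨hne, mem_univ (nextRows hND)⟩), hsum]
    simp only [lowRows_val, Nat.sub_self, pow_zero, one_mul, pow_one]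
    ring
  simp only [h]
  refine IsBigO.fun_sum fun g hg => ?_
  have hg1 := ne_of_mem_erase hg
  have hg2 := ne_of_mem_erase (mem_of_mem_erase hg)
  have h1 := sum_add_two_le_sum_orderEmb hND g hg2 hg1
  have h2 := isBigO_weight hB C (e := ∑ i, (g i : ℕ) - ∑ i : Fin N, (i : ℕ)) (r := 2) (by omega)
  simpa using h2.mul (isBigO_star_mul (hΦ g) (hΨ g))

end MinorSum

/-! ### The complex coordinate and Euclidean distances in the plane. -/

section Geometry

variable {n : ℕ} {lam0 lam1 : ℂ} {chi : PowerSeries ℂ}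

theorem waveCoord_sub (x t x' t' : ℝ) : waveCoord n lam0 chi (x - x') (t - t') =
    waveCoord n lam0 chi x t - waveCoord n lam0 chi x' t' := by
  simp only [waveCoord]
  push_cast
  ring

theorem waveCoord_smul (c x t : ℝ) : waveCoord n lam0 chi (c * x) (c * t) =
    c * waveCoord n lam0 chi x t := by
  simp only [waveCoord]
  push_cast
  ring

theorem waveCoord_planePoint (hlam0 : lam0.im ≠ 0) (h1 : chi1 chi ≠ 0) (w : ℂ) :
    waveCoord n lam0 chi (planePoint n lam0 chi w).1 (planePoint n lam0 chi w).2 = w :=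
  (planePoint_iff n lam0 chi w hlam0 h1 _ _).1 rfl

theorem norm_waveCoord (x t : ℝ) :
    ‖waveCoord n lam0 chi x t‖ = ‖chi1 chi‖ * ‖(x : ℂ) + chi0 n lam0 * t‖ := by
  rw [waveCoord, norm_mul, norm_mul, Complex.norm_I, one_mul]

/-- Since `Im χ₀ ≠ 0`, `u = x + χ₀ t` determines the real point: `|t| ≤ |u| / |Im χ₀|` and `|x| ≤
|u| + |χ₀| |t|`. The constant adds both bounds and divides by `|χ^{[1]}|`. -/
theorem exists_abs_le_waveCoord (hlam0 : lam0.im ≠ 0) (h1 : chi1 chi ≠ 0) :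
    ∃ K : ℝ, 0 < K ∧ ∀ x t : ℝ, |x| ≤ K * ‖waveCoord n lam0 chi x t‖ ∧
      |t| ≤ K * ‖waveCoord n lam0 chi x t‖ := by
  have him : 0 < |(chi0 n lam0).im| := by
    rw [chi0_im]; exact abs_pos.2 (specScale_ne_zero hlam0)
  have hc : 0 < ‖chi1 chi‖ := norm_pos_iff.2 h1
  refine ⟨(1 + (‖chi0 n lam0‖ + 1) / |(chi0 n lam0).im|) / ‖chi1 chi‖, by positivity,
    fun x t => ?_⟩
  rw [norm_waveCoord, div_mul_eq_mul_div, ← mul_assoc, mul_right_comm, mul_div_cancel_right₀ _ hc.ne']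
  set u : ℂ := (x : ℂ) + chi0 n lam0 * t with hu
  have ht : |t| * |(chi0 n lam0).im| ≤ ‖u‖ := by
    have : u.im = (chi0 n lam0).im * t := by rw [hu]; simp
    rw [← abs_mul, mul_comm, ← this]
    exact Complex.abs_im_le_norm u
  have ht' : |t| ≤ ‖u‖ / |(chi0 n lam0).im| := by rwa [le_div_iff₀ him]
  have hx : |x| ≤ ‖u‖ + ‖chi0 n lam0‖ * |t| := by
    have h2 : (x : ℂ) = u - chi0 n lam0 * t := by rw [hu]; ring
    have h3 := norm_sub_le u (chi0 n lam0 * t)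
    rw [← h2, norm_mul, Complex.norm_real, Complex.norm_real] at h3
    exact h3
  have h4 : ‖chi0 n lam0‖ * |t| ≤ ‖chi0 n lam0‖ * (‖u‖ / |(chi0 n lam0).im|) :=
    mul_le_mul_of_nonneg_left ht' (norm_nonneg _)
  have h5 : (1 + (‖chi0 n lam0‖ + 1) / |(chi0 n lam0).im|) * ‖u‖ =
      ‖u‖ + ‖chi0 n lam0‖ * (‖u‖ / |(chi0 n lam0).im|) + ‖u‖ / |(chi0 n lam0).im| := by
    ring
  have h6 : 0 ≤ ‖u‖ / |(chi0 n lam0).im| := by positivity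
  have h7 : 0 ≤ ‖chi0 n lam0‖ * (‖u‖ / |(chi0 n lam0).im|) := by positivity
  have h8 := norm_nonneg u
  rw [h5]
  constructor <;> linarith

theorem exists_dist2_le (hlam0 : lam0.im ≠ 0) (h1 : chi1 chi ≠ 0) :
    ∃ K : ℝ, 0 < K ∧ ∀ p q : ℝ × ℝ, dist2 p q ≤
      K * ‖waveCoord n lam0 chi p.1 p.2 - waveCoord n lam0 chi q.1 q.2‖ := by
  obtain ⟨K, hK, h⟩ := exists_abs_le_waveCoord (n := n) hlam0 h1
  refine ⟨K + K, by positivity, fun p q => ?_⟩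
  obtain ⟨hx, ht⟩ := h (p.1 - q.1) (p.2 - q.2)
  rw [waveCoord_sub] at hx ht
  rw [dist2, add_mul]
  refine (Real.sqrt_le_iff.2 ⟨by positivity, ?_⟩).trans (add_le_add hx ht)
  nlinarith [abs_nonneg (p.1 - q.1), abs_nonneg (p.2 - q.2), sq_abs (p.1 - q.1),
    sq_abs (p.2 - q.2), mul_nonneg (abs_nonneg (p.1 - q.1)) (abs_nonneg (p.2 - q.2))]

theorem norm_waveCoord_sub_le (p q : ℝ × ℝ) :
    ‖waveCoord n lam0 chi p.1 p.2 - waveCoord n lam0 chi q.1 q.2‖ ≤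
      ‖chi1 chi‖ * (1 + ‖chi0 n lam0‖) * dist2 p q := by
  rw [← waveCoord_sub, norm_waveCoord, mul_assoc]
  refine mul_le_mul_of_nonneg_left ?_ (norm_nonneg _)
  have hx : |p.1 - q.1| ≤ dist2 p q := Real.abs_le_sqrt (by nlinarith [sq_nonneg (p.2 - q.2)])
  have ht : |p.2 - q.2| ≤ dist2 p q := Real.abs_le_sqrt (by nlinarith [sq_nonneg (p.1 - q.1)])
  refine (norm_add_le _ _).trans ?_
  rw [norm_mul, Complex.norm_real, Complex.norm_real, Real.norm_eq_abs, Real.norm_eq_abs, add_mul,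
    one_mul]
  exact add_le_add hx (mul_le_mul_of_nonneg_left ht (norm_nonneg _))

theorem waveCoord_rwPos (hlam0 : lam0.im ≠ 0) (h1 : chi1 chi ≠ 0) (N : Fin n → ℕ)
    (kap : Fin n → ℕ → ℂ) (A : ℝ) (z : ℂ) :
    waveCoord n lam0 chi (rwPos n lam0 lam1 chi N kap A z).1
      (rwPos n lam0 lam1 chi N kap A z).2 = z * A - Delta n lam0 lam1 chi N kap z :=
  waveCoord_planePoint hlam0 h1 _

theorem tendsto_dist2_rwPos (hlam0 : lam0.im ≠ 0) (h1 : chi1 chi ≠ 0) (N : Fin n → ℕ)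
    (kap : Fin n → ℕ → ℂ) {z w : ℂ} (hzw : z ≠ w) :
    Tendsto (fun A : ℝ => dist2 (rwPos n lam0 lam1 chi N kap A z)
      (rwPos n lam0 lam1 chi N kap A w)) atTop atTop := by
  set K := ‖chi1 chi‖ * (1 + ‖chi0 n lam0‖) with hK
  have hKpos : 0 < K := mul_pos (norm_pos_iff.2 h1) (by positivity)
  set δ := Delta n lam0 lam1 chi N kap z - Delta n lam0 lam1 chi N kap w with hδ
  have hpos : 0 < ‖z - w‖ := norm_pos_iff.2 (sub_ne_zero.2 hzw)
  have ht : Tendsto (fun A : ℝ => (‖z - w‖ * A - ‖δ‖) / K) atTop atTop :=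
    ((tendsto_atTop_add_const_right _ _ (tendsto_id.const_mul_atTop hpos)).atTop_div_const hKpos)
  refine tendsto_atTop_mono' atTop ?_ ht
  filter_upwards [eventually_ge_atTop 0] with A hA
  rw [div_le_iff₀ hKpos, mul_comm _ K]
  refine le_trans ?_ (norm_waveCoord_sub_le (n := n) (lam0 := lam0) (chi := chi) _ _)
  rw [waveCoord_rwPos hlam0 h1, waveCoord_rwPos hlam0 h1]
  have h2 : z * A - Delta n lam0 lam1 chi N kap z - (w * A - Delta n lam0 lam1 chi N kap w) =
      (z - w) * A - δ := by rw [hδ]; ring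
  rw [h2]
  refine le_trans ?_ (norm_sub_norm_le _ _)
  rw [norm_mul, Complex.norm_real, Real.norm_of_nonneg hA]

end Geometry

/-! ### Lower bounds for products over separated roots. -/

section ProductBound

/-- At most one factor lies below `m`, and it is still at least `δ`. -/
theorem prod_ge_of_separated {ι : Type*} [DecidableEq ι] (s : Finset ι) (f : ι → ℝ) {m δ : ℝ} (hm : 0 < m)
    (hm1 : m ≤ 1) (hδ : 0 ≤ δ) (hδm : δ ≤ m) (hf : ∀ i ∈ s, δ ≤ f i)
    (hsep : ∀ i ∈ s, ∀ j ∈ s, i ≠ j → m ≤ f i ∨ m ≤ f j) :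
    δ * m ^ #s ≤ ∏ i ∈ s, f i := by
  by_cases h : ∃ i ∈ s, f i < m
  · obtain ⟨i, hi, him⟩ := h
    rw [← mul_prod_erase s f hi]
    refine mul_le_mul (hf i hi) ?_ (by positivity) (hδ.trans (hf i hi))
    have h1 : m ^ #(s.erase i) ≤ ∏ j ∈ s.erase i, f j := by
      rw [← prod_const]
      refine prod_le_prod (fun _ _ => hm.le) fun j hj => ?_
      exact (hsep i hi j (mem_of_mem_erase hj) (ne_of_mem_erase hj).symm).resolve_left (not_le.2 him)
    exact (pow_le_pow_of_le_one hm.le hm1 (card_le_card (erase_subset i s))).trans h1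
  · push Not at h
    have h1 : m ^ #s ≤ ∏ j ∈ s, f j := by
      rw [← prod_const]
      exact prod_le_prod (fun _ _ => hm.le) h
    refine le_trans ?_ h1
    exact mul_le_of_le_one_left (by positivity) (hδm.trans hm1)

/-- The bound is uniform in `a`, although the points `a w` merge as `a → 0`: in that regime `z` has
modulus one and stays away from all of them. -/
theorem exists_separation (s : Finset ℂ) : ∃ m : ℝ, 0 < m ∧ m ≤ 1 ∧ ∀ (a : ℝ) (z : ℂ), 0 < a →
    (a = 1 ∨ ‖z‖ = 1) → ∀ w ∈ s, ∀ w' ∈ s, w ≠ w' → m ≤ ‖z - a * w‖ ∨ m ≤ ‖z - a * w'‖ := by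
  obtain ⟨μ, hμ, hsep⟩ : ∃ μ : ℝ, 0 < μ ∧ ∀ w ∈ s, ∀ w' ∈ s, w ≠ w' → μ ≤ ‖w - w'‖ := by
    by_cases h : s.offDiag.Nonempty
    · obtain ⟨p, hp, hmin⟩ := s.offDiag.exists_min_image (fun p => ‖p.1 - p.2‖) h
      refine ⟨‖p.1 - p.2‖, norm_pos_iff.2 (sub_ne_zero.2 (mem_offDiag.1 hp).2.2), ?_⟩
      intro w hw w' hw' hne
      exact hmin (w, w') (mem_offDiag.2 ⟨hw, hw', hne⟩)
    · refine ⟨1, one_pos, fun w hw w' hw' hne => ?_⟩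
      exact absurd ⟨(w, w'), mem_offDiag.2 ⟨hw, hw', hne⟩⟩ h
  obtain ⟨M, hM0, hM⟩ : ∃ M : ℝ, 0 ≤ M ∧ ∀ w ∈ s, ‖w‖ ≤ M :=
    ⟨∑ w ∈ s, ‖w‖, by positivity, fun w hw => single_le_sum (f := fun w : ℂ => ‖w‖)
      (fun _ _ => norm_nonneg _) hw⟩
  refine ⟨min (1 / 2) (μ / (4 * (M + 1))), by positivity, (min_le_left _ _).trans (by norm_num), ?_⟩
  intro a z ha haz w hw w' hw' hne
  -- For small `a` all `a w` have modulus at most `1/2`. Otherwise `a` is bounded below, and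
  -- distinct points have distance at least `a μ ≥ μ / (2 (M + 1))`.
  by_cases hsmall : a * (2 * (M + 1)) < 1
  · left
    refine (min_le_left _ _).trans ?_
    have hz : ‖z‖ = 1 := haz.resolve_left (by rintro rfl; linarith)
    have h1 := norm_sub_norm_le z (a * w)
    have h2 : ‖(a : ℂ) * w‖ ≤ a * M := by
      rw [norm_mul, Complex.norm_real, Real.norm_of_nonneg ha.le]
      exact mul_le_mul_of_nonneg_left (hM w hw) ha.le
    nlinarith
  · by_contra! hc
    have h1 : ‖z - a * w‖ < μ / (4 * (M + 1)) := hc.1.trans_le (min_le_right _ _)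
    have h2 : ‖z - a * w'‖ < μ / (4 * (M + 1)) := hc.2.trans_le (min_le_right _ _)
    have h3 : a * ‖w - w'‖ ≤ ‖z - a * w‖ + ‖z - a * w'‖ := by
      have h4 : (a : ℂ) * (w - w') = (z - a * w') - (z - a * w) := by ring
      have h5 := norm_sub_le (z - a * w') (z - a * w)
      rw [← h4, norm_mul, Complex.norm_real, Real.norm_of_nonneg ha.le] at h5
      linarith
    have h6 : a * μ ≤ a * ‖w - w'‖ := mul_le_mul_of_nonneg_left (hsep w hw w' hw' hne) ha.le
    have h7 : μ / (2 * (M + 1)) ≤ a * μ := by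
      rw [div_le_iff₀ (by positivity)]
      nlinarith
    have h8 : μ / (4 * (M + 1)) + μ / (4 * (M + 1)) = μ / (2 * (M + 1)) := by
      field_simp; ring
    linarith

end ProductBound

section BaseDet

variable {n : ℕ} (N : Fin n → ℕ) (kap : Fin n → ℕ → ℂ)

theorem eval_phiRow (z : ℂ) (v : ℕ) (c : Fin (∑ l, N l)) :
    (phiRow N kap v c).eval z = baseRow n kap N 1 z v c := by
  rw [phiRow, baseRow, schurSub]
  split_ifs
  · exact eval_phi _ _ _ _ _
  · exact Polynomial.eval_zero

theorem eval_det_rowMatrix (z : ℂ) (p : Fin (∑ l, N l) → ℕ) :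
    (rowMatrix (phiRow N kap) p).det.eval z = (rowMatrix (baseRow n kap N 1 z) p).det := by
  rw [← Polynomial.coe_evalRingHom, RingHom.map_det]
  congr 1
  ext1 i c
  exact eval_phiRow N kap z _ _

/-- By homogeneity the determinant is `a^deg W(z / a)`. In the factored form no division by `a`
remains, so it can be estimated uniformly as `a → 0`. -/
theorem det_baseRow_eq {a : ℝ} (ha : a ≠ 0) (z : ℂ) :
    (rowMatrix (baseRow n kap N a z) fun i => i).det = (gmamWronskian n N kap).leadingCoeff *
      ((gmam n N kap).roots.map fun w => z - a * w).prod := by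
  have ha' : (a : ℂ) ≠ 0 := by exact_mod_cast ha
  have h1 : (rowMatrix (baseRow n kap N a z) fun i => i).det *
      (a : ℂ) ^ (∑ i : Fin (∑ l, N l), (i : ℕ)) =
      (a : ℂ) ^ (∑ c, colDeg N c) * (gmamWronskian n N kap).eval (z / a) := by
    have h2 := Matrix.det_mul_column (fun i : Fin (∑ l, N l) => (a : ℂ) ^ (i : ℕ))
      (rowMatrix (baseRow n kap N a z) fun i => i)
    have h3 := Matrix.det_mul_row (fun c => (a : ℂ) ^ colDeg N c)
      (rowMatrix (baseRow n kap N 1 (z / a)) fun i => i)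
    rw [prod_pow_eq_pow_sum] at h2 h3
    rw [gmamWronskian_eq, eval_det_rowMatrix, ← h3, mul_comm, ← h2]
    congr 1
    ext1 i c
    simp only [Matrix.of_apply, rowMatrix, baseRow]
    have h4 := schurSub_baseSeq_scale (kap := kap) (col N c).1 a z ha (colDeg N c) i
    rw [div_self ha'] at h4
    rw [← h4, mul_comm]
  have h5 := wronskianDegree_add N
  rw [← h5, pow_add, mul_right_comm] at h1
  rw [mul_right_cancel₀ (pow_ne_zero _ ha') h1, eval_gmamWronskian, ← card_roots_gmam N kap,
    mul_left_comm]
  congr 1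
  have h6 : ∀ s : Multiset ℂ, (a : ℂ) ^ (Multiset.card s) * (s.map fun w => z / a - w).prod =
      (s.map fun w => z - a * w).prod := by
    intro s
    induction s using Multiset.induction_on with
    | empty => simp
    | cons w s ih =>
      simp only [Multiset.card_cons, Multiset.map_cons, Multiset.prod_cons]
      rw [← ih, pow_succ]
      field_simp
  exact h6 _

end BaseDet

end RogueWave

end

/-! ### The plane wave background far from all positions. -/

noncomputable section

namespace RogueWave

open Finset Asymptotics Filter

section FarField

theorem norm_planeWave (n : ℕ) (lam0 : ℂ) (k : Fin n) (x t : ℝ) :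
    ‖planeWave n lam0 k x t‖ = |amp n lam0 k| := by
  rw [planeWave, norm_mul, Complex.norm_real, mul_comm Complex.I, Complex.norm_exp_ofReal_mul_I,
    mul_one, Real.norm_eq_abs]

theorem abs_amp_le (n : ℕ) (lam0 : ℂ) (k : Fin n) : |amp n lam0 k| ≤ ∑ j, |amp n lam0 j| :=
  single_le_sum (f := fun j => |amp n lam0 j|) (fun _ _ => abs_nonneg _) (mem_univ k)

/-- The error keeps the factor `‖W‖` because `W` may itself be small; what matters later is the
error relative to `‖W‖²`. -/
theorem isBigO_star_mul_sub {Ω : Type*} {l : Filter Ω} {P Q W : Ω → ℂ} {ε : Ω → ℝ}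
    (hε : ∀ᶠ ω in l, 0 ≤ ε ω) (hP : (fun ω => P ω - W ω) =O[l] ε)
    (hQ : (fun ω => Q ω - W ω) =O[l] ε) :
    (fun ω => star (P ω) * Q ω - star (W ω) * W ω) =O[l] fun ω => ‖W ω‖ * ε ω + ε ω ^ 2 := by
  have hW : W =O[l] fun ω => ‖W ω‖ := isBigO_of_le _ fun ω => by simp
  have h1 := isBigO_star_mul hP hW
  have h2 := isBigO_star_mul hW hQ
  have h3 := isBigO_star_mul hP hQ
  have hb1 : (fun ω => ‖W ω‖ * ε ω) =O[l] fun ω => ‖W ω‖ * ε ω + ε ω ^ 2 := by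
    refine IsBigO.of_bound 1 ?_
    filter_upwards [hε] with ω hω
    rw [one_mul, Real.norm_of_nonneg (by positivity), Real.norm_of_nonneg (by positivity)]
    nlinarith [sq_nonneg (ε ω)]
  have hb2 : (fun ω => ε ω * ε ω) =O[l] fun ω => ‖W ω‖ * ε ω + ε ω ^ 2 := by
    refine IsBigO.of_bound 1 ?_
    filter_upwards [hε] with ω hω
    rw [one_mul, Real.norm_of_nonneg (by positivity), Real.norm_of_nonneg (by positivity)]
    nlinarith [mul_nonneg (norm_nonneg (W ω)) hω]
  have hb1' : (fun ω => ε ω * ‖W ω‖) =O[l] fun ω => ‖W ω‖ * ε ω + ε ω ^ 2 := by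
    simpa only [mul_comm] using hb1
  refine (((h1.trans hb1').add (h2.trans hb1)).add (h3.trans hb2)).congr_left fun ω => ?_
  simp only [star_sub]
  ring

theorem norm_div_sub_one_le {a b W : ℂ} {η : ℝ} (hη : η ≤ 1 / 2) (hW : W ≠ 0)
    (ha : ‖a - star W * W‖ ≤ η * ‖W‖ ^ 2) (hb : ‖b - star W * W‖ ≤ η * ‖W‖ ^ 2) :
    ‖a / b - 1‖ ≤ 4 * η := by
  have hWW : ‖star W * W‖ = ‖W‖ ^ 2 := by rw [norm_mul, norm_star, pow_two]
  have hpos : 0 < ‖W‖ ^ 2 := by have := norm_pos_iff.2 hW; positivity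
  have hbn : ‖W‖ ^ 2 / 2 ≤ ‖b‖ := by
    have h1 := norm_sub_norm_le (star W * W) b
    rw [hWW, norm_sub_rev] at h1
    nlinarith
  have hb0 : b ≠ 0 := norm_pos_iff.1 (lt_of_lt_of_le (by positivity) hbn)
  have hη0 : 0 ≤ η := by
    have := (norm_nonneg _).trans ha
    by_contra hc
    nlinarith
  have hab : ‖a - b‖ ≤ 2 * η * ‖W‖ ^ 2 := by
    have h1 := norm_sub_le (a - star W * W) (b - star W * W)
    rw [sub_sub_sub_cancel_right] at h1
    linarith
  rw [div_sub_one hb0, norm_div, div_le_iff₀ (norm_pos_iff.2 hb0)]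
  nlinarith

variable {n : ℕ} {lam0 lam1 : ℂ} {chi : PowerSeries ℂ}

/-- The scale of the global estimates. -/
def farScale (n : ℕ) (lam0 : ℂ) (chi : PowerSeries ℂ) (ω : ℝ × ℝ × ℝ) : ℝ :=
  max ω.1 ‖waveCoord n lam0 chi ω.2.1 ω.2.2‖

/-- The filter restricts only `A`, so the resulting estimates are uniform in `(x, t)`. The base
point is the coordinate of the point itself, which makes the bounded-distance condition trivial. -/
theorem scaleBounds_far (hlam0 : lam0.im ≠ 0) (h1 : chi1 chi ≠ 0) :
    ScaleBounds n lam0 chi (comap (fun ω : ℝ × ℝ × ℝ => ω.1) atTop) (fun ω => ω.1)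
      (fun ω => ω.2.1) (fun ω => ω.2.2) (farScale n lam0 chi)
      (fun ω => waveCoord n lam0 chi ω.2.1 ω.2.2) := by
  obtain ⟨K, hK, h⟩ := exists_abs_le_waveCoord (n := n) hlam0 h1
  have hle : ∀ ω, ‖waveCoord n lam0 chi ω.2.1 ω.2.2‖ ≤ farScale n lam0 chi ω :=
    fun ω => le_max_right _ _
  have habs : ∀ ω, farScale n lam0 chi ω ≤ ‖farScale n lam0 chi ω‖ := fun ω => le_abs_self _
  have ht : Tendsto (fun ω : ℝ × ℝ × ℝ => ω.1) (comap (fun ω : ℝ × ℝ × ℝ => ω.1) atTop) atTop :=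
    tendsto_comap
  refine ⟨tendsto_atTop_mono (fun ω => le_max_left _ _) ht, ?_, ?_, ?_, ?_, ?_⟩
  · refine IsBigO.of_bound 1 ?_
    filter_upwards [ht.eventually_ge_atTop 0] with ω hω
    rw [one_mul, Real.norm_of_nonneg hω]
    exact (le_max_left _ _).trans (habs ω)
  · refine IsBigO.of_bound K (Eventually.of_forall fun ω => ?_)
    exact (h _ _).1.trans (mul_le_mul_of_nonneg_left ((hle ω).trans (habs ω)) hK.le)
  · refine IsBigO.of_bound K (Eventually.of_forall fun ω => ?_)
    exact (h _ _).2.trans (mul_le_mul_of_nonneg_left ((hle ω).trans (habs ω)) hK.le)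
  · refine IsBigO.of_bound 1 (Eventually.of_forall fun ω => ?_)
    rw [one_mul]
    exact (hle ω).trans (habs ω)
  · simp only [sub_self]
    exact isBigO_zero _ _

/-- The leading part of the scaled minors, far from all positions. -/
def farMinor (n : ℕ) (lam0 : ℂ) (chi : PowerSeries ℂ) (kap : Fin n → ℕ → ℂ) (N : Fin n → ℕ)
    (ω : ℝ × ℝ × ℝ) : ℂ :=
  (rowMatrix (baseRow n kap N (ω.1 / farScale n lam0 chi ω)
    (waveCoord n lam0 chi ω.2.1 ω.2.2 / farScale n lam0 chi ω)) fun i => i).det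

theorem detSum_far (hn : 1 ≤ n) (hlam0 : lam0.im ≠ 0) (h1 : chi1 chi ≠ 0)
    (hchi : IsCharBranch n lam0 lam1 chi) (N : Fin n → ℕ) (kap : Fin n → ℕ → ℂ)
    (s : Option (Fin n)) :
    (fun ω : ℝ × ℝ × ℝ => detSum n lam0 lam1 chi N (largeParam n kap ω.1) ω.2.1 ω.2.2 s
        (farScale n lam0 chi ω) -
      star (farMinor n lam0 chi kap N ω) * farMinor n lam0 chi kap N ω)
      =O[comap (fun ω : ℝ × ℝ × ℝ => ω.1) atTop] fun ω =>
        ‖farMinor n lam0 chi kap N ω‖ * (farScale n lam0 chi ω)⁻¹ +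
          (farScale n lam0 chi ω)⁻¹ ^ 2 := by
  have H := scaleBounds_far (n := n) hlam0 h1
  have hpos : ∀ᶠ ω in comap (fun ω : ℝ × ℝ × ℝ => ω.1) atTop,
      0 ≤ (farScale n lam0 chi ω)⁻¹ := by
    filter_upwards [H.scale.eventually_ge_atTop 0] with ω hω
    exact inv_nonneg.2 hω
  have h2 := minorSum_first H.scale (C1 n lam0 chi) (lt_rowBound (N := N)).le
    (fun g => H.scaledMinor_isBigO (kap := kap) hn hchi s 1 g)
    (fun g => H.scaledMinor_isBigO (kap := kap) hn hchi s (-1) g)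
  have h3 := isBigO_star_mul_sub hpos
    (H.scaledMinor_first (kap := kap) (N := N) hn hchi s 1
      (lowRows (lt_rowBound (N := N)).le))
    (H.scaledMinor_first (kap := kap) (N := N) hn hchi s (-1)
      (lowRows (lt_rowBound (N := N)).le))
  have h4 : (fun ω => (farScale n lam0 chi ω)⁻¹ ^ 2)
      =O[comap (fun ω : ℝ × ℝ × ℝ => ω.1) atTop] fun ω =>
        ‖farMinor n lam0 chi kap N ω‖ * (farScale n lam0 chi ω)⁻¹ +
          (farScale n lam0 chi ω)⁻¹ ^ 2 := by
    refine IsBigO.of_bound 1 ?_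
    filter_upwards [hpos] with ω hω
    rw [one_mul, Real.norm_of_nonneg (by positivity), Real.norm_of_nonneg (by positivity)]
    nlinarith [mul_nonneg (norm_nonneg (farMinor n lam0 chi kap N ω)) hω]
  refine ((h2.trans h4).add h3).congr_left fun ω => ?_
  exact sub_add_sub_cancel _ _ _

/-- The minor is the leading coefficient times one factor per root. After scaling, each factor is at
least `ρ / B`, and all but at most one are at least `m`. -/
theorem norm_farMinor_ge {N : Fin n → ℕ} {kap : Fin n → ℕ → ℂ}
    (hnodup : (gmam n N kap).roots.Nodup) :
    ∃ m G : ℝ, 0 < m ∧ 0 < G ∧ ∀ (ω : ℝ × ℝ × ℝ) (ρ : ℝ), 0 < ω.1 → 0 ≤ ρ →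
      ρ ≤ m * farScale n lam0 chi ω →
      (∀ w, (gmam n N kap).IsRoot w → ρ ≤ ‖waveCoord n lam0 chi ω.2.1 ω.2.2 - w * ω.1‖) →
      G * ρ ≤ ‖farMinor n lam0 chi kap N ω‖ * farScale n lam0 chi ω := by
  set s := (gmam n N kap).roots.toFinset with hs
  obtain ⟨m, hm, hm1, hsep⟩ := exists_separation s
  have hlead : 0 < ‖(gmamWronskian n N kap).leadingCoeff‖ :=
    norm_pos_iff.2 (Polynomial.leadingCoeff_ne_zero.2 (gmamWronskian_ne_zero N kap))
  refine ⟨m, ‖(gmamWronskian n N kap).leadingCoeff‖ * m ^ #s, hm, by positivity, ?_⟩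
  intro ω ρ hA hρ hρm hroot
  set B := farScale n lam0 chi ω with hB
  have hAB : ω.1 ≤ B := le_max_left _ _
  have hBpos : 0 < B := hA.trans_le hAB
  have hBne : (B : ℂ) ≠ 0 := by exact_mod_cast hBpos.ne'
  -- Whichever of `A` and the modulus of the coordinate attains the maximum `B` becomes one after
  -- division.
  have hcase : ω.1 / B = 1 ∨ ‖waveCoord n lam0 chi ω.2.1 ω.2.2 / B‖ = 1 := by
    rw [norm_div, Complex.norm_real, Real.norm_of_nonneg hBpos.le, div_eq_one_iff_eq hBpos.ne',
      div_eq_one_iff_eq hBpos.ne']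
    rcases max_choice ω.1 ‖waveCoord n lam0 chi ω.2.1 ω.2.2‖ with h | h
    · exact Or.inl h.symm
    · exact Or.inr h.symm
  have hdet : farMinor n lam0 chi kap N ω = (gmamWronskian n N kap).leadingCoeff *
      ∏ w ∈ s, (waveCoord n lam0 chi ω.2.1 ω.2.2 / B - (ω.1 / B : ℝ) * w) := by
    have h1 := det_baseRow_eq N kap (a := ω.1 / B) (by positivity)
      (waveCoord n lam0 chi ω.2.1 ω.2.2 / B)
    rw [farMinor, ← hB, Finset.prod, hs, Multiset.toFinset_val, hnodup.dedup, ← h1]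
    push_cast
    rfl
  have hprod := prod_ge_of_separated s
    (fun w => ‖waveCoord n lam0 chi ω.2.1 ω.2.2 / B - (ω.1 / B : ℝ) * w‖) hm hm1
    (δ := ρ / B) (by positivity) (by rwa [div_le_iff₀ hBpos])
    (fun w hw => ?_) (fun w hw w' hw' hne => hsep _ _ (by positivity) hcase w hw w' hw' hne)
  · rw [hdet, norm_mul, norm_prod, mul_assoc, mul_assoc]
    refine mul_le_mul_of_nonneg_left ?_ hlead.le
    calc m ^ #s * ρ = ρ / B * m ^ #s * B := by field_simp
      _ ≤ _ := mul_le_mul_of_nonneg_right hprod hBpos.le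
  · have hw' : (gmam n N kap).IsRoot w := by
      rw [hs, Multiset.mem_toFinset] at hw
      exact (Polynomial.mem_roots'.1 hw).2
    have h2 : waveCoord n lam0 chi ω.2.1 ω.2.2 / B - ((ω.1 / B : ℝ) : ℂ) * w =
        (waveCoord n lam0 chi ω.2.1 ω.2.2 - w * ω.1) / B := by
      push_cast
      field_simp
    rw [h2, norm_div, Complex.norm_real, Real.norm_of_nonneg hBpos.le]
    exact div_le_div_of_nonneg_right (hroot w hw') hBpos.le

/-- Both determinants equal `‖W‖²` up to a relative error of order `1 / (‖W‖ B)`, and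
`norm_farMinor_ge` makes `‖W‖ B` as large as desired. -/
theorem far_field (hn : 1 ≤ n) (hlam0 : lam0.im ≠ 0) (h1 : chi1 chi ≠ 0)
    (hchi : IsCharBranch n lam0 lam1 chi) {N : Fin n → ℕ} {kap : Fin n → ℕ → ℂ}
    (hnodup : (gmam n N kap).roots.Nodup) {ε : ℝ} (hε : 0 < ε) :
    ∃ R A₀ : ℝ, 0 < A₀ ∧ ∀ A : ℝ, A₀ ≤ A → ∀ x t : ℝ,
      (∀ z : ℂ, (gmam n N kap).IsRoot z → R ≤ dist2 (x, t) (rwPos n lam0 lam1 chi N kap A z)) →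
      ∀ k : Fin n, ‖qRW n lam0 lam1 chi N (largeParam n kap A) k x t - planeWave n lam0 k x t‖
        < ε := by
  have H := scaleBounds_far (n := n) hlam0 h1
  choose c hc using fun s => (detSum_far hn hlam0 h1 hchi N kap s).bound
  have hall := eventually_all.2 hc
  rw [eventually_comap] at hall
  obtain ⟨A₁, hA₁⟩ := eventually_atTop.1 hall
  obtain ⟨m, G, hm, hG, hfar⟩ := norm_farMinor_ge (lam0 := lam0) (chi := chi) hnodup
  obtain ⟨K, hK, hdist⟩ := exists_dist2_le (n := n) hlam0 h1
  set C := ∑ s, |c s| with hC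
  have hC0 : 0 ≤ C := by positivity
  have hcC : ∀ s, c s ≤ C := fun s => (le_abs_self _).trans
    (single_le_sum (f := fun s => |c s|) (fun _ _ => abs_nonneg _) (mem_univ s))
  set M := ∑ j, |amp n lam0 j| with hM
  have hM0 : 0 ≤ M := by positivity
  set E := ∑ w ∈ (gmam n N kap).roots.toFinset, ‖Delta n lam0 lam1 chi N kap w‖ with hE
  have hE0 : 0 ≤ E := by positivity
  -- The target size of `‖W‖ B`. The term `4 C` yields `η = 2 C / r ≤ 1/2`, the last term yields `4
  -- η M < ε`, and `1` ensures `r ≥ 1`.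
  set r := 1 + 4 * C + 8 * C * (M + 1) / ε with hr
  have hr1 : 1 ≤ r := by
    have : 0 ≤ 8 * C * (M + 1) / ε := by positivity
    linarith
  set ρ := r / G with hρ
  have hρpos : 0 < ρ := by positivity
  -- `E` compensates for the corrections `Δ` between the positions and the points `w A`; `K`
  -- converts to Euclidean distance. `A ≥ ρ / m` guarantees `ρ ≤ m B`.
  refine ⟨K * (E + ρ), max 1 (max A₁ (ρ / m)), by positivity, fun A hA x t hxt k => ?_⟩
  have hA1 : 1 ≤ A := (le_max_left _ _).trans hA
  have hAA₁ : A₁ ≤ A := ((le_max_left _ _).trans (le_max_right _ _)).trans hA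
  have hAm : ρ / m ≤ A := ((le_max_right _ _).trans (le_max_right _ _)).trans hA
  set B := farScale n lam0 chi (A, x, t) with hB
  set W := farMinor n lam0 chi kap N (A, x, t) with hW
  have hAB : A ≤ B := le_max_left _ _
  have hBpos : 0 < B := by linarith
  have hroot : ∀ w, (gmam n N kap).IsRoot w → ρ ≤ ‖waveCoord n lam0 chi x t - w * A‖ := by
    intro w hw
    have h2 := (hxt w hw).trans (hdist _ _)
    rw [waveCoord_rwPos hlam0 h1] at h2
    have h3 := le_of_mul_le_mul_left h2 hK
    have h4 : waveCoord n lam0 chi (x, t).1 (x, t).2 - (w * A - Delta n lam0 lam1 chi N kap w) =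
        waveCoord n lam0 chi x t - w * A + Delta n lam0 lam1 chi N kap w := by
      show waveCoord n lam0 chi x t - _ = _
      ring
    rw [h4] at h3
    have h5 := norm_add_le (waveCoord n lam0 chi x t - w * A) (Delta n lam0 lam1 chi N kap w)
    have h6 : ‖Delta n lam0 lam1 chi N kap w‖ ≤ E :=
      single_le_sum (f := fun w => ‖Delta n lam0 lam1 chi N kap w‖) (fun _ _ => norm_nonneg _)
        (Multiset.mem_toFinset.2 ((Polynomial.mem_roots (gmam_ne_zero N kap)).2 hw))
    linarith
  have hWB : r ≤ ‖W‖ * B := by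
    have h2 := hfar (A, x, t) ρ (by show 0 < A; linarith) hρpos.le ?_ hroot
    · rwa [hρ, mul_div_cancel₀ _ hG.ne'] at h2
    · rw [div_le_iff₀ hm] at hAm
      rw [mul_comm]
      exact hAm.trans (mul_le_mul_of_nonneg_right hAB hm.le)
  have hWpos : 0 < ‖W‖ := by
    by_contra hc
    have : ‖W‖ = 0 := le_antisymm (not_lt.1 hc) (norm_nonneg _)
    rw [this, zero_mul] at hWB
    linarith
  set η := 2 * C / r with hη
  have hbound : ∀ s, ‖detSum n lam0 lam1 chi N (largeParam n kap A) x t s B - star W * W‖ ≤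
      η * ‖W‖ ^ 2 := by
    intro s
    have h2 := hA₁ A hAA₁ (A, x, t) rfl s
    refine h2.trans ?_
    rw [Real.norm_of_nonneg (by positivity)]
    have h3 : ‖W‖ * B⁻¹ ≤ ‖W‖ ^ 2 / r := by
      rw [← div_eq_mul_inv, div_le_div_iff₀ hBpos (by linarith)]
      nlinarith
    -- Here `r ≥ 1` enters: `r ≤ r² ≤ ‖W‖² B²`.
    have h4 : B⁻¹ ^ 2 ≤ ‖W‖ ^ 2 / r := by
      rw [inv_pow, inv_le_iff_one_le_mul₀ (by positivity), div_mul_eq_mul_div,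
        le_div_iff₀ (by linarith), one_mul]
      nlinarith
    have h5 : 0 ≤ ‖W‖ * B⁻¹ + B⁻¹ ^ 2 := by positivity
    calc c s * (‖W‖ * B⁻¹ + B⁻¹ ^ 2) ≤ C * (‖W‖ * B⁻¹ + B⁻¹ ^ 2) :=
          mul_le_mul_of_nonneg_right (hcC s) h5
      _ ≤ C * (‖W‖ ^ 2 / r + ‖W‖ ^ 2 / r) := mul_le_mul_of_nonneg_left (add_le_add h3 h4) hC0
      _ = η * ‖W‖ ^ 2 := by rw [hη]; ring
  have hη2 : η ≤ 1 / 2 := by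
    rw [hη, div_le_iff₀ (by linarith)]
    have : 0 ≤ 8 * C * (M + 1) / ε := by positivity
    linarith
  have hratio := norm_div_sub_one_le hη2 (norm_pos_iff.1 hWpos) (hbound (some k)) (hbound none)
  rw [qRW_eq hlam0 h1 k x t hBpos.ne']
  have h2 : ∀ p q : ℂ, p * q - p = p * (q - 1) := fun p q => by ring
  rw [h2, norm_mul, norm_planeWave]
  have h3 : |amp n lam0 k| ≤ M := abs_amp_le n lam0 k
  calc |amp n lam0 k| * _ ≤ M * (4 * η) :=
        mul_le_mul h3 hratio (norm_nonneg _) hM0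
    _ < ε := by
        rw [hη]
        have h4 : M * (4 * (2 * C / r)) = 8 * C * M / r := by ring
        rw [h4, div_lt_iff₀ (by linarith), hr]
        have h5 : ε * (1 + 4 * C + 8 * C * (M + 1) / ε) =
            ε + 4 * C * ε + 8 * C * (M + 1) := by field_simp
        rw [h5]
        nlinarith [mul_nonneg hC0 hε.le]

end FarField

end RogueWave

end

/-! ### Determinants at a root of the Wronskian. -/

noncomputable section

namespace RogueWave

open Finset Asymptotics Filter

section RootDet

variable {n : ℕ} {N : Fin n → ℕ} {kap : Fin n → ℕ → ℂ} {z : ℂ}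

theorem sum_pos_of_isRoot (hz : (gmam n N kap).IsRoot z) : 0 < ∑ l, N l := by
  by_contra h
  have : IsEmpty (Fin (∑ l, N l)) := by
    rw [not_lt, Nat.le_zero] at h
    rw [h]
    infer_instance
  have h1 := (isRoot_gmam_iff N kap).1 hz
  rw [gmamWronskian, Matrix.det_isEmpty, Polynomial.eval_one] at h1
  exact one_ne_zero h1

theorem det_baseRow_root (hz : (gmam n N kap).IsRoot z) :
    (rowMatrix (baseRow n kap N 1 z) fun i => i).det = 0 := by
  rw [← eval_det_rowMatrix, ← gmamWronskian_eq]
  exact (isRoot_gmam_iff N kap).1 hz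

theorem sum_det_baseRow_succ (hN : 0 < ∑ l, N l) :
    ∑ i : Fin (∑ l, N l), ((rowMatrix (baseRow n kap N 1 z) fun i => i).updateRow i
      (baseRow n kap N 1 z (i + 1))).det =
      (Polynomial.derivative (gmamWronskian n N kap)).eval z := by
  rw [sum_det_updateRow_succ _ hN, derivative_gmamWronskian, sum_det_updateRow_succ _ hN,
    eval_det_rowMatrix]

/-- The normalizing constant cancels in the quotient, so `Δ`, defined with the monic polynomials,
matches the unnormalized determinants. -/
theorem sum_det_baseRow_succ_succ (hz : (gmam n N kap).IsRoot z)
    (hL : (Polynomial.derivative (gmamWronskian n N kap)).eval z ≠ 0) :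
    ∑ i : Fin (∑ l, N l), ((rowMatrix (baseRow n kap N 1 z) fun i => i).updateRow i
      (baseRow n kap N 1 z (i + 2))).det =
      (gmam2 n N kap).eval z / (Polynomial.derivative (gmam n N kap)).eval z *
        (Polynomial.derivative (gmamWronskian n N kap)).eval z := by
  rw [sum_det_updateRow_succ_succ _ (sum_pos_of_isRoot hz) (det_baseRow_root hz),
    ← eval_det_rowMatrix, ← eval_det_rowMatrix, ← shiftedDet_eq, ← shiftedDet_eq, gmam2, gmam,
    Polynomial.derivative_C_mul, Polynomial.eval_mul, Polynomial.eval_mul, Polynomial.eval_C,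
    Polynomial.eval_add, mul_div_mul_left _ _ (gmamConst_ne_zero N kap), div_mul_cancel₀ _ hL]

end RootDet

section Asymptotics

variable {Ω : Type*} {l : Filter Ω} {f g F G : Ω → ℂ} {ε : Ω → ℝ}

theorem isBigO_star_mul_sub_star_mul (hε : ε =O[l] fun _ => (1 : ℝ))
    (hf : (fun ω => f ω - F ω) =O[l] ε) (hg : (fun ω => g ω - G ω) =O[l] ε)
    (hF : F =O[l] fun _ => (1 : ℝ)) (hG : G =O[l] fun _ => (1 : ℝ)) :
    (fun ω => star (f ω) * g ω - star (F ω) * G ω) =O[l] ε := by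
  have h1 := isBigO_star_mul hf hG
  have h2 := isBigO_star_mul hF hg
  have h3 := isBigO_star_mul hf (hg.trans hε)
  simp only [mul_one, one_mul] at h1 h2 h3
  refine ((h1.add h2).add h3).congr_left fun ω => ?_
  simp only [star_sub]
  ring

theorem isBigO_inv_of_norm_ge {m : ℝ} (hm : 0 < m) (hG : ∀ᶠ ω in l, m ≤ ‖G ω‖) :
    (fun ω => (G ω)⁻¹) =O[l] fun _ => (1 : ℝ) := by
  refine IsBigO.of_bound m⁻¹ ?_
  filter_upwards [hG] with ω hω
  rw [norm_inv, norm_one, mul_one]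
  exact inv_anti₀ hm hω

theorem isBigO_div_sub_div {m : ℝ} (hm : 0 < m) (hε : Tendsto ε l (nhds 0))
    (hf : (fun ω => f ω - F ω) =O[l] ε) (hg : (fun ω => g ω - G ω) =O[l] ε)
    (hF : F =O[l] fun _ => (1 : ℝ)) (hG : ∀ᶠ ω in l, m ≤ ‖G ω‖) :
    (fun ω => f ω / g ω - F ω / G ω) =O[l] ε := by
  have hsmall : ∀ᶠ ω in l, ‖g ω - G ω‖ < m / 2 := by
    have := (hg.trans_tendsto hε).norm
    rw [norm_zero] at this
    exact this.eventually_lt_const (by positivity)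
  have hgm : ∀ᶠ ω in l, m / 2 ≤ ‖g ω‖ := by
    filter_upwards [hsmall, hG] with ω h1 h2
    have h3 := norm_sub_norm_le (G ω) (g ω)
    rw [norm_sub_rev] at h3
    linarith
  have hgi := isBigO_inv_of_norm_ge (half_pos hm) hgm
  have hGi := isBigO_inv_of_norm_ge hm hG
  have h1 := hf.mul hgi
  have h2 := ((hF.mul hg).mul hgi).mul hGi
  simp only [mul_one, one_mul] at h1 h2
  refine (h1.sub h2).congr' ?_ EventuallyEq.rfl
  filter_upwards [hgm, hG] with ω h3 h4
  have h5 : g ω ≠ 0 := norm_pos_iff.1 (by linarith)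
  have h6 : G ω ≠ 0 := norm_pos_iff.1 (by linarith)
  field_simp
  ring

end Asymptotics

/-! ### The limiting quotient is the first-order rogue wave. -/

section FirstOrderWave

variable {n : ℕ} {lam0 lam1 : ℂ} {chi : PowerSeries ℂ}

/-- The limit of the normalized determinants near a position, up to a constant factor. -/
def localTau (n : ℕ) (lam0 : ℂ) (chi : PowerSeries ℂ) (s : Option (Fin n)) (x t : ℝ) : ℂ :=
  star (waveCoord n lam0 chi x t + shift2 n lam0 chi s 1) *
    (waveCoord n lam0 chi x t - shift2 n lam0 chi s 1) + C1 n lam0 chi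

theorem localTau_none (x t : ℝ) :
    localTau n lam0 chi none x t = ((‖waveCoord n lam0 chi x t‖ ^ 2 + C1 n lam0 chi : ℝ) : ℂ) := by
  rw [localTau, shift2, Pi.zero_apply, add_zero, sub_zero, ← starRingEnd_apply, Complex.conj_mul']
  push_cast
  rfl

theorem C1_le_norm_localTau_none (hlam0 : lam0.im ≠ 0) (h1 : chi1 chi ≠ 0) (x t : ℝ) :
    C1 n lam0 chi ≤ ‖localTau n lam0 chi none x t‖ := by
  have h := C1_pos (n := n) hlam0 h1
  rw [localTau_none, Complex.norm_real, Real.norm_of_nonneg (by positivity)]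
  linarith [sq_nonneg ‖waveCoord n lam0 chi x t‖]

/-- Here `C₁ = |χ^{[1]}|² / (4 (Im χ₀)²)` and `h_{2,1}^{[k]} = χ^{[1]} / (χ₀ + b_k)`, so
`|χ^{[1]}|²` is a common factor of both expressions and cancels. -/
theorem localTau_div_none (hlam0 : lam0.im ≠ 0) (h1 : chi1 chi ≠ 0)
    (hchi : IsCharBranch n lam0 lam1 chi) (k : Fin n) (x t : ℝ) :
    localTau n lam0 chi (some k) x t / localTau n lam0 chi none x t = qHat n lam0 k x t := by
  have hm : (chi0 n lam0).im ≠ 0 := by rw [chi0_im]; exact specScale_ne_zero hlam0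
  have hp := chi0_add_wav_ne_zero (n := n) hlam0 k
  have h0 : localTau n lam0 chi none x t ≠ 0 :=
    norm_pos_iff.1 ((C1_pos hlam0 h1).trans_le (C1_le_norm_localTau_none hlam0 h1 x t))
  have hC : (C1 n lam0 chi : ℂ) = chi1 chi * star (chi1 chi) * (1 / (4 * (chi0 n lam0).im ^ 2) : ℝ) := by
    have h2 : ‖chi0 n lam0 - star (chi0 n lam0)‖ ^ 2 = 4 * (chi0 n lam0).im ^ 2 := by
      rw [chi0_sub_star, ← chi0_im]
      rw [norm_mul, norm_mul, Complex.norm_I, Complex.norm_real, mul_one, mul_pow, Real.norm_eq_abs,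
        sq_abs]
      norm_num
    rw [C1, h2, ← starRingEnd_apply, Complex.mul_conj']
    push_cast
    ring
  have hnone : localTau n lam0 chi none x t = chi1 chi * star (chi1 chi) *
      (((x + (chi0 n lam0).re * t) ^ 2 + (chi0 n lam0).im ^ 2 * t ^ 2
        + 1 / (4 * (chi0 n lam0).im ^ 2) : ℝ) : ℂ) := by
    rw [localTau, hC, shift2, waveCoord]
    have h3 := Complex.re_add_im (chi0 n lam0)
    generalize (chi0 n lam0).re = a at *
    generalize (chi0 n lam0).im = m at *
    rw [← h3]
    simp only [Pi.zero_apply, add_zero, sub_zero, star_add, star_mul', Complex.star_def,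
      Complex.conj_I, Complex.conj_ofReal]
    push_cast
    linear_combination (-(chi1 chi * (starRingEnd ℂ) (chi1 chi) * ((x + a * t) ^ 2 - Complex.I ^ 2 * m ^ 2 * t ^ 2)) - chi1 chi * (starRingEnd ℂ) (chi1 chi) * m ^ 2 * t ^ 2) * Complex.I_sq
  have hsome : localTau n lam0 chi (some k) x t = chi1 chi * star (chi1 chi) *
      ((((x + (chi0 n lam0).re * t) ^ 2 + (chi0 n lam0).im ^ 2 * t ^ 2
        + 1 / (4 * (chi0 n lam0).im ^ 2) : ℝ) : ℂ) +
      2 * Complex.I / ((‖chi0 n lam0 + (wav n lam0 k : ℂ)‖ ^ 2 : ℝ) : ℂ) *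
    (((((chi0 n lam0).re + wav n lam0 k) * (x + (chi0 n lam0).re * t)
        - (chi0 n lam0).im ^ 2 * t : ℝ) : ℂ) + Complex.I / 2)) := by
    have h4 : ((‖chi0 n lam0 + (wav n lam0 k : ℂ)‖ ^ 2 : ℝ) : ℂ) =
        (chi0 n lam0 + (wav n lam0 k : ℂ)) * star (chi0 n lam0 + (wav n lam0 k : ℂ)) := by
      rw [← starRingEnd_apply, Complex.mul_conj']
      push_cast
      rfl
    have hp' := star_ne_zero.2 hp
    have h5 : localTau n lam0 chi (some k) x t = localTau n lam0 chi none x t +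
        chi1 chi * star (chi1 chi) * (Complex.I * (star ((x : ℂ) + chi0 n lam0 * t) *
          star (chi0 n lam0 + (wav n lam0 k : ℂ)) +
          ((x : ℂ) + chi0 n lam0 * t) * (chi0 n lam0 + (wav n lam0 k : ℂ))) - 1) /
          ((chi0 n lam0 + (wav n lam0 k : ℂ)) * star (chi0 n lam0 + (wav n lam0 k : ℂ))) := by
      rw [localTau, localTau, shift2, shift2, h2_one hchi hlam0 k, waveCoord]
      simp only [Pi.zero_apply, add_zero, sub_zero, star_add, star_mul', star_div₀,
        Complex.star_def, Complex.conj_I, Complex.conj_ofReal] at hp' ⊢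
      field_simp
      ring
    rw [h5, hnone, h4, mul_add (chi1 chi * star (chi1 chi)),
      mul_div_assoc (chi1 chi * star (chi1 chi))]
    congr 2
    rw [div_mul_eq_mul_div]
    congr 1
    have h3 := Complex.re_add_im (chi0 n lam0)
    generalize (chi0 n lam0).re = a at *
    generalize (chi0 n lam0).im = m at *
    rw [← h3]
    simp only [star_add, star_mul', Complex.star_def,
      Complex.conj_I, Complex.conj_ofReal]
    push_cast
    linear_combination (2 * Complex.I * m ^ 2 * t - 1) * Complex.I_sq
  have hcc : chi1 chi * star (chi1 chi) ≠ 0 := mul_ne_zero h1 (star_ne_zero.2 h1)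
  rw [hnone] at h0
  rw [hsome, hnone, mul_div_mul_left _ _ hcc, add_div, div_self (right_ne_zero_of_mul h0), qHat]

end FirstOrderWave

/-! ### Asymptotics at bounded distance from a position. -/

section NearField

variable {n : ℕ} {lam0 lam1 : ℂ} {chi : PowerSeries ℂ} {N : Fin n → ℕ} {kap : Fin n → ℕ → ℂ}
  {z : ℂ} {R : ℝ}

/-- Large parameters, and points at distance at most `R` from the position that belongs
to `z`. -/
def nearFilter (n : ℕ) (lam0 lam1 : ℂ) (chi : PowerSeries ℂ) (N : Fin n → ℕ)
    (kap : Fin n → ℕ → ℂ) (z : ℂ) (R : ℝ) : Filter (ℝ × ℝ × ℝ) :=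
  comap (fun ω => ω.1) atTop ⊓ 𝓟 {ω | dist2 (ω.2.1, ω.2.2) (rwPos n lam0 lam1 chi N kap ω.1 z) ≤ R}

local notation "𝔫" => nearFilter n lam0 lam1 chi N kap z R

theorem tendsto_nearFilter : Tendsto (fun ω : ℝ × ℝ × ℝ => ω.1) 𝔫 atTop :=
  tendsto_comap.mono_left inf_le_left

/-- The wave coordinate relative to the position that belongs to `z`. -/
def relCoord (n : ℕ) (lam0 lam1 : ℂ) (chi : PowerSeries ℂ) (N : Fin n → ℕ)
    (kap : Fin n → ℕ → ℂ) (z : ℂ) (ω : ℝ × ℝ × ℝ) : ℂ :=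
  waveCoord n lam0 chi (ω.2.1 - (rwPos n lam0 lam1 chi N kap ω.1 z).1)
    (ω.2.2 - (rwPos n lam0 lam1 chi N kap ω.1 z).2)

theorem relCoord_eq (hlam0 : lam0.im ≠ 0) (h1 : chi1 chi ≠ 0) (ω : ℝ × ℝ × ℝ) :
    relCoord n lam0 lam1 chi N kap z ω =
      waveCoord n lam0 chi ω.2.1 ω.2.2 - z * ω.1 + Delta n lam0 lam1 chi N kap z := by
  rw [relCoord, waveCoord_sub, waveCoord_rwPos hlam0 h1]
  ring

theorem relCoord_isBigO : relCoord n lam0 lam1 chi N kap z =O[𝔫] fun _ => (1 : ℝ) := by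
  refine IsBigO.of_bound (‖chi1 chi‖ * (1 + ‖chi0 n lam0‖) * R) ?_
  filter_upwards [mem_inf_of_right (mem_principal_self _)] with ω hω
  rw [norm_one, mul_one, relCoord, waveCoord_sub]
  refine (norm_waveCoord_sub_le (ω.2.1, ω.2.2) _).trans ?_
  exact mul_le_mul_of_nonneg_left hω (by positivity)

theorem scaleBounds_near (hlam0 : lam0.im ≠ 0) (h1 : chi1 chi ≠ 0) :
    ScaleBounds n lam0 chi 𝔫 (fun ω => ω.1) (fun ω => ω.2.1) (fun ω => ω.2.2) (fun ω => ω.1)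
      (fun ω => z * ω.1) := by
  have ht := tendsto_nearFilter (n := n) (lam0 := lam0) (lam1 := lam1) (chi := chi) (N := N)
    (kap := kap) (z := z) (R := R)
  have hnear : (fun ω : ℝ × ℝ × ℝ => waveCoord n lam0 chi ω.2.1 ω.2.2 - z * ω.1)
      =O[𝔫] fun _ => (1 : ℝ) := by
    have h2 := (relCoord_isBigO (n := n) (lam0 := lam0) (lam1 := lam1) (chi := chi) (N := N)
      (kap := kap) (z := z) (R := R)).sub
        (isBigO_const_const (Delta n lam0 lam1 chi N kap z) (one_ne_zero (α := ℝ)) 𝔫)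
    refine h2.congr_left fun ω => ?_
    rw [relCoord_eq hlam0 h1]
    ring
  have hbase : (fun ω : ℝ × ℝ × ℝ => z * ω.1) =O[𝔫] fun ω => ω.1 :=
    (isBigO_of_le _ fun ω => by simp : (fun ω : ℝ × ℝ × ℝ => (ω.1 : ℂ)) =O[𝔫] fun ω => ω.1).const_mul_left z
  have hw : (fun ω : ℝ × ℝ × ℝ => waveCoord n lam0 chi ω.2.1 ω.2.2) =O[𝔫] fun ω => ω.1 := by
    simpa using (hnear.trans (isBigO_one_of_tendsto_atTop ht)).add hbase
  obtain ⟨K, hK, h⟩ := exists_abs_le_waveCoord (n := n) hlam0 h1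
  refine ⟨ht, isBigO_refl _ _, ?_, ?_, hbase, hnear⟩
  · exact (IsBigO.of_bound K (Eventually.of_forall fun ω => (h ω.2.1 ω.2.2).1)).trans hw
  · exact (IsBigO.of_bound K (Eventually.of_forall fun ω => (h ω.2.1 ω.2.2).2)).trans hw

/-- In the region considered, `(x, t)` stays at bounded distance from `A (x̂, t̂)`. -/
theorem second_order_near (hlam0 : lam0.im ≠ 0) (h1 : chi1 chi ≠ 0) :
    (fun ω : ℝ × ℝ × ℝ => (alpha n lam0 lam1 chi 2 * ω.2.1 +
        beta n lam0 lam1 chi 2 * Complex.I * ω.2.2) / ω.1 -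
      (alpha n lam0 lam1 chi 2 * (planePoint n lam0 chi z).1 +
        beta n lam0 lam1 chi 2 * Complex.I * (planePoint n lam0 chi z).2)) =O[𝔫]
      fun ω => ω.1⁻¹ := by
  have H := scaleBounds_near (n := n) (lam1 := lam1) (N := N) (kap := kap) (z := z) (R := R)
    hlam0 h1
  obtain ⟨K, hK, h⟩ := exists_abs_le_waveCoord (n := n) hlam0 h1
  have hw : ∀ ω : ℝ × ℝ × ℝ, waveCoord n lam0 chi (ω.2.1 - ω.1 * (planePoint n lam0 chi z).1)
      (ω.2.2 - ω.1 * (planePoint n lam0 chi z).2) =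
      waveCoord n lam0 chi ω.2.1 ω.2.2 - z * ω.1 := by
    intro ω
    rw [waveCoord_sub, waveCoord_smul, waveCoord_planePoint hlam0 h1, mul_comm z]
  have hx : (fun ω : ℝ × ℝ × ℝ => ((ω.2.1 - ω.1 * (planePoint n lam0 chi z).1 : ℝ) : ℂ))
      =O[𝔫] fun _ => (1 : ℝ) := by
    refine (IsBigO.of_bound K (Eventually.of_forall fun ω => ?_)).trans H.near
    rw [Complex.norm_real, ← hw]
    exact (h _ _).1
  have ht : (fun ω : ℝ × ℝ × ℝ => ((ω.2.2 - ω.1 * (planePoint n lam0 chi z).2 : ℝ) : ℂ))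
      =O[𝔫] fun _ => (1 : ℝ) := by
    refine (IsBigO.of_bound K (Eventually.of_forall fun ω => ?_)).trans H.near
    rw [Complex.norm_real, ← hw]
    exact (h _ _).2
  have hi : (fun ω : ℝ × ℝ × ℝ => (ω.1 : ℂ)⁻¹) =O[𝔫] fun ω => ω.1⁻¹ :=
    isBigO_of_le _ fun ω => by simp
  have h2 := ((hx.const_mul_left (alpha n lam0 lam1 chi 2)).add
    (ht.const_mul_left (beta n lam0 lam1 chi 2 * Complex.I))).mul hi
  simp only [one_mul] at h2
  refine h2.congr' ?_ EventuallyEq.rfl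
  filter_upwards [H.eventually_ne_zero] with ω hω
  have hω' : (ω.1 : ℂ) ≠ 0 := by exact_mod_cast hω
  push_cast
  field_simp
  ring

/-- The order-zero determinant vanishes at the root. Of the two terms of order `1/A`, the one with
`W^{[2]}` equals `Δ W'` up to `O(1/A)` after multiplication by `A`, and it turns the coordinate
relative to `z A` into the one relative to the corrected centre. -/
theorem lowMinor_near (hn : 1 ≤ n) (hlam0 : lam0.im ≠ 0) (hlam1 : lam1 ≠ 0) (h1 : chi1 chi ≠ 0)
    (hchi : IsCharBranch n lam0 lam1 chi) (hz : (gmam n N kap).IsRoot z)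
    (hL : (Polynomial.derivative (gmamWronskian n N kap)).eval z ≠ 0)
    (s : Option (Fin n)) (σ : ℂ) :
    (fun ω : ℝ × ℝ × ℝ => ω.1 * scaledMinor (gramFactor n lam0 lam1 chi N (largeParam n kap ω.1)
        ω.2.1 ω.2.2 s σ) (colDeg N) ω.1 (lowRows (lt_rowBound (N := N)).le) -
      (Polynomial.derivative (gmamWronskian n N kap)).eval z *
        (relCoord n lam0 lam1 chi N kap z ω + σ * shift2 n lam0 chi s 1)) =O[𝔫]
      fun ω => ω.1⁻¹ := by
  have H := scaleBounds_near (n := n) (lam1 := lam1) (N := N) (kap := kap) (z := z) (R := R)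
    hlam0 h1
  set L := (Polynomial.derivative (gmamWronskian n N kap)).eval z with hLdef
  have hA : (fun ω : ℝ × ℝ × ℝ => (ω.1 : ℂ)) =O[𝔫] fun ω => ω.1 := isBigO_of_le _ fun ω => by simp
  have h2 := hA.mul (H.scaledMinor_second (kap := kap) (N := N) hn hchi hlam0 hlam1 s σ)
  have h2' := h2.trans_eventuallyEq (g₂ := fun ω => ω.1⁻¹) (by
    filter_upwards [H.eventually_ne_zero] with ω hω
    field_simp)
  have h3 := (second_order_near (n := n) (lam1 := lam1) (N := N) (kap := kap) (z := z) (R := R)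
    hlam0 h1).mul (isBigO_const_const
      (∑ i : Fin (∑ l, N l), ((rowMatrix (baseRow n kap N 1 z) fun i => i).updateRow i
        (baseRow n kap N 1 z (i + 2))).det) (one_ne_zero (α := ℝ)) 𝔫)
  simp only [mul_one] at h3
  refine (h2'.add h3).congr' ?_ EventuallyEq.rfl
  filter_upwards [H.eventually_ne_zero] with ω hω
  have hω' : (ω.1 : ℂ) ≠ 0 := by exact_mod_cast hω
  rw [div_self hω', mul_div_cancel_right₀ _ hω', det_baseRow_root hz,
    sum_det_baseRow_succ (sum_pos_of_isRoot hz), ← hLdef, relCoord_eq hlam0 h1, Delta]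
  rw [sum_det_baseRow_succ_succ hz hL, ← hLdef]
  generalize (gmam2 n N kap).eval z / (Polynomial.derivative (gmam n N kap)).eval z = q
  field_simp
  ring

theorem nextMinor_near (hn : 1 ≤ n) (hlam0 : lam0.im ≠ 0) (h1 : chi1 chi ≠ 0)
    (hchi : IsCharBranch n lam0 lam1 chi) (hz : (gmam n N kap).IsRoot z)
    (s : Option (Fin n)) (σ : ℂ) :
    (fun ω : ℝ × ℝ × ℝ => scaledMinor (gramFactor n lam0 lam1 chi N (largeParam n kap ω.1)
        ω.2.1 ω.2.2 s σ) (colDeg N) ω.1 (nextRows (lt_rowBound (N := N))) -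
      (Polynomial.derivative (gmamWronskian n N kap)).eval z) =O[𝔫] fun ω => ω.1⁻¹ := by
  have H := scaleBounds_near (n := n) (lam1 := lam1) (N := N) (kap := kap) (z := z) (R := R)
    hlam0 h1
  refine (H.scaledMinor_first (kap := kap) (N := N) hn hchi s σ
    (nextRows (lt_rowBound (N := N)))).congr' ?_ EventuallyEq.rfl
  filter_upwards [H.eventually_ne_zero] with ω hω
  have hω' : (ω.1 : ℂ) ≠ 0 := by exact_mod_cast hω
  rw [div_self hω', mul_div_cancel_right₀ _ hω', ← sum_det_baseRow_succ (sum_pos_of_isRoot hz),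
    sum_det_updateRow_succ _ (sum_pos_of_isRoot hz)]
  simp only [nextRows_val]

/-- Both low minors are of order `1/A`, so their product has the same order `A⁻²` as the
contribution of the next row set, whose minors tend to `W'(z)`. The remaining row sets are `O(A⁻⁴)`.
-/
theorem detSum_near (hn : 1 ≤ n) (hlam0 : lam0.im ≠ 0) (hlam1 : lam1 ≠ 0) (h1 : chi1 chi ≠ 0)
    (hchi : IsCharBranch n lam0 lam1 chi) (hz : (gmam n N kap).IsRoot z)
    (hL : (Polynomial.derivative (gmamWronskian n N kap)).eval z ≠ 0) (s : Option (Fin n)) :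
    (fun ω : ℝ × ℝ × ℝ => (ω.1 : ℂ) ^ 2 *
        detSum n lam0 lam1 chi N (largeParam n kap ω.1) ω.2.1 ω.2.2 s ω.1 -
      star ((Polynomial.derivative (gmamWronskian n N kap)).eval z) *
        (Polynomial.derivative (gmamWronskian n N kap)).eval z *
        localTau n lam0 chi s (ω.2.1 - (rwPos n lam0 lam1 chi N kap ω.1 z).1)
          (ω.2.2 - (rwPos n lam0 lam1 chi N kap ω.1 z).2)) =O[𝔫] fun ω => ω.1⁻¹ := by
  have H := scaleBounds_near (n := n) (lam1 := lam1) (N := N) (kap := kap) (z := z) (R := R)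
    hlam0 h1
  set L := (Polynomial.derivative (gmamWronskian n N kap)).eval z with hLdef
  have hone := isBigO_inv_one H.scale
  have hA : (fun ω : ℝ × ℝ × ℝ => (ω.1 : ℂ) ^ 2) =O[𝔫] fun ω => ω.1 ^ 2 :=
    isBigO_of_le _ fun ω => by simp
  have h2 := hA.mul (minorSum_second H.scale (C1 n lam0 chi) (lt_rowBound (N := N))
    (sum_pos_of_isRoot hz) (fun g => H.scaledMinor_isBigO (kap := kap) hn hchi s 1 g)
    (fun g => H.scaledMinor_isBigO (kap := kap) hn hchi s (-1) g))
  have h2' : _ =O[𝔫] fun ω : ℝ × ℝ × ℝ => ω.1⁻¹ := h2.trans (by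
    refine IsBigO.of_bound 1 ?_
    filter_upwards [H.scale.eventually_ge_atTop 1] with ω hω
    have hpos : 0 < ω.1 := by linarith
    have h3 : ω.1 ^ 2 * ω.1⁻¹ ^ 4 = ω.1⁻¹ * ω.1⁻¹ := by field_simp
    rw [one_mul, h3, norm_mul]
    refine mul_le_of_le_one_left (norm_nonneg _) ?_
    rw [Real.norm_of_nonneg (by positivity)]
    exact inv_le_one_of_one_le₀ hω)
  have hlin : ∀ c : ℂ, (fun ω => L * (relCoord n lam0 lam1 chi N kap z ω + c * shift2 n lam0 chi s 1))
      =O[𝔫] fun _ => (1 : ℝ) := fun c =>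
    (relCoord_isBigO.add (isBigO_const_const _ (one_ne_zero (α := ℝ)) 𝔫)).const_mul_left L
  have hLc : (fun _ : ℝ × ℝ × ℝ => L) =O[𝔫] fun _ => (1 : ℝ) :=
    isBigO_const_const _ one_ne_zero _
  have h3 := isBigO_star_mul_sub_star_mul hone
    (lowMinor_near (R := R) hn hlam0 hlam1 h1 hchi hz hL s 1)
    (lowMinor_near (R := R) hn hlam0 hlam1 h1 hchi hz hL s (-1)) (hlin 1) (hlin (-1))
  have h4 := (isBigO_star_mul_sub_star_mul hone
    (nextMinor_near (R := R) hn hlam0 h1 hchi hz s 1)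
    (nextMinor_near (R := R) hn hlam0 h1 hchi hz s (-1)) hLc hLc).const_mul_left
      (C1 n lam0 chi : ℂ)
  refine ((h2'.add h3).add h4).congr' ?_ EventuallyEq.rfl
  filter_upwards [H.eventually_ne_zero] with ω hω
  have hω' : (ω.1 : ℂ) ≠ 0 := by exact_mod_cast hω
  rw [detSum, localTau, ← relCoord, ← hLdef]
  simp only [star_mul', star_add, one_mul, Complex.star_def, Complex.conj_ofReal]
  push_cast
  field_simp
  ring

theorem near_field (hn : 1 ≤ n) (hlam0 : lam0.im ≠ 0) (hlam1 : lam1 ≠ 0) (h1 : chi1 chi ≠ 0)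
    (hchi : IsCharBranch n lam0 lam1 chi) (hz : (gmam n N kap).IsRoot z)
    (hL : (Polynomial.derivative (gmamWronskian n N kap)).eval z ≠ 0) :
    ∃ K A₀ : ℝ, 0 < A₀ ∧ ∀ A : ℝ, A₀ ≤ A → ∀ x t : ℝ,
      dist2 (x, t) (rwPos n lam0 lam1 chi N kap A z) ≤ R → ∀ k : Fin n,
        ‖qRW n lam0 lam1 chi N (largeParam n kap A) k x t -
          qHat n lam0 k (x - (rwPos n lam0 lam1 chi N kap A z).1)
            (t - (rwPos n lam0 lam1 chi N kap A z).2) * planeWave n lam0 k x t‖ ≤ K * A⁻¹ := by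
  have H := scaleBounds_near (n := n) (lam1 := lam1) (N := N) (kap := kap) (z := z) (R := R)
    hlam0 h1
  set L := (Polynomial.derivative (gmamWronskian n N kap)).eval z with hLdef
  have hLL : star L * L ≠ 0 := mul_ne_zero (star_ne_zero.2 hL) hL
  have hF : ∀ s, (fun ω : ℝ × ℝ × ℝ => star L * L *
      localTau n lam0 chi s (ω.2.1 - (rwPos n lam0 lam1 chi N kap ω.1 z).1)
          (ω.2.2 - (rwPos n lam0 lam1 chi N kap ω.1 z).2)) =O[𝔫] fun _ => (1 : ℝ) := by
    intro s
    have hc : ∀ c : ℂ, (fun _ : ℝ × ℝ × ℝ => c) =O[𝔫] fun _ => (1 : ℝ) :=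
      fun c => isBigO_const_const c one_ne_zero _
    have hξ : relCoord n lam0 lam1 chi N kap z =O[𝔫] fun _ => (1 : ℝ) := relCoord_isBigO
    have h2 := isBigO_star_mul (hξ.add (hc (shift2 n lam0 chi s 1)))
      (hξ.sub (hc (shift2 n lam0 chi s 1)))
    simp only [mul_one] at h2
    exact (h2.add (hc _)).const_mul_left _
  -- The term `C₁ > 0` in the limit of the denominator bounds it away from zero uniformly, as the
  -- division estimate needs.
  have hG : ∀ ω : ℝ × ℝ × ℝ, ‖star L * L‖ * C1 n lam0 chi ≤ ‖star L * L *
      localTau n lam0 chi none (ω.2.1 - (rwPos n lam0 lam1 chi N kap ω.1 z).1)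
          (ω.2.2 - (rwPos n lam0 lam1 chi N kap ω.1 z).2)‖ := by
    intro ω
    rw [norm_mul (star L * L)]
    exact mul_le_mul_of_nonneg_left (C1_le_norm_localTau_none hlam0 h1 _ _) (norm_nonneg _)
  have hm : 0 < ‖star L * L‖ * C1 n lam0 chi :=
    mul_pos (norm_pos_iff.2 hLL) (C1_pos hlam0 h1)
  choose c hc using fun k : Fin n => (isBigO_div_sub_div hm
    (tendsto_inv_atTop_zero.comp H.scale)
    (detSum_near (R := R) hn hlam0 hlam1 h1 hchi hz hL (some k))
    (detSum_near (R := R) hn hlam0 hlam1 h1 hchi hz hL none) (hF (some k))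
    (Eventually.of_forall hG)).bound
  have hall := eventually_all.2 hc
  rw [nearFilter, eventually_inf_principal, eventually_comap] at hall
  obtain ⟨A₁, hA₁⟩ := eventually_atTop.1 hall
  set C := ∑ k, |c k| with hC
  have hC0 : 0 ≤ C := by positivity
  set M := ∑ j, |amp n lam0 j| with hM
  refine ⟨M * C, max 1 A₁, by positivity, fun A hA x t hxt k => ?_⟩
  have hA1 : 1 ≤ A := (le_max_left _ _).trans hA
  have hApos : 0 < A := by linarith
  have hne : (A : ℂ) ≠ 0 := by exact_mod_cast hApos.ne'
  have h2 := hA₁ A ((le_max_right _ _).trans hA) (A, x, t) rfl hxt k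
  simp only [Function.comp_apply] at h2
  rw [mul_div_mul_left _ _ hLL, localTau_div_none hlam0 h1 hchi,
    mul_div_mul_left _ _ (pow_ne_zero 2 hne), Real.norm_of_nonneg (inv_nonneg.2 hApos.le)] at h2
  rw [qRW_eq hlam0 h1 k x t hApos.ne', mul_comm (qHat _ _ _ _ _), ← mul_sub, norm_mul,
    norm_planeWave, mul_assoc]
  refine mul_le_mul (abs_amp_le n lam0 k) (h2.trans ?_) (norm_nonneg _) (by positivity)
  refine mul_le_mul_of_nonneg_right ((le_abs_self _).trans ?_) (inv_nonneg.2 hApos.le)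
  exact single_le_sum (f := fun k => |c k|) (fun _ _ => abs_nonneg _) (mem_univ k)

end NearField

end RogueWave

end

theorem theorem3 (n : ℕ) (hn : 1 ≤ n) (lam0 lam1 : ℂ) (hlam0 : lam0.im ≠ 0) (hlam1 : lam1 ≠ 0)
    (chi : PowerSeries ℂ) (hchi : RogueWave.IsCharBranch n lam0 lam1 chi)
    (N : Fin n → ℕ) (kap : Fin n → ℕ → ℂ)
    (hsimple : ∀ z : ℂ, (RogueWave.gmam n N kap).IsRoot z →
      (RogueWave.gmam n N kap).rootMultiplicity z = 1) :
    -- the number of the first-order rogue waves is `Γ = deg W`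
    ((RogueWave.gmam n N kap).natDegree : ℚ) = RogueWave.Gam n N ∧
    (RogueWave.gmam n N kap).roots.toFinset.card = (RogueWave.gmam n N kap).natDegree ∧
    -- their positions separate
    (∀ z w : ℂ, (RogueWave.gmam n N kap).IsRoot z → (RogueWave.gmam n N kap).IsRoot w → z ≠ w →
      Filter.Tendsto (fun A : ℝ => RogueWave.dist2 (RogueWave.rwPos n lam0 lam1 chi N kap A z)
        (RogueWave.rwPos n lam0 lam1 chi N kap A w)) Filter.atTop Filter.atTop) ∧
    -- the denominator of `q^𝒩` never vanishes
    (∀ A x t : ℝ, (RogueWave.Mmat n lam0 lam1 chi N (RogueWave.largeParam n kap A) x t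
      none).det ≠ 0) ∧
    -- asymptotics at bounded distance of a position
    (∀ z : ℂ, (RogueWave.gmam n N kap).IsRoot z → ∀ R : ℝ, 0 < R →
      ∃ K A₀ : ℝ, 0 < A₀ ∧ ∀ A : ℝ, A₀ ≤ A → ∀ x t : ℝ,
        RogueWave.dist2 (x, t) (RogueWave.rwPos n lam0 lam1 chi N kap A z) ≤ R →
        ∀ k : Fin n,
          ‖RogueWave.qRW n lam0 lam1 chi N (RogueWave.largeParam n kap A) k x t -
            RogueWave.qHat n lam0 k (x - (RogueWave.rwPos n lam0 lam1 chi N kap A z).1)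
                (t - (RogueWave.rwPos n lam0 lam1 chi N kap A z).2) *
              RogueWave.planeWave n lam0 k x t‖ ≤ K * A⁻¹) ∧
    -- the plane wave background far from all positions
    (∀ ε : ℝ, 0 < ε → ∃ R A₀ : ℝ, 0 < A₀ ∧ ∀ A : ℝ, A₀ ≤ A → ∀ x t : ℝ,
      (∀ z : ℂ, (RogueWave.gmam n N kap).IsRoot z →
        R ≤ RogueWave.dist2 (x, t) (RogueWave.rwPos n lam0 lam1 chi N kap A z)) →
      ∀ k : Fin n,
        ‖RogueWave.qRW n lam0 lam1 chi N (RogueWave.largeParam n kap A) k x t -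
          RogueWave.planeWave n lam0 k x t‖ < ε) := by
  have h1 := RogueWave.chi1_ne_zero hchi hlam0 hlam1
  have hnodup := RogueWave.nodup_roots_gmam N kap hsimple
  refine ⟨?_, ?_, fun z w _ _ hzw => RogueWave.tendsto_dist2_rwPos hlam0 h1 N kap hzw,
    fun A x t => RogueWave.Mmat_none_det_ne_zero hlam0 h1 x t, fun z hz R _ =>
      RogueWave.near_field hn hlam0 hlam1 h1 hchi hz
        (RogueWave.eval_derivative_gmamWronskian_ne_zero N kap hz (hsimple z hz)),
    fun ε hε => RogueWave.far_field hn hlam0 h1 hchi hnodup hε⟩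
  · rw [RogueWave.natDegree_gmam, RogueWave.wronskianDegree_eq_Gam]
  · rw [Multiset.toFinset_card_of_nodup hnodup, RogueWave.card_roots_gmam,
      RogueWave.natDegree_gmam]
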